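/- Let $M$ be a finite-dimensional real analytic manifold (Hausdorff, second countable, without boundary) with base point $\star$, let $\pi:P\to M$ be a smooth principal $U(1)$-bundle, let $u_0\in\pi^{-1}(\star)$, and let $\mathcal A$ be the set of smooth principal connections on $P$. A loop is a continuous map $\alpha:[0,1]\to M$ with $\alpha(0)=\alpha(1)=\star$ that is piecewise analytic: there is a partition $0=t_0\le t_1\le\dots\le t_n=1$ such that $\alpha$ agrees on each $[t_i,t_{i+1}]$ with a map that is analytic on a neighbourhood of $[t_i,t_{i+1}]$. A loop $\alpha$ is thin if it is homotopic to the constant loop $\star$ by a homotopy of based loops whose image is contained in the image of $\alpha$; two loops $\alpha,\beta$ are thin-equivalent if $\alpha\beta^{-1}$ is thin. Let $Loop_\star(M)$ be the group of loops modulo the equivalence relation generated by thin equivalence, with composition of loops as multiplication. For $A\in\mathcal A$ and a loop $\alpha$ there is a unique $H_A(\alpha)\in U(1)$ (the holonomy) with $u_0=\mathcal P^A_\alpha(u_0)\,H_A(\alpha)$, where $\mathcal P^A_\alpha(u_0)$ is the end point of the $A$-horizontal lift of $\alpha$ starting at $u_0$. The Wilson function of $\alpha$ is $T_\alpha:\mathcal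 A\to\mathbb C$, $T_\alpha(A)=H_A(\alpha)$, and $Hoop_\star(M)=\{T_\alpha\}$ is the set of all Wilson functions. Then $Hoop_\star(M)$ is a group under pointwise multiplication, $T_\alpha$ depends only on the class of $\alpha$ in $Loop_\star(M)$, and the map $\tau:Loop_\star(M)\to Hoop_\star(M)$, $\alpha\mapsto T_\alpha$, is a group homomorphism whose kernel is exactly the commutator subgroup of $Loop_\star(M)$. -/

import Mathlib

open Set
open scoped Manifold ContDiff

noncomputable section

namespace LoopHoop

/-! ### Piecewise analytic loops -/

section Loops

variable {E : Type*} [NormedAddCommGroup E] [NormedSpace ℝ E]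
  {H : Type*} [TopologicalSpace H] (I : ModelWithCorners ℝ E H)
  {M : Type*} [TopologicalSpace M] [ChartedSpace H M]

/-- On the closed interval `[a, b]` the path `γ` agrees with a map that is analytic at every point
of `[a, b]` (hence on an open neighbourhood of `[a, b]`). -/
def AgreesWithAnalyticOn {x y : M} (γ : Path x y) (a b : ℝ) : Prop :=
  ∃ c : ℝ → M, (∀ s ∈ Icc a b, ContMDiffAt 𝓘(ℝ, ℝ) I ω c s) ∧
    ∀ s : unitInterval, (s : ℝ) ∈ Icc a b → γ s = c s

/-- A continuous path is piecewise analytic if there is a partition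
`0 = t 0 ≤ t 1 ≤ ⋯ ≤ t n = 1` such that the path agrees with an analytic map on each
`[t i, t (i + 1)]`. -/
def IsPiecewiseAnalytic {x y : M} (γ : Path x y) : Prop :=
  ∃ (n : ℕ) (t : ℕ → ℝ), t 0 = 0 ∧ t n = 1 ∧ (∀ i < n, t i ≤ t (i + 1)) ∧
    ∀ i < n, AgreesWithAnalyticOn I γ (t i) (t (i + 1))

theorem IsPiecewiseAnalytic.refl (x : M) : IsPiecewiseAnalytic I (Path.refl x) :=
  ⟨1, fun i => i, by simp, by simp, fun i _ => by simp,
    fun i _ => ⟨fun _ => x, fun _ _ => contMDiffAt_const, fun _ _ => rfl⟩⟩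

variable {I}

/-- Affine substitution in an analytic map. -/
theorem contMDiffAt_comp_affine {c : ℝ → M} {s k d : ℝ}
    (h : ContMDiffAt 𝓘(ℝ, ℝ) I ω c (k * s + d)) :
    ContMDiffAt 𝓘(ℝ, ℝ) I ω (fun r : ℝ => c (k * r + d)) s := by
  have h2 : ContMDiffAt 𝓘(ℝ, ℝ) 𝓘(ℝ, ℝ) ω (fun r : ℝ => k * r + d) s := by
    rw [contMDiffAt_iff_contDiffAt]
    fun_prop
  exact ContMDiffAt.comp (f := fun r : ℝ => k * r + d) s h h2

theorem IsPiecewiseAnalytic.symm {x y : M} {γ : Path x y} (h : IsPiecewiseAnalytic I γ) :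
    IsPiecewiseAnalytic I γ.symm := by
  obtain ⟨n, t, h0, h1, hm, ha⟩ := h
  refine ⟨n, fun i => 1 - t (n - i), by simp [h1], by simp [h0], fun i hi => ?_, fun i hi => ?_⟩
  · have := hm (n - (i + 1)) (by omega)
    rw [show n - (i + 1) + 1 = n - i by omega] at this
    dsimp only
    linarith
  · obtain ⟨c, hc, hγ⟩ := ha (n - (i + 1)) (by omega)
    rw [show n - (i + 1) + 1 = n - i by omega] at hc hγ
    refine ⟨fun r => c ((-1) * r + 1), fun s hs => contMDiffAt_comp_affine (hc _ ?_),
      fun s hs => ?_⟩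
    · exact ⟨by linarith [hs.2], by linarith [hs.1]⟩
    · have h3 := hγ (unitInterval.symm s)
        ⟨by rw [unitInterval.coe_symm_eq]; linarith [hs.2],
          by rw [unitInterval.coe_symm_eq]; linarith [hs.1]⟩
      rw [unitInterval.coe_symm_eq] at h3
      rw [Path.symm_apply, Function.comp_apply, h3]
      dsimp only
      congr 1
      ring

theorem IsPiecewiseAnalytic.trans {x y z : M} {γ : Path x y} {δ : Path y z}
    (hγ : IsPiecewiseAnalytic I γ) (hδ : IsPiecewiseAnalytic I δ) :
    IsPiecewiseAnalytic I (γ.trans δ) := by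
  obtain ⟨n, t, h0, h1, hm, ha⟩ := hγ
  obtain ⟨n', t', h0', h1', hm', ha'⟩ := hδ
  have ht : ∀ i ≤ n, t i ≤ 1 := fun i hi => by
    induction hi using Nat.decreasingInduction with
    | self => exact h1.le
    | of_succ k hk ih => exact (hm k hk).trans ih
  have ht' : ∀ i ≤ n', 0 ≤ t' i := fun i => by
    induction i with
    | zero => intro _; exact h0'.ge
    | succ k ih => intro hk; exact (ih (by omega)).trans (hm' k (by omega))
  -- the concatenated partition, written separately on both halves
  set T : ℕ → ℝ := fun i => if i ≤ n then t i / 2 else (t' (i - n) + 1) / 2 with hT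
  have hTl : ∀ i ≤ n, T i = t i / 2 := fun i hi => by simp [hT, hi]
  have hTr : ∀ i, T (n + i) = (t' i + 1) / 2 := fun i => by
    rcases Nat.eq_zero_or_pos i with rfl | hi
    · simp [hT, h1, h0']
    · simp only [hT]
      rw [if_neg (by omega), Nat.add_sub_cancel_left]
  have key : ∀ i < n + n', i < n ∨ ∃ j < n', i = n + j := fun i hi => by
    rcases lt_or_ge i n with h | h
    · exact Or.inl h
    · exact Or.inr ⟨i - n, by omega, by omega⟩
  refine ⟨n + n', T, by simp [hTl 0 (Nat.zero_le _), h0], by rw [hTr, h1']; norm_num,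
    fun i hi => ?_, fun i hi => ?_⟩
  · rcases key i hi with h | ⟨j, hj, rfl⟩
    · rw [hTl i h.le, hTl (i + 1) h]
      linarith [hm i h]
    · rw [hTr, add_assoc, hTr]
      linarith [hm' j hj]
  · rcases key i hi with h | ⟨j, hj, rfl⟩
    · rw [hTl i h.le, hTl (i + 1) h]
      obtain ⟨c, hc, hγ⟩ := ha i h
      refine ⟨fun r => c (2 * r + 0), fun s hs => contMDiffAt_comp_affine (hc _ ?_),
        fun s hs => ?_⟩
      · exact ⟨by linarith [hs.1], by linarith [hs.2]⟩
      · have hs2 : (s : ℝ) ≤ 1 / 2 := by linarith [hs.2, ht (i + 1) h]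
        rw [Path.trans_apply, dif_pos hs2, hγ _ ⟨by simp; linarith [hs.1], by simp; linarith [hs.2]⟩]
        simp
    · rw [hTr, add_assoc, hTr]
      obtain ⟨c, hc, hγ⟩ := ha' j hj
      refine ⟨fun r => c (2 * r + (-1)), fun s hs => contMDiffAt_comp_affine (hc _ ?_),
        fun s hs => ?_⟩
      · exact ⟨by linarith [hs.1], by linarith [hs.2]⟩
      · have hs2 : 1 / 2 ≤ (s : ℝ) := by linarith [hs.1, ht' j hj.le]
        rcases hs2.eq_or_lt with he | hlt
        · have hz : (0 : ℝ) ∈ Icc (t' j) (t' (j + 1)) :=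
            ⟨by linarith [hs.1], by linarith [ht' (j + 1) hj]⟩
          have h3 := hγ 0 (by simpa using hz)
          rw [Path.trans_apply, dif_pos he.ge]
          have h4 : (⟨2 * (s : ℝ), (unitInterval.mul_pos_mem_iff zero_lt_two).2 ⟨s.2.1, he.ge⟩⟩ :
              unitInterval) = 1 := by
            apply Subtype.ext
            simp [← he]
          rw [h4, γ.target, ← δ.source, h3, ← he]
          norm_num
        · rw [Path.trans_apply, dif_neg (not_le.2 hlt),
            hγ _ ⟨by simp; linarith [hs.1], by simp; linarith [hs.2]⟩]
          simp [sub_eq_add_neg]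

variable (I)

/-- Parametrized piecewise analytic loops based at `x`. -/
def PALoop (x : M) : Type _ := {γ : Path x x // IsPiecewiseAnalytic I γ}

end Loops

/-! ### Thin loops and thin equivalence -/

section Thin

variable {X : Type*} [TopologicalSpace X] {x : X}

/-- A loop is thin if it is homotopic to the constant loop at its base point by a homotopy (of based
loops) whose image is contained in the image of the loop. -/
def IsThin (α : Path x x) : Prop :=
  ∃ F : α.Homotopy (Path.refl x), ∀ z, F z ∈ range α

/-- Two loops `α`, `β` are thin-equivalent if `α β⁻¹` is thin. -/
def ThinEquiv (α β : Path x x) : Prop := IsThin (α.trans β.symm)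

/-- A loop in `X` with image in `S`, as a loop in `S`. -/
def liftPath (S : Set X) (p : Path x x) (h : range p ⊆ S) (hx : x ∈ S) :
    Path (⟨x, hx⟩ : S) ⟨x, hx⟩ where
  toFun t := ⟨p t, h ⟨t, rfl⟩⟩
  source' := by simp
  target' := by simp

theorem liftPath_trans {S : Set X} {p q : Path x x} (hp : range p ⊆ S) (hq : range q ⊆ S)
    (hpq : range (p.trans q) ⊆ S) (hx : x ∈ S) :
    liftPath S (p.trans q) hpq hx = (liftPath S p hp hx).trans (liftPath S q hq hx) := by
  ext t
  simp only [liftPath, Path.trans_apply, Path.coe_mk_mk]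
  split_ifs <;> rfl

/-- The class in the fundamental group of `S` of a loop with image in `S`. -/
def cls (S : Set X) (p : Path x x) (h : range p ⊆ S) (hx : x ∈ S) :
    FundamentalGroup S ⟨x, hx⟩ :=
  FundamentalGroup.fromPath (Path.Homotopic.Quotient.mk (liftPath S p h hx))

theorem cls_trans {S : Set X} {p q : Path x x} (hp : range p ⊆ S) (hq : range q ⊆ S)
    (hpq : range (p.trans q) ⊆ S) (hx : x ∈ S) :
    cls S (p.trans q) hpq hx = cls S q hq hx * cls S p hp hx := by
  rw [cls, liftPath_trans hp hq]
  rfl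

theorem cls_symm {S : Set X} {p : Path x x} (hp : range p ⊆ S)
    (hp' : range p.symm ⊆ S) (hx : x ∈ S) :
    cls S p.symm hp' hx = (cls S p hp hx)⁻¹ := rfl

theorem cls_refl {S : Set X} (hp : range (Path.refl x) ⊆ S) (hx : x ∈ S) :
    cls S (Path.refl x) hp hx = 1 := rfl

/-- Loops homotopic in `S` are homotopic in every larger set. -/
theorem cls_mono {S S' : Set X} (hSS : S ⊆ S') {p q : Path x x} (hp : range p ⊆ S)
    (hq : range q ⊆ S) (hx : x ∈ S) (h : cls S p hp hx = cls S q hq hx) :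
    cls S' p (hp.trans hSS) (hSS hx) = cls S' q (hq.trans hSS) (hSS hx) := by
  obtain ⟨F⟩ := Path.Homotopic.Quotient.exact h
  exact Path.Homotopic.Quotient.eq.2 ⟨F.map ⟨Set.inclusion hSS, continuous_inclusion hSS⟩⟩

theorem base_mem {S : Set X} {p : Path x x} (hp : range p ⊆ S) : x ∈ S := hp ⟨0, p.source⟩

theorem isThin_iff (α : Path x x) {S : Set X} (hS : range α = S) (h : range α ⊆ S) (hx : x ∈ S) :
    IsThin α ↔ cls S α h hx = 1 := by
  subst hS
  constructor
  · rintro ⟨F, hF⟩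
    refine Path.Homotopic.Quotient.eq.2 ⟨{
      toFun z := ⟨F z, hF z⟩
      map_zero_left t := Subtype.ext (by simp [liftPath])
      map_one_left t := Subtype.ext (by simp)
      prop' t s hs := Subtype.ext ?_ }⟩
    rcases hs with rfl | rfl <;> simp [liftPath]
  · intro h
    obtain ⟨F⟩ := Path.Homotopic.Quotient.exact h
    exact ⟨F.map ⟨Subtype.val, continuous_subtype_val⟩, fun z => (F z).2⟩

theorem thinEquiv_iff (α β : Path x x) :
    ThinEquiv α β ↔ cls (range α ∪ range β) α subset_union_left (base_mem subset_union_left) =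
      cls (range α ∪ range β) β subset_union_right (base_mem subset_union_left) := by
  have hr : range (α.trans β.symm) = range α ∪ range β := by
    rw [Path.trans_range, Path.symm_range]
  have hβ : range β.symm ⊆ range α ∪ range β := by rw [Path.symm_range]; exact subset_union_right
  rw [ThinEquiv, isThin_iff _ hr hr.le (base_mem hr.le),
    cls_trans (p := α) (q := β.symm) subset_union_left hβ,
    cls_symm (p := β) subset_union_right, inv_mul_eq_one, eq_comm]

theorem thinEquiv_of_cls {α β : Path x x}
    (h : ∀ (S : Set X) (hα : range α ⊆ S) (hβ : range β ⊆ S), S = range α ∪ range β →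
      cls S α hα (base_mem hα) = cls S β hβ (base_mem hα)) : ThinEquiv α β :=
  (thinEquiv_iff α β).2 (h _ subset_union_left subset_union_right rfl)

theorem ThinEquiv.cls_eq {α β : Path x x} (h : ThinEquiv α β) {S : Set X}
    (hα : range α ⊆ S) (hβ : range β ⊆ S) :
    cls S α hα (base_mem hα) = cls S β hβ (base_mem hα) :=
  cls_mono (union_subset hα hβ) _ _ _ ((thinEquiv_iff α β).1 h)

theorem ThinEquiv.trans_congr {α α' β β' : Path x x} (h : ThinEquiv α α') (h' : ThinEquiv β β') :
    ThinEquiv (α.trans β) (α'.trans β') := by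
  refine thinEquiv_of_cls fun S h1 h2 _ => ?_
  have h1' := h1
  have h2' := h2
  rw [Path.trans_range, union_subset_iff] at h1' h2'
  rw [cls_trans h1'.1 h1'.2, cls_trans h2'.1 h2'.2, h.cls_eq h1'.1 h2'.1, h'.cls_eq h1'.2 h2'.2]

theorem ThinEquiv.symm_congr {α α' : Path x x} (h : ThinEquiv α α') :
    ThinEquiv α.symm α'.symm := by
  refine thinEquiv_of_cls fun S h1 h2 _ => ?_
  have h1' := h1
  have h2' := h2
  rw [Path.symm_range] at h1' h2'
  rw [cls_symm h1', cls_symm h2', h.cls_eq h1' h2']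

theorem ThinEquiv.refl (α : Path x x) : ThinEquiv α α :=
  thinEquiv_of_cls fun _ _ _ _ => rfl

theorem thinEquiv_assoc (α β γ : Path x x) :
    ThinEquiv ((α.trans β).trans γ) (α.trans (β.trans γ)) := by
  refine thinEquiv_of_cls fun S h1 h2 _ => ?_
  have h1' := h1
  have h2' := h2
  simp only [Path.trans_range, union_subset_iff] at h1' h2'
  obtain ⟨⟨ha, hb⟩, hc⟩ := h1'
  have hab : range (α.trans β) ⊆ S := by rw [Path.trans_range]; exact union_subset ha hb
  have hbc : range (β.trans γ) ⊆ S := by rw [Path.trans_range]; exact union_subset hb hc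
  rw [cls_trans hab hc, cls_trans ha hb, cls_trans ha hbc, cls_trans hb hc, mul_assoc]

theorem thinEquiv_refl_trans (α : Path x x) : ThinEquiv ((Path.refl x).trans α) α := by
  refine thinEquiv_of_cls fun S h1 h2 _ => ?_
  have h3 := h1
  rw [Path.trans_range, union_subset_iff] at h3
  rw [cls_trans h3.1 h2, cls_refl, mul_one]

theorem thinEquiv_trans_refl (α : Path x x) : ThinEquiv (α.trans (Path.refl x)) α := by
  refine thinEquiv_of_cls fun S h1 h2 _ => ?_
  have h3 := h1
  rw [Path.trans_range, union_subset_iff] at h3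
  rw [cls_trans h2 h3.2, cls_refl, one_mul]

theorem thinEquiv_symm_trans (α : Path x x) : ThinEquiv (α.symm.trans α) (Path.refl x) := by
  refine thinEquiv_of_cls fun S h1 h2 _ => ?_
  have h3 := h1
  rw [Path.trans_range, union_subset_iff] at h3
  rw [cls_trans h3.1 h3.2, cls_symm h3.2, cls_refl, mul_inv_cancel]

end Thin

/-! ### The group of loops -/

section LoopGroup

variable {E : Type*} [NormedAddCommGroup E] [NormedSpace ℝ E]
  {H : Type*} [TopologicalSpace H] (I : ModelWithCorners ℝ E H)
  {M : Type*} [TopologicalSpace M] [ChartedSpace H M]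

/-- The group of loops: piecewise analytic loops based at `x` up to thin equivalence (that is,
up to the equivalence relation that thin equivalence generates). -/
def LoopGroup (x : M) : Type _ :=
  Quot fun α β : PALoop I x => ThinEquiv α.1 β.1

variable {I} {x : M}

/-- The class of a parametrized loop. -/
def LoopGroup.mk (α : PALoop I x) : LoopGroup I x := Quot.mk _ α

/-- The group structure: composition of loops. -/
instance : Group (LoopGroup I x) where
  mul := Quot.map₂ (fun α β => ⟨α.1.trans β.1, α.2.trans β.2⟩)
    (fun _ _ _ h => (ThinEquiv.refl _).trans_congr h)
    (fun _ _ _ h => h.trans_congr (ThinEquiv.refl _))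
  one := LoopGroup.mk ⟨Path.refl x, .refl I x⟩
  inv := Quot.map (fun α => ⟨α.1.symm, α.2.symm⟩) (fun _ _ h => h.symm_congr)
  mul_assoc := by
    rintro ⟨α⟩ ⟨β⟩ ⟨γ⟩
    exact Quot.sound (thinEquiv_assoc _ _ _)
  one_mul := by
    rintro ⟨α⟩
    exact Quot.sound (thinEquiv_refl_trans _)
  mul_one := by
    rintro ⟨α⟩
    exact Quot.sound (thinEquiv_trans_refl _)
  inv_mul_cancel := by
    rintro ⟨α⟩
    exact Quot.sound (thinEquiv_symm_trans _)

end LoopGroup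

/-! ### Principal `U(1)`-bundles, connections, holonomy -/

section Bundles

variable {E : Type*} [NormedAddCommGroup E] [NormedSpace ℝ E]
  {H : Type*} [TopologicalSpace H] (I : ModelWithCorners ℝ E H)
  {M : Type*} [TopologicalSpace M] [ChartedSpace H M]
  {F : Type*} [NormedAddCommGroup F] [NormedSpace ℝ F]
  {K : Type*} [TopologicalSpace K] (J : ModelWithCorners ℝ F K)
  {P : Type*} [TopologicalSpace P] [ChartedSpace K P] [MulAction Circle P]

/-- `π : P → M` is a smooth principal bundle with structure group `U(1) = Circle` (as the group is
abelian, left and right actions are the same): the action and the projection are smooth and there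
are smooth equivariant local trivializations. -/
structure IsPrincipalCircleBundle (π : P → M) : Prop where
  smooth_smul : ContMDiff ((𝓡 1).prod J) J ∞ (fun z : Circle × P => z.1 • z.2)
  smooth_proj : ContMDiff J I ∞ π
  locally_trivial : ∀ x : M, ∃ (U : Set M) (e : OpenPartialHomeomorph P (M × Circle)),
    IsOpen U ∧ x ∈ U ∧ e.source = π ⁻¹' U ∧ e.target = U ×ˢ univ ∧
    ContMDiffOn J (I.prod (𝓡 1)) ∞ e e.source ∧
    ContMDiffOn (I.prod (𝓡 1)) J ∞ e.symm e.target ∧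
    (∀ p ∈ e.source, (e p).1 = π p) ∧
    ∀ (g : Circle), ∀ p ∈ e.source, e (g • p) = ((e p).1, g * (e p).2)

variable (P) in
/-- A smooth principal connection on a `U(1)`-bundle with total space `P`, given by its connection
form. The Lie algebra `u(1) = iℝ` is identified with `ℝ` through `θ ↦ exp(iθ)`: the form is a smooth
`U(1)`-invariant real 1-form with value `1` on the fundamental vector field of the action. -/
structure Connection [IsManifold J ∞ P] where
  form : ∀ p : P, TangentSpace J p →L[ℝ] ℝ
  smooth_form : ContMDiff J.tangent 𝓘(ℝ, ℝ) ∞ (fun v : TangentBundle J P => form v.proj v.snd)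
  invariant : ∀ (g : Circle) (p : P) (v : TangentSpace J p),
    form (g • p) (mfderiv J J (fun q : P => g • q) p v) = form p v
  form_vertical : ∀ p : P,
    form (Circle.exp 0 • p) (mfderiv 𝓘(ℝ, ℝ) J (fun θ : ℝ => Circle.exp θ • p) 0 (1 : ℝ)) = 1

variable {J} [IsManifold J ∞ P]

/-- `u` is the horizontal lift of the loop `α` starting at `u₀`: it is continuous on `[0, 1]`, lies
over `α`, and outside a finite set of parameters it is differentiable with horizontal velocity. -/
def IsHorizontalLift (π : P → M) (A : Connection J P) {x : M} (α : Path x x) (u₀ : P)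
    (u : ℝ → P) : Prop :=
  ContinuousOn u (Icc 0 1) ∧ u 0 = u₀ ∧ (∀ s : unitInterval, π (u s) = α s) ∧
    ∃ S : Finset ℝ, ∀ t ∈ Ioo (0 : ℝ) 1, t ∉ S →
      MDifferentiableAt 𝓘(ℝ, ℝ) J u t ∧ A.form (u t) (mfderiv 𝓘(ℝ, ℝ) J u t (1 : ℝ)) = 0

/-- `g` is the holonomy of `A` around `α`: `u₀ = g • 𝒫(u₀)`, where `𝒫(u₀)` is the end point of the
horizontal lift of `α` starting at `u₀`. -/
def IsHolonomy (π : P → M) (A : Connection J P) (u₀ : P) {x : M} (α : Path x x)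
    (g : Circle) : Prop :=
  ∃ u : ℝ → P, IsHorizontalLift π A α u₀ u ∧ u₀ = g • u 1

/-- The holonomy `H_A(α) ∈ U(1)`. -/
def holonomy (π : P → M) (A : Connection J P) (u₀ : P) {x : M} (α : Path x x) : Circle :=
  Classical.epsilon (IsHolonomy π A u₀ α)

variable {I}

/-- The Wilson function `T_α` on the space of connections, `T_α(A) = (1/N) Tr H_A(α)`; here `N = 1`,
and the trace is the complex number `H_A(α)` itself. -/
def wilson (J : ModelWithCorners ℝ F K) [IsManifold J ∞ P] (π : P → M) (u₀ : P) {x : M}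
    (α : PALoop I x) : Connection J P → ℂ :=
  fun A => (holonomy π A u₀ α.1 : ℂ)

variable (I)

/-- The set of all Wilson functions of piecewise analytic loops based at `x`. -/
def Hoop (J : ModelWithCorners ℝ F K) [IsManifold J ∞ P] (π : P → M) (u₀ : P) (x : M) :
    Set (Connection J P → ℂ) :=
  range (fun α : PALoop I x => wilson J π u₀ α)

end Bundles

end LoopHoop

end

/-! The image of a piecewise analytic loop is a finite graph: `[0, 1]` splits into intervals on
which the loop is constant or an injective edge, and any other piece either misses the interior of a
given edge or is a reparametrization of it (`exists_isEdgePartition`). Each edge then has a signed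
number of passages, `edgeCount`, and everything is read off from these integers.

The graph structure comes from Puiseux's description of analytic arcs. In a chart centred at `p`,
each half of a nonconstant analytic germ through `p` is determined by its distance to `p`: it runs
along a branch that is analytic in a root of the radius (`exists_radialGerm_right`). By the identity
theorem two branches coincide or separate near `p`, so near every point the image is a finite star,
and by compactness finitely many stars cover it.

Four implications carry the theorem. A thin loop has zero counts: collapsing all but one edge maps
the image to the circle, and the null homotopy, which stays in the image, kills the winding number,
which is the count (`IsThin.edgeCount_eq_zero`). Zero counts force trivial holonomy, because the
contributions of the passages of an edge cancel in the abelian group `U(1)`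
(`IsPrincipalCircleBundle.holonomy_eq_one`); with multiplicativity of the holonomy, `T_α` is thus
well defined on classes. Zero counts also put the class into the commutator subgroup, by the same
cancellation in the abelianization (`mem_commutator_of_edgeCount_eq_zero`). Finally, adding to a
connection a 1-form `ψ dh` concentrated at one edge multiplies the holonomy by the exponential of an
integral that is a nonzero multiple of the count, so trivial holonomy for all connections forces
zero counts (`IsPrincipalCircleBundle.edgeCount_eq_zero`).

The last two give one inclusion for the kernel; the other is commutativity of `U(1)`. -/

noncomputable section

namespace LoopHoop

open Filter Topology MeasureTheory

/-! ### Puiseux germs of analytic curves -/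

section Germs

variable {V : Type*} [NormedAddCommGroup V] [InnerProductSpace ℝ V]

/-- A germ at `0` of a Puiseux curve `ρ ↦ γ (ρ ^ (1 / k))`, with `γ` analytic and `γ 0 = 0`. -/
def IsRadialGerm (σ : ℝ → V) : Prop :=
  σ 0 = 0 ∧ ∃ k : ℕ, k ≠ 0 ∧ ∃ γ : ℝ → V, AnalyticAt ℝ γ 0 ∧
    ∀ ρ, 0 ≤ ρ → σ ρ = γ (ρ ^ ((k : ℝ)⁻¹))

theorem tendsto_rpow_inv_nhdsGT (k : ℕ) (hk : k ≠ 0) :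
    Tendsto (fun ρ : ℝ => ρ ^ ((k : ℝ)⁻¹)) (𝓝[>] 0) (𝓝[>] 0) := by
  have hk' : (0 : ℝ) < (k : ℝ)⁻¹ := by positivity
  refine tendsto_nhdsWithin_iff.2 ⟨?_, ?_⟩
  · have := (Real.continuousAt_rpow_const 0 ((k : ℝ)⁻¹) (Or.inr hk'.le)).tendsto
    rw [Real.zero_rpow hk'.ne'] at this
    exact this.mono_left nhdsWithin_le_nhds
  · filter_upwards [self_mem_nhdsWithin] with ρ hρ
    exact Real.rpow_pos_of_pos hρ _

/-- With roots of orders `k` and `l`, the substitution `ρ = z ^ (k * l)` makes both germs analytic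
in `z`, and the identity theorem applies. -/
theorem IsRadialGerm.eventually_eq_or_ne {σ τ : ℝ → V} (hσ : IsRadialGerm σ)
    (hτ : IsRadialGerm τ) :
    (∀ᶠ ρ in 𝓝[>] 0, σ ρ = τ ρ) ∨ ∀ᶠ ρ in 𝓝[>] 0, σ ρ ≠ τ ρ := by
  obtain ⟨-, k, hk, γ, hγ, h1⟩ := hσ
  obtain ⟨-, l, hl, δ, hδ, h2⟩ := hτ
  have e1 : AnalyticAt ℝ (fun z : ℝ => γ (z ^ l)) 0 := by
    refine AnalyticAt.fun_comp (f := fun z : ℝ => z ^ l) ?_ (by fun_prop)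
    simpa [hl] using hγ
  have e2 : AnalyticAt ℝ (fun z : ℝ => δ (z ^ k)) 0 := by
    refine AnalyticAt.fun_comp (f := fun z : ℝ => z ^ k) ?_ (by fun_prop)
    simpa [hk] using hδ
  have ht := tendsto_rpow_inv_nhdsGT (k * l) (mul_ne_zero hk hl)
  have s1 : ∀ ρ : ℝ, 0 < ρ → σ ρ = γ ((ρ ^ (((k * l : ℕ) : ℝ)⁻¹)) ^ l) := fun ρ hρ => by
    rw [h1 ρ hρ.le, ← Real.rpow_natCast, ← Real.rpow_mul hρ.le]
    congr 2
    push_cast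
    field_simp
  have s2 : ∀ ρ : ℝ, 0 < ρ → τ ρ = δ ((ρ ^ (((k * l : ℕ) : ℝ)⁻¹)) ^ k) := fun ρ hρ => by
    rw [h2 ρ hρ.le, ← Real.rpow_natCast, ← Real.rpow_mul hρ.le]
    congr 2
    push_cast
    field_simp
  rcases e1.eventually_eq_or_eventually_ne e2 with h | h
  · left
    filter_upwards [ht.eventually (h.filter_mono nhdsWithin_le_nhds), self_mem_nhdsWithin]
      with ρ h hρ
    rw [s1 ρ hρ, s2 ρ hρ, h]
  · right
    filter_upwards [ht.eventually (h.filter_mono (nhdsGT_le_nhdsNE 0)), self_mem_nhdsWithin]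
      with ρ h hρ
    rwa [s1 ρ hρ, s2 ρ hρ]

variable [CompleteSpace V]

theorem IsRadialGerm.eventually_continuousOn {σ : ℝ → V} (hσ : IsRadialGerm σ) :
    ∀ᶠ ε in 𝓝[>] 0, ContinuousOn σ (Icc 0 ε) := by
  obtain ⟨-, k, hk, γ, hγ, h1⟩ := hσ
  have hk' : (0 : ℝ) < (k : ℝ)⁻¹ := by positivity
  obtain ⟨r, hr, hc⟩ := Metric.eventually_nhds_iff.1
    (hγ.eventually_analyticAt.mono fun _ h => h.continuousAt)
  have ht := tendsto_nhdsWithin_iff.1 (tendsto_rpow_inv_nhdsGT k hk)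
  have h2 := ht.1.eventually (Metric.ball_mem_nhds 0 hr)
  filter_upwards [h2, self_mem_nhdsWithin] with ε hε hε0
  have hcont : ContinuousOn (fun ρ : ℝ => γ (ρ ^ ((k : ℝ)⁻¹))) (Icc 0 ε) := by
    intro ρ hρ
    have hb : ρ ^ ((k : ℝ)⁻¹) ∈ Metric.ball (0 : ℝ) r := by
      rw [Metric.mem_ball, dist_zero_right, Real.norm_of_nonneg (Real.rpow_nonneg hρ.1 _)]
      rw [dist_zero_right, Real.norm_of_nonneg (Real.rpow_nonneg (le_of_lt hε0) _)] at hε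
      exact (Real.rpow_le_rpow hρ.1 hρ.2 hk'.le).trans_lt hε
    exact (ContinuousAt.comp (f := fun ρ : ℝ => ρ ^ ((k : ℝ)⁻¹)) (hc hb)
      (Real.continuousAt_rpow_const ρ _ (Or.inr hk'.le))).continuousWithinAt
  exact hcont.congr fun ρ hρ => h1 ρ hρ.1

/-- A nonconstant analytic curve is, on the right of each of its zeros, a radial germ composed with
the norm. -/
theorem exists_radialGerm_right {c : ℝ → V} {t₀ : ℝ} (hc : AnalyticAt ℝ c t₀) (h0 : c t₀ = 0) :
    (∀ᶠ t in 𝓝 t₀, c t = 0) ∨ ∃ σ : ℝ → V, IsRadialGerm σ ∧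
      ∀ᶠ t in 𝓝[>] t₀, c t ≠ 0 ∧ c t = σ ‖c t‖ ∧ deriv (fun s => ‖c s‖ ^ 2) t ≠ 0 := by
  by_cases hz : ∀ᶠ t in 𝓝 t₀, c t = 0
  · exact Or.inl hz
  right
  have hN : AnalyticAt ℝ (fun s => ‖c s‖ ^ 2) t₀ := by
    exact (hc.contDiffAt.norm_sq ℝ (n := ω)).analyticAt
  -- Were the derivative identically zero, `‖c‖ ^ 2` would keep its value `0` at `t₀`, so `c` would
  -- vanish near `t₀`.
  have hN' : ∀ᶠ t in 𝓝[≠] t₀, deriv (fun s => ‖c s‖ ^ 2) t ≠ 0 := by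
    refine hN.deriv.eventually_eq_zero_or_eventually_ne_zero.resolve_left fun h => hz ?_
    obtain ⟨r, hr, hb⟩ := Metric.eventually_nhds_iff.1 (h.and
      (hN.eventually_analyticAt.mono fun _ h => h.differentiableAt))
    filter_upwards [Metric.ball_mem_nhds t₀ hr] with t ht
    have := (convex_ball t₀ r).is_const_of_fderivWithin_eq_zero (𝕜 := ℝ)
      (f := fun s => ‖c s‖ ^ 2) (fun s hs => (hb hs).2.differentiableWithinAt)
      (fun s hs => ?_) ht (Metric.mem_ball_self hr)
    · simpa [h0] using this
    · rw [fderivWithin_of_isOpen Metric.isOpen_ball hs]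
      ext
      simpa using (hb hs).1
  obtain ⟨k, a, ha, ha0, hca⟩ := hc.exists_eventuallyEq_pow_smul_nonzero_iff.2 hz
  have hk : k ≠ 0 := by
    rintro rfl
    have := hca.self_of_nhds
    simp [h0] at this
    exact ha0 this.symm
  have hk' : (k : ℝ) ≠ 0 := by exact_mod_cast hk
  -- For `t > t₀` this function is `‖c t‖ ^ (1 / k)`. Without the absolute value on `t - t₀` it is
  -- analytic across `t₀` with nonzero derivative, so its local inverse `T` recovers `t` from the
  -- norm.
  have hs : AnalyticAt ℝ (fun t => (t - t₀) * ‖a t‖ ^ ((k : ℝ)⁻¹)) t₀ := by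
    have : ContDiffAt ℝ ω (fun t => ‖a t‖ ^ ((k : ℝ)⁻¹)) t₀ :=
      (ha.contDiffAt.norm ℝ ha0).rpow_const_of_ne (norm_ne_zero_iff.2 ha0)
    exact (by fun_prop : AnalyticAt ℝ (fun t : ℝ => t - t₀) t₀).mul
      this.analyticAt
  set s : ℝ → ℝ := fun t => (t - t₀) * ‖a t‖ ^ ((k : ℝ)⁻¹) with hs_def
  have hs0 : s t₀ = 0 := by simp [hs_def]
  have hds : deriv s t₀ ≠ 0 := by
    have hd : HasDerivAt s (1 * ‖a t₀‖ ^ ((k : ℝ)⁻¹) + (t₀ - t₀) *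
        deriv (fun t => ‖a t‖ ^ ((k : ℝ)⁻¹)) t₀) t₀ := by
      refine ((hasDerivAt_id t₀).sub_const t₀).mul (DifferentiableAt.hasDerivAt ?_)
      exact ((ha.differentiableAt.norm ℝ ha0).rpow_const (Or.inl (norm_ne_zero_iff.2 ha0)))
    rw [hd.deriv, sub_self, zero_mul, add_zero, one_mul]
    exact (Real.rpow_pos_of_pos (norm_pos_iff.2 ha0) _).ne'
  have hT := hs.analyticAt_localInverse hds
  have hTl := hs.hasStrictDerivAt.eventually_left_inverse hds
  set T := hs.hasStrictDerivAt.localInverse _ _ _ hds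
  have hTt : T 0 = t₀ := by
    rw [← hs0]
    exact hTl.self_of_nhds
  refine ⟨fun ρ => c (T (ρ ^ ((k : ℝ)⁻¹))), ⟨?_, k, hk, fun z => c (T z), ?_, fun _ _ => rfl⟩, ?_⟩
  · simp [Real.zero_rpow (inv_ne_zero hk'), hTt, h0]
  · rw [hs0] at hT
    exact AnalyticAt.fun_comp (by rwa [hTt]) hT
  · filter_upwards [hN'.filter_mono (nhdsGT_le_nhdsNE t₀),
      hTl.filter_mono nhdsWithin_le_nhds, hca.filter_mono nhdsWithin_le_nhds,
      (ha.continuousAt.eventually_ne ha0).filter_mono nhdsWithin_le_nhds, self_mem_nhdsWithin]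
      with t h1 h2 h3 h4 h5
    have h5' : 0 < t - t₀ := sub_pos.2 h5
    have hne : c t ≠ 0 := by
      rw [h3]
      exact smul_ne_zero (pow_ne_zero _ h5'.ne') h4
    refine ⟨hne, ?_, h1⟩
    have : ‖c t‖ ^ ((k : ℝ)⁻¹) = s t := by
      rw [h3, norm_smul, norm_pow, Real.norm_of_nonneg h5'.le,
        Real.mul_rpow (by positivity) (norm_nonneg _), Real.pow_rpow_inv_natCast h5'.le hk]
    rw [this, h2]

theorem exists_radialGerm_left {c : ℝ → V} {t₀ : ℝ} (hc : AnalyticAt ℝ c t₀) (h0 : c t₀ = 0) :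
    (∀ᶠ t in 𝓝 t₀, c t = 0) ∨ ∃ σ : ℝ → V, IsRadialGerm σ ∧
      ∀ᶠ t in 𝓝[<] t₀, c t ≠ 0 ∧ c t = σ ‖c t‖ ∧ deriv (fun s => ‖c s‖ ^ 2) t ≠ 0 := by
  have hn : Tendsto (fun t : ℝ => -t) (𝓝 t₀) (𝓝 (-t₀)) := tendsto_neg t₀
  have hl : Tendsto (fun t : ℝ => -t) (𝓝[<] t₀) (𝓝[>] (-t₀)) := tendsto_neg_nhdsLT
  have hc' : AnalyticAt ℝ (fun t => c (-t)) (-t₀) :=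
    AnalyticAt.fun_comp (by simpa using hc) (by fun_prop)
  rcases exists_radialGerm_right hc' (by simpa using h0) with h | ⟨σ, hσ, h⟩
  · left
    filter_upwards [hn.eventually h] with t ht
    simpa using ht
  · refine Or.inr ⟨σ, hσ, ?_⟩
    filter_upwards [hl.eventually h] with t ht
    rw [neg_neg] at ht
    refine ⟨ht.1, ht.2.1, fun h => ht.2.2 ?_⟩
    have := deriv_comp_neg (fun s => ‖c s‖ ^ 2) (-t)
    rw [this, neg_neg, h, neg_zero]

end Germs

/-! ### One-sided agreement of curves -/

section OneSided

theorem eventually_eventuallyEq_nhdsGT {X : Type*} {f c : ℝ → X} {t : ℝ}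
    (h : ∀ᶠ s in 𝓝[≥] t, f s = c s) :
    ∀ᶠ s in 𝓝[>] t, f =ᶠ[𝓝 s] c := by
  have h1 := eventually_eventually_nhdsWithin.2
    (h.filter_mono (nhdsWithin_mono t Ioi_subset_Ici_self))
  filter_upwards [h1, self_mem_nhdsWithin] with s hs hts
  rwa [isOpen_Ioi.nhdsWithin_eq hts] at hs

theorem eventually_eventuallyEq_nhdsLT {X : Type*} {f c : ℝ → X} {t : ℝ}
    (h : ∀ᶠ s in 𝓝[≤] t, f s = c s) :
    ∀ᶠ s in 𝓝[<] t, f =ᶠ[𝓝 s] c := by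
  have h1 := eventually_eventually_nhdsWithin.2
    (h.filter_mono (nhdsWithin_mono t Iio_subset_Iic_self))
  filter_upwards [h1, self_mem_nhdsWithin] with s hs hts
  rwa [isOpen_Iio.nhdsWithin_eq hts] at hs

end OneSided

/-! ### The image of a curve near a point is a finite star -/

section Star

variable {E : Type*} [NormedAddCommGroup E] [NormedSpace ℝ E]
  {H : Type*} [TopologicalSpace H] (I : ModelWithCorners ℝ E H)
  {M : Type*} [TopologicalSpace M] [ChartedSpace H M]

/-- At every parameter, `f` agrees on each side with an analytic curve. -/
def HasAnalyticGerms (f : ℝ → M) : Prop :=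
  ∀ t, (∃ c : ℝ → M, ContMDiffAt 𝓘(ℝ, ℝ) I ω c t ∧ ∀ᶠ s in 𝓝[≥] t, f s = c s) ∧
    ∃ c : ℝ → M, ContMDiffAt 𝓘(ℝ, ℝ) I ω c t ∧ ∀ᶠ s in 𝓝[≤] t, f s = c s

variable {I} in
theorem IsPiecewiseAnalytic.exists_right_germ {x y : M} {γ : Path x y}
    (h : IsPiecewiseAnalytic I γ) (r : ℝ) :
    ∃ c : ℝ → M, ContMDiffAt 𝓘(ℝ, ℝ) I ω c r ∧ ∀ᶠ s in 𝓝[≥] r, γ.extend s = c s := by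
  obtain ⟨n, t, h0, h1, hm, ha⟩ := h
  rcases lt_or_ge r 0 with hr | hr
  · refine ⟨fun _ => x, contMDiffAt_const, ?_⟩
    filter_upwards [nhdsWithin_le_nhds (Iio_mem_nhds hr)] with s hs
    exact γ.extend_of_le_zero hs.le
  rcases lt_or_ge r 1 with hr1 | hr1
  · have hex : ∃ j, r < t j := ⟨n, by rwa [h1]⟩
    classical
    have hlt := Nat.find_spec hex
    have hle : Nat.find hex ≤ n := Nat.find_min' hex (by rwa [h1])
    obtain ⟨i, hi⟩ : ∃ i, Nat.find hex = i + 1 := by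
      refine Nat.exists_eq_succ_of_ne_zero fun h => ?_
      rw [h, h0] at hlt
      exact hlt.not_ge hr
    have hti : t i ≤ r := not_lt.1 (Nat.find_min hex (by omega : i < Nat.find hex))
    rw [hi] at hlt hle
    obtain ⟨c, hc, hγ⟩ := ha i hle
    refine ⟨c, hc r ⟨hti, hlt.le⟩, ?_⟩
    filter_upwards [nhdsWithin_le_nhds (Iio_mem_nhds hlt), nhdsWithin_le_nhds (Iio_mem_nhds hr1),
      self_mem_nhdsWithin] with s hs hs1 hs0
    have hs' : s ∈ unitInterval := ⟨hr.trans hs0, hs1.le⟩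
    rw [γ.extend_apply hs', hγ ⟨s, hs'⟩ ⟨hti.trans hs0, hs.le⟩]
  · refine ⟨fun _ => y, contMDiffAt_const, ?_⟩
    filter_upwards [self_mem_nhdsWithin] with s hs
    exact γ.extend_of_one_le (hr1.trans hs)

variable {I} in
theorem IsPiecewiseAnalytic.hasAnalyticGerms {x y : M} {γ : Path x y}
    (h : IsPiecewiseAnalytic I γ) : HasAnalyticGerms I γ.extend := by
  refine fun t => ⟨h.exists_right_germ t, ?_⟩
  -- Left germs are right germs of the reversed path.
  obtain ⟨c, hc, hγ⟩ := h.symm.exists_right_germ (-1 * t + 1)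
  refine ⟨fun s => c (-1 * s + 1), contMDiffAt_comp_affine hc, ?_⟩
  have ht : Tendsto (fun s : ℝ => -1 * s + 1) (𝓝[≤] t) (𝓝[≥] (-1 * t + 1)) := by
    refine tendsto_nhdsWithin_iff.2 ⟨?_, ?_⟩
    · exact ((by fun_prop : Continuous fun s : ℝ => -1 * s + 1).tendsto t).mono_left
        nhdsWithin_le_nhds
    · filter_upwards [self_mem_nhdsWithin] with s hs
      simp only [mem_Iic, mem_Ici] at hs ⊢
      linarith
  filter_upwards [ht.eventually hγ] with s hs
  rw [← hs, Path.extend_symm]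
  congr 1
  ring

variable [FiniteDimensional ℝ E]

/-- The chart at `p`, centred at `p` and composed with a linear isomorphism to a Euclidean space. -/
def radialChart (p q : M) : EuclideanSpace ℝ (Fin (Module.finrank ℝ E)) :=
  toEuclidean (extChartAt I p q - extChartAt I p p)

/-- Coordinate balls. -/
def coordBall (p : M) (ε : ℝ) : Set M :=
  {q | q ∈ (chartAt H p).source ∧ ‖radialChart I p q‖ < ε}

@[simp] theorem radialChart_self (p : M) : radialChart I p p = 0 := by simp [radialChart]

theorem continuousOn_radialChart (p : M) :
    ContinuousOn (radialChart I p) (chartAt H p).source := by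
  have := continuousOn_extChartAt (I := I) p
  rw [extChartAt_source] at this
  exact toEuclidean.continuous.comp_continuousOn (this.sub continuousOn_const)

theorem injOn_radialChart (p : M) : InjOn (radialChart I p) (chartAt H p).source := by
  intro q hq q' hq' h
  have h2 := toEuclidean.injective h
  rw [sub_left_inj] at h2
  exact (extChartAt I p).injOn (by rwa [extChartAt_source]) (by rwa [extChartAt_source]) h2

theorem radialChart_eq_zero_iff {p q : M} (hq : q ∈ (chartAt H p).source) :
    radialChart I p q = 0 ↔ q = p := by
  rw [← radialChart_self I p]
  exact (injOn_radialChart I p).eq_iff hq (mem_chart_source H p)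

theorem isOpen_coordBall (p : M) (ε : ℝ) : IsOpen (coordBall I p ε) := by
  have := (continuousOn_radialChart I p).norm.isOpen_inter_preimage (chartAt H p).open_source
    (isOpen_Iio (a := ε))
  exact this

theorem self_mem_coordBall (p : M) {ε : ℝ} (h : 0 < ε) : p ∈ coordBall I p ε :=
  ⟨mem_chart_source H p, by simpa⟩

variable {I} in
theorem coordBall_mono {p : M} {ε δ : ℝ} (h : ε ≤ δ) : coordBall I p ε ⊆ coordBall I p δ :=
  fun _ hq => ⟨hq.1, hq.2.trans_le h⟩

theorem exists_coordBall_subset {p : M} {U : Set M} (hU : U ∈ 𝓝 p) :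
    ∃ ε > 0, coordBall I p ε ⊆ U := by
  have h1 := (continuousAt_extChartAt_symm (I := I) p).preimage_mem_nhds (t := U) (by
    rwa [extChartAt_to_inv])
  have h2 : Tendsto (fun v => toEuclidean.symm v + extChartAt I p p)
      (𝓝 (0 : EuclideanSpace ℝ (Fin (Module.finrank ℝ E)))) (𝓝 (extChartAt I p p)) := by
    have : Continuous fun v : EuclideanSpace ℝ (Fin (Module.finrank ℝ E)) =>
      toEuclidean.symm v + extChartAt I p p := by fun_prop
    simpa using this.tendsto 0
  obtain ⟨ε, hε, hb⟩ := Metric.mem_nhds_iff.1 (h2 h1)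
  refine ⟨ε, hε, fun q hq => ?_⟩
  have := hb (show radialChart I p q ∈ Metric.ball _ ε by simpa using hq.2)
  simpa [radialChart, (chartAt H p).left_inv hq.1] using this

/-- At the parameter `t` the curve `f` is analytic, lies on the branch `σ` in the chart at `p`, and
its distance to `p` in this chart has nonzero derivative. -/
structure RadialAt (f : ℝ → M) (p : M)
    (σ : ℝ → EuclideanSpace ℝ (Fin (Module.finrank ℝ E))) (t : ℝ) : Prop where
  mem : f t ∈ (chartAt H p).source
  ne : f t ≠ p
  branch : radialChart I p (f t) = σ ‖radialChart I p (f t)‖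
  deriv_ne : deriv (fun s => ‖radialChart I p (f s)‖ ^ 2) t ≠ 0
  analytic : ContMDiffAt 𝓘(ℝ, ℝ) I ω f t

variable {I} in
theorem radialAt_of_eventuallyEq {f c : ℝ → M} {p : M}
    {σ : ℝ → EuclideanSpace ℝ (Fin (Module.finrank ℝ E))} {t : ℝ} (hfc : f =ᶠ[𝓝 t] c)
    (hc : ContMDiffAt 𝓘(ℝ, ℝ) I ω c t) (hs : c t ∈ (chartAt H p).source)
    (h : radialChart I p (c t) ≠ 0 ∧ radialChart I p (c t) = σ ‖radialChart I p (c t)‖ ∧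
      deriv (fun s => ‖radialChart I p (c s)‖ ^ 2) t ≠ 0) : RadialAt I f p σ t where
  mem := by rwa [hfc.self_of_nhds]
  ne h' := h.1 (by rw [← hfc.self_of_nhds, h', radialChart_self])
  branch := by rw [hfc.self_of_nhds]; exact h.2.1
  deriv_ne := by
    rw [Filter.EventuallyEq.deriv_eq (hfc.mono fun s hs => by rw [hs])]
    exact h.2.2
  analytic := hc.congr_of_eventuallyEq hfc

variable [IsManifold I ω M]

theorem contMDiffOn_radialChart (p : M) :
    ContMDiffOn I 𝓘(ℝ, EuclideanSpace ℝ (Fin (Module.finrank ℝ E))) ω (radialChart I p)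
      (chartAt H p).source := by
  have h := contMDiffOn_extChartAt (I := I) (n := ω) (x := p)
  have h2 : ContMDiff 𝓘(ℝ, E) 𝓘(ℝ, EuclideanSpace ℝ (Fin (Module.finrank ℝ E))) ω
      (fun v : E => toEuclidean (v - extChartAt I p p)) := by
    rw [contMDiff_iff_contDiff]
    fun_prop
  exact h2.comp_contMDiffOn h

variable {I}

theorem analyticAt_radialChart_comp {p : M} {c : ℝ → M} {t : ℝ}
    (hc : ContMDiffAt 𝓘(ℝ, ℝ) I ω c t) (hp : c t ∈ (chartAt H p).source) :
    AnalyticAt ℝ (fun s => radialChart I p (c s)) t := by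
  have h := (contMDiffOn_radialChart I p).contMDiffAt
    ((chartAt H p).open_source.mem_nhds hp)
  exact (contMDiffAt_iff_contDiffAt.1 (ContMDiffAt.comp t h hc)).analyticAt

theorem HasAnalyticGerms.right {f : ℝ → M} (hf : HasAnalyticGerms I f) (t₀ : ℝ) :
    (∀ᶠ t in 𝓝[>] t₀, f t = f t₀) ∨ ∃ σ, IsRadialGerm σ ∧
      ∀ᶠ t in 𝓝[>] t₀, RadialAt I f (f t₀) σ t := by
  obtain ⟨c, hc, hfc⟩ := (hf t₀).1
  have h0 : f t₀ = c t₀ := hfc.self_of_nhdsWithin self_mem_Ici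
  have hsrc : c t₀ ∈ (chartAt H (f t₀)).source := by rw [h0]; exact mem_chart_source H _
  have hev := hc.continuousAt.eventually ((chartAt H (f t₀)).open_source.mem_nhds hsrc)
  have hfc' := hfc.filter_mono (nhdsWithin_mono t₀ Ioi_subset_Ici_self)
  rcases exists_radialGerm_right (analyticAt_radialChart_comp hc hsrc) (by rw [← h0]; simp)
    with h | ⟨σ, hσ, h⟩
  · left
    filter_upwards [nhdsWithin_le_nhds h, hfc', nhdsWithin_le_nhds hev] with t h1 h2 h3
    rw [h2]
    exact (radialChart_eq_zero_iff I h3).1 h1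
  · refine Or.inr ⟨σ, hσ, ?_⟩
    filter_upwards [h, eventually_eventuallyEq_nhdsGT hfc, nhdsWithin_le_nhds hev,
      nhdsWithin_le_nhds ((contMDiffAt_iff_contMDiffAt_nhds (by simp)).1 hc)] with t h1 h2 h3 h4
    exact radialAt_of_eventuallyEq h2 h4 h3 h1

theorem HasAnalyticGerms.left {f : ℝ → M} (hf : HasAnalyticGerms I f) (t₀ : ℝ) :
    (∀ᶠ t in 𝓝[<] t₀, f t = f t₀) ∨ ∃ σ, IsRadialGerm σ ∧
      ∀ᶠ t in 𝓝[<] t₀, RadialAt I f (f t₀) σ t := by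
  obtain ⟨c, hc, hfc⟩ := (hf t₀).2
  have h0 : f t₀ = c t₀ := hfc.self_of_nhdsWithin self_mem_Iic
  have hsrc : c t₀ ∈ (chartAt H (f t₀)).source := by rw [h0]; exact mem_chart_source H _
  have hev := hc.continuousAt.eventually ((chartAt H (f t₀)).open_source.mem_nhds hsrc)
  have hfc' := hfc.filter_mono (nhdsWithin_mono t₀ Iio_subset_Iic_self)
  rcases exists_radialGerm_left (analyticAt_radialChart_comp hc hsrc) (by rw [← h0]; simp)
    with h | ⟨σ, hσ, h⟩
  · left
    filter_upwards [nhdsWithin_le_nhds h, hfc', nhdsWithin_le_nhds hev] with t h1 h2 h3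
    rw [h2]
    exact (radialChart_eq_zero_iff I h3).1 h1
  · refine Or.inr ⟨σ, hσ, ?_⟩
    filter_upwards [h, eventually_eventuallyEq_nhdsLT hfc, nhdsWithin_le_nhds hev,
      nhdsWithin_le_nhds ((contMDiffAt_iff_contMDiffAt_nhds (by simp)).1 hc)] with t h1 h2 h3 h4
    exact radialAt_of_eventuallyEq h2 h4 h3 h1

theorem HasAnalyticGerms.nhds {f : ℝ → M} (hf : HasAnalyticGerms I f) (t₀ : ℝ) :
    ∃ B : Set (ℝ → EuclideanSpace ℝ (Fin (Module.finrank ℝ E))), B.Finite ∧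
      (∀ σ ∈ B, IsRadialGerm σ) ∧
      ∀ᶠ t in 𝓝 t₀, f t = f t₀ ∨ ∃ σ ∈ B, RadialAt I f (f t₀) σ t := by
  have hr : ∃ B : Set (ℝ → EuclideanSpace ℝ (Fin (Module.finrank ℝ E))), B.Finite ∧
      (∀ σ ∈ B, IsRadialGerm σ) ∧
      ∀ᶠ t in 𝓝[>] t₀, f t = f t₀ ∨ ∃ σ ∈ B, RadialAt I f (f t₀) σ t := by
    rcases hf.right t₀ with h | ⟨σ, hσ, h⟩
    · exact ⟨∅, finite_empty, by simp, h.mono fun _ h => Or.inl h⟩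
    · exact ⟨{σ}, finite_singleton σ, by simpa, h.mono fun _ h => Or.inr ⟨σ, rfl, h⟩⟩
  have hl : ∃ B : Set (ℝ → EuclideanSpace ℝ (Fin (Module.finrank ℝ E))), B.Finite ∧
      (∀ σ ∈ B, IsRadialGerm σ) ∧
      ∀ᶠ t in 𝓝[<] t₀, f t = f t₀ ∨ ∃ σ ∈ B, RadialAt I f (f t₀) σ t := by
    rcases hf.left t₀ with h | ⟨σ, hσ, h⟩
    · exact ⟨∅, finite_empty, by simp, h.mono fun _ h => Or.inl h⟩
    · exact ⟨{σ}, finite_singleton σ, by simpa, h.mono fun _ h => Or.inr ⟨σ, rfl, h⟩⟩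
  obtain ⟨B, hB, hB1, hB2⟩ := hr
  obtain ⟨C, hC, hC1, hC2⟩ := hl
  refine ⟨B ∪ C, hB.union hC, fun σ h => h.elim (hB1 σ) (hC1 σ), ?_⟩
  rw [← nhdsNE_sup_pure, ← nhdsLT_sup_nhdsGT, eventually_sup, eventually_sup]
  refine ⟨⟨hC2.mono fun t h => ?_, hB2.mono fun t h => ?_⟩, by simp⟩
  · exact h.imp_right fun ⟨σ, h1, h2⟩ => ⟨σ, Or.inr h1, h2⟩
  · exact h.imp_right fun ⟨σ, h1, h2⟩ => ⟨σ, Or.inl h1, h2⟩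

variable (I) in
/-- In the coordinate ball of radius `ε` around `p` the image of `f` is a star with centre `p` and
branches in `B`. -/
structure IsStar (f : ℝ → M) (p : M) (ε : ℝ)
    (B : Set (ℝ → EuclideanSpace ℝ (Fin (Module.finrank ℝ E)))) : Prop where
  pos : 0 < ε
  finite : B.Finite
  zero : ∀ σ ∈ B, σ 0 = 0
  cont : ∀ σ ∈ B, ContinuousOn σ (Icc 0 ε)
  eq_or_ne : ∀ σ ∈ B, ∀ τ ∈ B, (∀ ρ ∈ Ioc 0 ε, σ ρ = τ ρ) ∨ ∀ ρ ∈ Ioc 0 ε, σ ρ ≠ τ ρ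
  closure_subset : closure (coordBall I p ε) ⊆ (chartAt H p).source
  radial : ∀ t ∈ Icc (0 : ℝ) 1, f t ∈ coordBall I p ε → f t = p ∨ ∃ σ ∈ B, RadialAt I f p σ t

/-- Compactness of `[0, 1]`: near a parameter mapped to `p` at most two branches occur, one for each
side, and near any other parameter the curve misses a small coordinate ball around `p`. -/
theorem exists_finite_branches [T2Space M] {f : ℝ → M} (hf : HasAnalyticGerms I f)
    (hfc : Continuous f) (p : M) :
    ∃ B : Set (ℝ → EuclideanSpace ℝ (Fin (Module.finrank ℝ E))), B.Finite ∧
      (∀ σ ∈ B, IsRadialGerm σ) ∧ ∃ ε > 0, ∀ t ∈ Icc (0 : ℝ) 1, f t ∈ coordBall I p ε →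
        f t = p ∨ ∃ σ ∈ B, RadialAt I f p σ t := by
  refine isCompact_Icc.induction_on (p := fun s : Set ℝ =>
    ∃ B : Set (ℝ → EuclideanSpace ℝ (Fin (Module.finrank ℝ E))), B.Finite ∧
      (∀ σ ∈ B, IsRadialGerm σ) ∧ ∃ ε > 0, ∀ t ∈ s, f t ∈ coordBall I p ε →
        f t = p ∨ ∃ σ ∈ B, RadialAt I f p σ t) ?_ ?_ ?_ ?_
  · exact ⟨∅, finite_empty, by simp, 1, one_pos, by simp⟩
  · rintro s s' hss ⟨B, hB, hB1, ε, hε, h⟩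
    exact ⟨B, hB, hB1, ε, hε, fun t ht => h t (hss ht)⟩
  · rintro s s' ⟨B, hB, hB1, ε, hε, h⟩ ⟨B', hB', hB1', ε', hε', h'⟩
    refine ⟨B ∪ B', hB.union hB', fun σ h => h.elim (hB1 σ) (hB1' σ), min ε ε', lt_min hε hε', ?_⟩
    rintro t (ht | ht) hft
    · exact (h t ht (coordBall_mono (min_le_left _ _) hft)).imp_right
        fun ⟨σ, h1, h2⟩ => ⟨σ, Or.inl h1, h2⟩
    · exact (h' t ht (coordBall_mono (min_le_right _ _) hft)).imp_right
        fun ⟨σ, h1, h2⟩ => ⟨σ, Or.inr h1, h2⟩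
  · intro t₀ _
    by_cases h0 : f t₀ = p
    · obtain ⟨B, hB, hB1, h⟩ := hf.nhds t₀
      rw [h0] at h
      exact ⟨_, mem_nhdsWithin_of_mem_nhds h, B, hB, hB1, 1, one_pos, fun t ht _ => ht⟩
    · obtain ⟨u, hu, v, hv, huv⟩ := Filter.disjoint_iff.1 (disjoint_nhds_nhds.2 h0)
      obtain ⟨ε, hε, hb⟩ := exists_coordBall_subset I hv
      exact ⟨_, mem_nhdsWithin_of_mem_nhds (hfc.continuousAt.preimage_mem_nhds hu), ∅,
        finite_empty, by simp, ε, hε, fun t ht ht' => (huv.ne_of_mem ht (hb ht') rfl).elim⟩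

/-- There are finitely many branches and finitely many pairs of them, so one radius serves for the
continuity of all branches and for the alternative "equal or disjoint". Regularity of `M` keeps the
closure of the ball inside the chart. -/
theorem exists_isStar [T2Space M] {f : ℝ → M} (hf : HasAnalyticGerms I f)
    (hfc : Continuous f) (p : M) : ∃ ε B, IsStar I f p ε B := by
  have : LocallyCompactSpace M := Manifold.locallyCompact_of_finiteDimensional I
  obtain ⟨B, hB, hB1, ε₀, hε₀, h⟩ := exists_finite_branches hf hfc p
  obtain ⟨C, hC, hCc, hCs⟩ := exists_mem_nhds_isClosed_subset
    ((chartAt H p).open_source.mem_nhds (mem_chart_source H p))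
  obtain ⟨ε₁, hε₁, hb⟩ := exists_coordBall_subset I hC
  have e1 : ∀ᶠ ε in 𝓝[>] (0 : ℝ), ∀ σ ∈ B, ContinuousOn σ (Icc 0 ε) :=
    (eventually_all_finite hB).2 fun σ hσ => (hB1 σ hσ).eventually_continuousOn
  have e2 : ∀ᶠ ε in 𝓝[>] (0 : ℝ), ∀ σ ∈ B, ∀ τ ∈ B,
      (∀ ρ ∈ Ioc 0 ε, σ ρ = τ ρ) ∨ ∀ ρ ∈ Ioc 0 ε, σ ρ ≠ τ ρ := by
    refine (eventually_all_finite hB).2 fun σ hσ => (eventually_all_finite hB).2 fun τ hτ => ?_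
    rcases (hB1 σ hσ).eventually_eq_or_ne (hB1 τ hτ) with h | h
    · obtain ⟨r, hr, hrs⟩ := mem_nhdsGT_iff_exists_Ioo_subset.1 h
      filter_upwards [Ioo_mem_nhdsGT hr] with ε hε
      exact Or.inl fun ρ hρ => hrs ⟨hρ.1, hρ.2.trans_lt hε.2⟩
    · obtain ⟨r, hr, hrs⟩ := mem_nhdsGT_iff_exists_Ioo_subset.1 h
      filter_upwards [Ioo_mem_nhdsGT hr] with ε hε
      exact Or.inr fun ρ hρ => hrs ⟨hρ.1, hρ.2.trans_lt hε.2⟩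
  obtain ⟨ε, h1, h2, h3⟩ := (e1.and (e2.and (Ioo_mem_nhdsGT (lt_min hε₀ hε₁)))).exists
  refine ⟨ε, B, h3.1, hB, fun σ hσ => (hB1 σ hσ).1, h1, h2, ?_, fun t ht ht' => h t ht ?_⟩
  · refine (closure_minimal ?_ hCc).trans hCs
    exact (coordBall_mono (h3.2.le.trans (min_le_right _ _))).trans hb
  · exact coordBall_mono (h3.2.le.trans (min_le_left _ _)) ht'

end Star

/-! ### Reparametrizations between injective pieces -/

section Reparametrization

/-- `φ` maps `[c, d]` to `[a, b]`, end points to end points, and identifies the restriction of `f`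
to `[c, d]` with the restriction to `[a, b]`. -/
structure IsReparam {X : Type*} (f : ℝ → X) (a b c d : ℝ) (φ : ℝ → ℝ) : Prop where
  cont : ContinuousOn φ (Icc c d)
  mapsTo : MapsTo φ (Icc c d) (Icc a b)
  mapsTo_Ioo : MapsTo φ (Ioo c d) (Ioo a b)
  diff : ∀ τ ∈ Ioo c d, DifferentiableAt ℝ φ τ
  comp : ∀ τ ∈ Icc c d, f (φ τ) = f τ
  ends : (φ c = a ∧ φ d = b) ∨ (φ c = b ∧ φ d = a)

/-- `R '' Ioo c d` is an interval that meets the interval between `R a` and `R b` and contains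
neither end, so it cannot leave it. -/
theorem image_Ioo_subset_of_disjoint_ends {R : ℝ → ℝ} {a b c d : ℝ} (hab : a < b)
    (h1 : ContinuousOn R (Icc a b)) (h2 : ContinuousOn R (Icc c d))
    (i1 : InjOn R (Icc a b))
    (ha : R a ∉ R '' Ioo c d) (hb : R b ∉ R '' Ioo c d)
    (hne : (R '' Ioo a b ∩ R '' Ioo c d).Nonempty) : R '' Ioo c d ⊆ R '' Ioo a b := by
  obtain ⟨y, hy1, hy2⟩ := hne
  have hoc : OrdConnected (R '' Ioo c d) :=
    (isPreconnected_Ioo.image R (h2.mono Ioo_subset_Icc_self)).ordConnected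
  have hoc1 : OrdConnected (R '' Icc a b) := (isPreconnected_Icc.image R h1).ordConnected
  have hA : R a ∈ R '' Icc a b := ⟨a, left_mem_Icc.2 hab.le, rfl⟩
  have hB : R b ∈ R '' Icc a b := ⟨b, right_mem_Icc.2 hab.le, rfl⟩
  have key : R '' Icc a b ⊆ uIcc (R a) (R b) := by
    rcases h1.strictMonoOn_of_injOn_Icc' hab.le i1 with h | h
    · rintro _ ⟨τ, hτ, rfl⟩
      exact Icc_subset_uIcc ⟨h.monotoneOn (left_mem_Icc.2 hab.le) hτ hτ.1,
        h.monotoneOn hτ (right_mem_Icc.2 hab.le) hτ.2⟩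
    · rintro _ ⟨τ, hτ, rfl⟩
      exact Icc_subset_uIcc' ⟨h.antitoneOn hτ (right_mem_Icc.2 hab.le) hτ.2,
        h.antitoneOn (left_mem_Icc.2 hab.le) hτ hτ.1⟩
  have hy := key (image_mono Ioo_subset_Icc_self hy1)
  intro z hz
  have hz' : z ∈ uIcc (R a) (R b) := by
    by_contra hcon
    rw [mem_uIcc] at hy hcon
    have hab' : R a ∈ uIcc y z ∨ R b ∈ uIcc y z := by
      simp only [mem_uIcc]
      grind
    rcases hab' with h | h
    · exact ha (hoc.uIcc_subset hy2 hz h)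
    · exact hb (hoc.uIcc_subset hy2 hz h)
  obtain ⟨τ, hτ, rfl⟩ := hoc1.uIcc_subset hA hB hz'
  refine ⟨τ, ⟨lt_of_le_of_ne hτ.1 ?_, lt_of_le_of_ne hτ.2 ?_⟩, rfl⟩
  · rintro rfl; exact ha hz
  · rintro rfl; exact hb hz

/-- `φ` is `R` on `[c, d]` followed by the inverse of `R` on `[a, b]`, which is continuous by
compactness. The end points `c`, `d` have values outside the image of the open interval, so they go
to `a` or `b`, and to different ones by injectivity. -/
theorem exists_reparam_real {R : ℝ → ℝ} {a b c d : ℝ} (hab : a < b) (hcd : c < d)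
    (h1 : ContinuousOn R (Icc a b)) (h2 : ContinuousOn R (Icc c d))
    (i1 : InjOn R (Icc a b)) (i2 : InjOn R (Icc c d))
    (ha : R a ∉ R '' Ioo c d) (hb : R b ∉ R '' Ioo c d)
    (hc : R c ∉ R '' Ioo a b) (hd : R d ∉ R '' Ioo a b)
    (hne : (R '' Ioo a b ∩ R '' Ioo c d).Nonempty) :
    ∃ φ : ℝ → ℝ, ContinuousOn φ (Icc c d) ∧ MapsTo φ (Icc c d) (Icc a b) ∧
      MapsTo φ (Ioo c d) (Ioo a b) ∧ (∀ τ ∈ Icc c d, R (φ τ) = R τ) ∧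
      ((φ c = a ∧ φ d = b) ∨ (φ c = b ∧ φ d = a)) := by
  have hsub := image_Ioo_subset_of_disjoint_ends hab h1 h2 i1 ha hb hne
  have hsub' : R '' Icc c d ⊆ R '' Icc a b := by
    have hcl : IsClosed (R '' Icc a b) := (isCompact_Icc.image_of_continuousOn h1).isClosed
    rintro _ ⟨τ, hτ, rfl⟩
    rw [← closure_Ioo hcd.ne] at hτ h2
    have := h2.image_closure (mem_image_of_mem R hτ)
    exact hcl.closure_subset_iff.2 (hsub.trans (image_mono Ioo_subset_Icc_self)) this
  choose! φ hφ hR using fun τ (hτ : τ ∈ Icc c d) => hsub' (mem_image_of_mem R hτ)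
  have hIoo : MapsTo φ (Ioo c d) (Ioo a b) := by
    intro τ hτ
    obtain ⟨τ', hτ', h⟩ := hsub (mem_image_of_mem R hτ)
    rw [i1 (hφ τ (Ioo_subset_Icc_self hτ)) (Ioo_subset_Icc_self hτ')
      ((hR τ (Ioo_subset_Icc_self hτ)).trans h.symm)]
    exact hτ'
  have hend : ∀ τ ∈ Icc c d, R τ ∉ R '' Ioo a b → φ τ = a ∨ φ τ = b := by
    intro τ hτ hn
    by_contra! hcon
    exact hn ⟨φ τ, ⟨lt_of_le_of_ne (hφ τ hτ).1 hcon.1.symm, lt_of_le_of_ne (hφ τ hτ).2 hcon.2⟩,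
      hR τ hτ⟩
  have hcm := left_mem_Icc.2 hcd.le
  have hdm := right_mem_Icc.2 hcd.le
  have hne' : φ c ≠ φ d := fun h => hcd.ne (i2 hcm hdm (by rw [← hR c hcm, ← hR d hdm, h]))
  refine ⟨φ, ?_, hφ, hIoo, hR, ?_⟩
  · have hemb : IsEmbedding ((Icc a b).domRestrict R) := by
      refine (Continuous.isClosedEmbedding ?_ ?_).isEmbedding
      · exact h1.domRestrict
      · exact injOn_iff_injective.1 i1
    rw [continuousOn_iff_continuous_domRestrict] at h2 ⊢
    have : Continuous (MapsTo.restrict φ _ _ hφ) := by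
      rw [hemb.continuous_iff]
      convert h2 using 1
      ext τ
      exact hR τ τ.2
    exact continuous_subtype_val.comp this
  · rcases hend c hcm hc with h | h <;> rcases hend d hdm hd with h' | h' <;> grind

end Reparametrization

/-! ### Decomposition of a curve into edges -/

section Decomposition

variable {E : Type*} [NormedAddCommGroup E] [NormedSpace ℝ E]
  {H : Type*} [TopologicalSpace H] (I : ModelWithCorners ℝ E H)
  {M : Type*} [TopologicalSpace M] [ChartedSpace H M]

/-- On `[a, b]` the curve `f` is injective, and it is analytic and immersive inside. -/
structure IsEdge (f : ℝ → M) (a b : ℝ) : Prop where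
  inj : InjOn f (Icc a b)
  analytic : ∀ τ ∈ Ioo a b, ContMDiffAt 𝓘(ℝ, ℝ) I ω f τ
  immersive : ∀ τ ∈ Ioo a b, ∃ h : M → ℝ, ContMDiffAt I 𝓘(ℝ, ℝ) ω h (f τ) ∧
    0 < deriv (fun s => h (f s)) τ

variable [FiniteDimensional ℝ E]

/-- The restriction of `f` to `[a, b]` runs monotonically along the branch `σ` of the star
at `p`. -/
structure IsArc (f : ℝ → M) (p : M) (σ : ℝ → EuclideanSpace ℝ (Fin (Module.finrank ℝ E)))
    (a b : ℝ) : Prop where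
  mem : ∀ τ ∈ Icc a b, f τ ∈ (chartAt H p).source
  branch : ∀ τ ∈ Icc a b, radialChart I p (f τ) = σ ‖radialChart I p (f τ)‖
  inj : InjOn (fun τ => ‖radialChart I p (f τ)‖) (Icc a b)
  radial : ∀ τ ∈ Ioo a b, RadialAt I f p σ τ

variable {I}

theorem norm_radialChart_le_of_mem_closure {p q : M} {r : ℝ}
    (hq : q ∈ closure (coordBall I p r)) (hs : q ∈ (chartAt H p).source) :
    ‖radialChart I p q‖ ≤ r := by
  by_contra! hlt
  have hopen := (continuousOn_radialChart I p).norm.isOpen_inter_preimage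
    (chartAt H p).open_source (isOpen_Ioi (a := r))
  obtain ⟨z, hz, hz'⟩ := mem_closure_iff.1 hq _ hopen ⟨hs, hlt⟩
  exact lt_asymm hz.2 hz'.2

theorem IsArc.continuousOn {f : ℝ → M} (hfc : Continuous f) {p : M} {a b : ℝ}
    {σ : ℝ → EuclideanSpace ℝ (Fin (Module.finrank ℝ E))} (h : IsArc I f p σ a b) :
    ContinuousOn (fun τ => ‖radialChart I p (f τ)‖) (Icc a b) :=
  ((continuousOn_radialChart I p).comp hfc.continuousOn h.mem).norm

/-- On a common branch the radius determines the point; this reduces the comparison of two arcs to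
real functions. -/
theorem IsArc.eq_of_norm_eq {f : ℝ → M} {p : M} {a b c d : ℝ}
    {σ : ℝ → EuclideanSpace ℝ (Fin (Module.finrank ℝ E))} (h : IsArc I f p σ a b)
    (h' : IsArc I f p σ c d) {τ τ' : ℝ} (hτ : τ ∈ Icc a b) (hτ' : τ' ∈ Icc c d)
    (he : ‖radialChart I p (f τ)‖ = ‖radialChart I p (f τ')‖) : f τ = f τ' := by
  refine injOn_radialChart I p (h.mem τ hτ) (h'.mem τ' hτ') ?_
  rw [h.branch τ hτ, h'.branch τ' hτ', he]

/-- Each branch `σ` meets the sphere of radius `r` in at most the single coordinate point `σ r`. -/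
theorem IsStar.finite_sphere {f : ℝ → M} {p : M} {ε r : ℝ}
    {B : Set (ℝ → EuclideanSpace ℝ (Fin (Module.finrank ℝ E)))} (hS : IsStar I f p ε B)
    (hr0 : 0 < r) (hr : r < ε) :
    {q | q ∈ f '' Icc 0 1 ∧ q ∈ (chartAt H p).source ∧ ‖radialChart I p q‖ = r}.Finite := by
  refine Finite.of_finite_image (f := radialChart I p) ?_
    ((injOn_radialChart I p).mono fun q hq => hq.2.1)
  refine (hS.finite.image fun σ => σ r).subset ?_
  rintro _ ⟨_, ⟨⟨t, ht, rfl⟩, hq, hqr⟩, rfl⟩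
  obtain h | ⟨σ, hσ, h⟩ := hS.radial t ht ⟨hq, hqr ▸ hr⟩
  · rw [h, radialChart_self, norm_zero] at hqr
    exact (hr0.ne hqr).elim
  · exact ⟨σ, hσ, by rw [h.branch, hqr]⟩

variable [IsManifold I ω M]

theorem RadialAt.hasStrictDerivAt {f : ℝ → M} {p : M}
    {σ : ℝ → EuclideanSpace ℝ (Fin (Module.finrank ℝ E))} {t : ℝ} (h : RadialAt I f p σ t) :
    HasStrictDerivAt (fun s => ‖radialChart I p (f s)‖ ^ 2)
      (deriv (fun s => ‖radialChart I p (f s)‖ ^ 2) t) t := by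
  have := analyticAt_radialChart_comp h.analytic h.mem
  exact ((this.contDiffAt.norm_sq ℝ (n := ω)).analyticAt).hasStrictDerivAt

/-- Three connectedness arguments: a piece that avoids the sphere stays in the ball, a piece that
avoids the centre stays on its branch, and a radius whose square has nonvanishing derivative is
monotone. The closed interval is reached by continuity, possibly at the centre or on the sphere. -/
theorem IsStar.isArc {f : ℝ → M} (hfc : Continuous f) {p : M} {ε r : ℝ}
    {B : Set (ℝ → EuclideanSpace ℝ (Fin (Module.finrank ℝ E)))} (hS : IsStar I f p ε B)
    (hr : r < ε) {a b m : ℝ} (ha : 0 ≤ a) (hb : b ≤ 1)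
    (hav : ∀ τ ∈ Ioo a b, f τ ≠ p ∧
      ¬(f τ ∈ (chartAt H p).source ∧ ‖radialChart I p (f τ)‖ = r))
    (hm : m ∈ Ioo a b) (hmr : f m ∈ coordBall I p r)
    {σ : ℝ → EuclideanSpace ℝ (Fin (Module.finrank ℝ E))} (hσ : σ ∈ B) (hmσ : RadialAt I f p σ m) :
    IsArc I f p σ a b := by
  have hab : a < b := hm.1.trans hm.2
  have hsrc : closure (coordBall I p r) ⊆ (chartAt H p).source :=
    (closure_mono (coordBall_mono hr.le)).trans hS.closure_subset
  have hcl : ∀ τ ∈ closure (f ⁻¹' coordBall I p r), f τ ∈ closure (coordBall I p r) :=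
    fun τ hτ => hfc.closure_preimage_subset _ hτ
  -- the curve stays in the coordinate ball
  have hin : Ioo a b ⊆ f ⁻¹' coordBall I p r := by
    refine isPreconnected_Ioo.subset_of_closure_inter_subset
      ((isOpen_coordBall I p r).preimage hfc) ⟨m, hm, hmr⟩ ?_
    rintro τ ⟨hτ, hτ'⟩
    have h1 := hsrc (hcl τ hτ)
    exact ⟨h1, lt_of_le_of_ne (norm_radialChart_le_of_mem_closure (hcl τ hτ) h1)
      fun h => (hav τ hτ').2 ⟨h1, h⟩⟩
  have hIcc : ∀ τ ∈ Icc a b, f τ ∈ closure (coordBall I p r) := by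
    intro τ hτ
    rw [← closure_Ioo hab.ne] at hτ
    exact hcl τ (closure_mono hin hτ)
  have hmem : ∀ τ ∈ Icc a b, f τ ∈ (chartAt H p).source := fun τ hτ => hsrc (hIcc τ hτ)
  have hle : ∀ τ ∈ Icc a b, ‖radialChart I p (f τ)‖ ≤ r := fun τ hτ =>
    norm_radialChart_le_of_mem_closure (hIcc τ hτ) (hmem τ hτ)
  have hcont : ContinuousOn (fun τ => radialChart I p (f τ)) (Icc a b) :=
    (continuousOn_radialChart I p).comp hfc.continuousOn hmem
  have hbr : ∀ τ ∈ Ioo a b, ∃ σ' ∈ B, RadialAt I f p σ' τ := fun τ hτ =>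
    (hS.radial τ ⟨ha.trans hτ.1.le, hτ.2.le.trans hb⟩ (coordBall_mono hr.le (hin hτ))).resolve_left
      (hav τ hτ).1
  have hIoc : ∀ τ ∈ Ioo a b, ‖radialChart I p (f τ)‖ ∈ Ioc 0 ε := fun τ hτ => by
    refine ⟨norm_pos_iff.2 fun h => ?_, (hle τ (Ioo_subset_Icc_self hτ)).trans hr.le⟩
    exact (hav τ hτ).1 ((radialChart_eq_zero_iff I (hmem τ (Ioo_subset_Icc_self hτ))).1 h)
  have hσcont : ∀ σ' ∈ B, ContinuousOn (fun τ => σ' ‖radialChart I p (f τ)‖) (Icc a b) :=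
    fun σ' hσ' => (hS.cont σ' hσ').comp hcont.norm
      fun τ hτ => ⟨norm_nonneg _, (hle τ hτ).trans hr.le⟩
  have hopen : ∀ σ' ∈ B,
      IsOpen (Ioo a b ∩ {τ | radialChart I p (f τ) - σ' ‖radialChart I p (f τ)‖ ≠ 0}) :=
    fun σ' hσ' => ((hcont.sub (hσcont σ' hσ')).mono Ioo_subset_Icc_self).isOpen_inter_preimage
      isOpen_Ioo isOpen_compl_singleton
  -- the curve stays on the branch
  have hbranch : ∀ τ ∈ Ioo a b, radialChart I p (f τ) = σ ‖radialChart I p (f τ)‖ := by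
    -- Lying on `σ` is a closed condition. As the finitely many branches are pairwise equal or
    -- disjoint, it amounts to lying on no branch different from `σ`, which is open.
    set u : Set ℝ := Ioo a b ∩ ⋂ σ' ∈ {σ' ∈ B | ∀ ρ ∈ Ioc 0 ε, σ ρ ≠ σ' ρ},
      (Ioo a b ∩ {τ | radialChart I p (f τ) - σ' ‖radialChart I p (f τ)‖ ≠ 0}) with hu
    have hu_iff : ∀ τ ∈ Ioo a b, τ ∈ u ↔ radialChart I p (f τ) = σ ‖radialChart I p (f τ)‖ := by
      intro τ hτ
      constructor
      · rintro ⟨-, h⟩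
        obtain ⟨σ', hσ', hr'⟩ := hbr τ hτ
        rcases hS.eq_or_ne σ hσ σ' hσ' with he | hn
        · rw [he _ (hIoc τ hτ)]
          exact hr'.branch
        · have := mem_iInter₂.1 h σ' ⟨hσ', hn⟩
          exact (this.2 (sub_eq_zero.2 hr'.branch)).elim
      · refine fun h => ⟨hτ, mem_iInter₂.2 fun σ' hσ' => ⟨hτ, fun h0 => ?_⟩⟩
        exact hσ'.2 _ (hIoc τ hτ) (h.symm.trans (sub_eq_zero.1 h0))
    have hsub : Ioo a b ⊆ u := by
      refine isPreconnected_Ioo.subset_of_closure_inter_subset ?_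
        ⟨m, hm, (hu_iff m hm).2 hmσ.branch⟩ ?_
      · exact isOpen_Ioo.inter ((hS.finite.subset (sep_subset _ _)).isOpen_biInter
          fun σ' hσ' => hopen σ' hσ'.1)
      · rintro τ ⟨hτ, hτ'⟩
        rw [hu_iff τ hτ']
        by_contra hcon
        obtain ⟨z, hz, hzu⟩ := mem_closure_iff.1 hτ _ (hopen σ hσ) ⟨hτ', sub_ne_zero.2 hcon⟩
        exact hz.2 (sub_eq_zero.2 ((hu_iff z hz.1).1 hzu))
    exact fun τ hτ => (hu_iff τ hτ).1 (hsub hτ)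
  have hrad : ∀ τ ∈ Ioo a b, RadialAt I f p σ τ := fun τ hτ => by
    obtain ⟨σ', -, h⟩ := hbr τ hτ
    exact ⟨h.mem, h.ne, hbranch τ hτ, h.deriv_ne, h.analytic⟩
  refine ⟨hmem, ?_, ?_, hrad⟩
  · have := EqOn.of_subset_closure (s := Ioo a b) (t := Icc a b) hbranch hcont (hσcont σ hσ)
      Ioo_subset_Icc_self (closure_Ioo hab.ne).ge
    exact this
  · have hinj : InjOn (fun τ => ‖radialChart I p (f τ)‖ ^ 2) (Icc a b) := by
      have hc2 : ContinuousOn (fun τ => ‖radialChart I p (f τ)‖ ^ 2) (Icc a b) := hcont.norm.pow 2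
      -- By Darboux's theorem a derivative without zeros has constant sign.
      rcases hasDerivWithinAt_forall_lt_or_forall_gt_of_forall_ne (convex_Ioo a b) (m := 0)
        (fun τ hτ => (hrad τ hτ).hasStrictDerivAt.hasDerivAt.hasDerivWithinAt)
        (fun τ hτ => (hrad τ hτ).deriv_ne) with h | h
      · exact (strictAntiOn_of_deriv_neg (convex_Icc a b) hc2 (by rwa [interior_Icc])).injOn
      · exact (strictMonoOn_of_deriv_pos (convex_Icc a b) hc2 (by rwa [interior_Icc])).injOn
    intro τ hτ τ' hτ' h
    exact hinj hτ hτ' (by dsimp only at h ⊢; rw [h])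

/-- The squared radius, up to sign, is the function that increases along the arc. -/
theorem IsArc.isEdge {f : ℝ → M} {p : M} {a b : ℝ}
    {σ : ℝ → EuclideanSpace ℝ (Fin (Module.finrank ℝ E))} (h : IsArc I f p σ a b) :
    IsEdge I f a b where
  inj τ hτ τ' hτ' he := h.inj hτ hτ' (by dsimp only; rw [he])
  analytic τ hτ := (h.radial τ hτ).analytic
  immersive τ hτ := by
    have hr := h.radial τ hτ
    have hs : ContMDiffAt I 𝓘(ℝ, ℝ) ω (fun q => ‖radialChart I p q‖ ^ 2) (f τ) := by
      have h1 := ((contMDiffOn_radialChart I p).contMDiffAt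
        ((chartAt H p).open_source.mem_nhds hr.mem))
      have h2 : ContMDiff 𝓘(ℝ, EuclideanSpace ℝ (Fin (Module.finrank ℝ E))) 𝓘(ℝ, ℝ) ω
          (fun v : EuclideanSpace ℝ (Fin (Module.finrank ℝ E)) => ‖v‖ ^ 2) :=
        (contDiff_norm_sq ℝ).contMDiff
      exact ContMDiffAt.comp (f τ) h2.contMDiffAt h1
    rcases hr.deriv_ne.lt_or_gt with hlt | hgt
    · refine ⟨fun q => -‖radialChart I p q‖ ^ 2, hs.neg, ?_⟩
      rw [deriv.fun_neg]
      linarith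
    · exact ⟨_, hs, hgt⟩

/-- In the radius coordinate both arcs become real intervals. The finite set `V` of vertices keeps
the ends of one arc out of the interior of the other, so two arcs that meet inside run over the same
points. -/
theorem IsArc.exists_isReparam {f : ℝ → M} (hfc : Continuous f) {p : M} {a b c d : ℝ}
    (hab : a < b) (hcd : c < d)
    {σ : ℝ → EuclideanSpace ℝ (Fin (Module.finrank ℝ E))} (h : IsArc I f p σ a b)
    (h' : IsArc I f p σ c d) {V : Set M} (ha : f a ∈ V) (hb : f b ∈ V) (hc : f c ∈ V) (hd : f d ∈ V)
    (hV : ∀ τ ∈ Ioo a b, f τ ∉ V) (hV' : ∀ τ ∈ Ioo c d, f τ ∉ V)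
    {τ τ' : ℝ} (hτ : τ ∈ Ioo a b) (hτ' : τ' ∈ Ioo c d) (he : f τ = f τ') :
    ∃ φ, IsReparam f a b c d φ := by
  have hn : ∀ z ∈ Icc a b, f z ∈ V →
      ‖radialChart I p (f z)‖ ∉ (fun τ => ‖radialChart I p (f τ)‖) '' Ioo c d := by
    rintro z hz hzV ⟨s, hs, hs'⟩
    refine hV' s hs ?_
    rwa [h'.eq_of_norm_eq h (Ioo_subset_Icc_self hs) hz hs']
  have hn' : ∀ z ∈ Icc c d, f z ∈ V →
      ‖radialChart I p (f z)‖ ∉ (fun τ => ‖radialChart I p (f τ)‖) '' Ioo a b := by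
    rintro z hz hzV ⟨s, hs, hs'⟩
    refine hV s hs ?_
    rwa [h.eq_of_norm_eq h' (Ioo_subset_Icc_self hs) hz hs']
  obtain ⟨φ, h1, h2, h3, h4, h5⟩ := exists_reparam_real hab hcd (h.continuousOn hfc)
    (h'.continuousOn hfc) h.inj h'.inj (hn a (left_mem_Icc.2 hab.le) ha)
    (hn b (right_mem_Icc.2 hab.le) hb) (hn' c (left_mem_Icc.2 hcd.le) hc)
    (hn' d (right_mem_Icc.2 hcd.le) hd)
    ⟨‖radialChart I p (f τ)‖, ⟨τ, hτ, rfl⟩, ⟨τ', hτ', by dsimp only; rw [he]⟩⟩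
  refine ⟨φ, h1, h2, h3, fun s hs => ?_, fun s hs => h.eq_of_norm_eq h' (h2 hs) hs (h4 s hs), h5⟩
  have hφ := h.radial _ (h3 hs)
  have hst := hφ.hasStrictDerivAt
  have hinv := hst.eventually_left_inverse hφ.deriv_ne
  have hder := (hst.to_localInverse hφ.deriv_ne).hasDerivAt
  have hcφ : ContinuousAt φ s := h1.continuousAt (Icc_mem_nhds hs.1 hs.2)
  -- Locally `φ` is the squared radius along the second arc followed by the inverse function of the
  -- squared radius along the first, so it is differentiable.
  have hev : φ =ᶠ[𝓝 s] fun z => hst.localInverse _ _ _ hφ.deriv_ne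
      (‖radialChart I p (f z)‖ ^ 2) := by
    filter_upwards [hcφ.eventually hinv, Ioo_mem_nhds hs.1 hs.2] with z hz hz'
    rw [← h4 z (Ioo_subset_Icc_self hz'), hz]
  refine DifferentiableAt.congr_of_eventuallyEq ?_ hev
  refine DifferentiableAt.comp (g := hst.localInverse _ _ _ hφ.deriv_ne)
    (f := fun z => ‖radialChart I p (f z)‖ ^ 2) s ?_
    (h'.radial s hs).hasStrictDerivAt.hasDerivAt.differentiableAt
  have := h4 s (Ioo_subset_Icc_self hs)
  rw [← this]
  exact hder.differentiableAt

variable (I) in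
/-- A partition of `[0, 1]` such that `f` is constant or an edge on each piece, and such that an
edge is disjoint from each other piece or a reparametrization of it. -/
structure IsEdgePartition (f : ℝ → M) (n : ℕ) (t : ℕ → ℝ) : Prop where
  zero : t 0 = 0
  one : t n = 1
  lt : ∀ i < n, t i < t (i + 1)
  const_or_edge : ∀ i < n, (∀ τ ∈ Icc (t i) (t (i + 1)), f τ = f (t i)) ∨
    IsEdge I f (t i) (t (i + 1))
  disjoint_or : ∀ i < n, IsEdge I f (t i) (t (i + 1)) → ∀ j < n,
    Disjoint (f '' Ioo (t i) (t (i + 1))) (f '' Icc (t j) (t (j + 1))) ∨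
    (IsEdge I f (t j) (t (j + 1)) ∧ ∃ φ, IsReparam f (t i) (t (i + 1)) (t j) (t (j + 1)) φ)

theorem exists_sorted_partition {S : Set ℝ} (hS : S.Finite) :
    ∃ (n : ℕ) (t : ℕ → ℝ), t 0 = 0 ∧ t n = 1 ∧ (∀ i < n, t i < t (i + 1)) ∧
      (∀ i ≤ n, t i ∈ S ∪ {0, 1}) ∧ ∀ i < n, Disjoint (Ioo (t i) (t (i + 1))) S := by
  classical
  set s : Finset ℝ := hS.toFinset.filter (· ∈ Icc (0 : ℝ) 1) ∪ {0, 1} with hs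
  have h0s : (0 : ℝ) ∈ s := by simp [hs]
  have h1s : (1 : ℝ) ∈ s := by simp [hs]
  have hsI : ∀ r ∈ s, r ∈ Icc (0 : ℝ) 1 := by
    intro r hr
    simp only [hs, Finset.mem_union, Finset.mem_filter, Finset.mem_insert,
      Finset.mem_singleton] at hr
    rcases hr with ⟨-, h⟩ | rfl | rfl
    · exact h
    · simp
    · simp
  have hsS : ∀ r ∈ s, r ∈ S ∪ {0, 1} := by
    intro r hr
    simp only [hs, Finset.mem_union, Finset.mem_filter, Finset.mem_insert,
      Finset.mem_singleton, Finite.mem_toFinset] at hr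
    rcases hr with ⟨h, -⟩ | h
    · exact Or.inl h
    · exact Or.inr h
  obtain ⟨n, hn⟩ : ∃ n, s.card = n + 1 :=
    Nat.exists_eq_succ_of_ne_zero (Finset.card_ne_zero_of_mem h0s)
  set e := s.orderEmbOfFin hn
  have he : ∀ r ∈ s, ∃ k, e k = r := fun r hr => by
    have : r ∈ Set.range e := by rw [Finset.range_orderEmbOfFin]; exact hr
    exact this
  set t : ℕ → ℝ := fun i => if h : i < n + 1 then e ⟨i, h⟩ else 1 with ht
  have hti : ∀ i (h : i < n + 1), t i = e ⟨i, h⟩ := fun i h => dif_pos h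
  have hts : ∀ i (h : i < n + 1), t i ∈ s := fun i h => by
    rw [hti i h]; exact Finset.orderEmbOfFin_mem _ _ _
  refine ⟨n, t, ?_, ?_, fun i hi => ?_, fun i hi => hsS _ (hts i (by omega)), fun i hi => ?_⟩
  · obtain ⟨k, hk⟩ := he 0 h0s
    refine le_antisymm ?_ (hsI _ (hts 0 (by omega))).1
    rw [hti 0 (by omega), ← hk]
    exact e.monotone (Fin.mk_le_of_le_val (Nat.zero_le _))
  · obtain ⟨k, hk⟩ := he 1 h1s
    refine le_antisymm (hsI _ (hts n (by omega))).2 ?_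
    rw [hti n (by omega), ← hk]
    exact e.monotone (Fin.le_def.2 (by have := k.2; simp only; omega))
  · rw [hti i (by omega), hti (i + 1) (by omega)]
    exact e.strictMono (Fin.mk_lt_mk.2 (Nat.lt_succ_self i))
  · rw [Set.disjoint_left]
    intro r hr hrS
    have hrI : r ∈ Icc (0 : ℝ) 1 := ⟨(hsI _ (hts i (by omega))).1.trans hr.1.le,
      hr.2.le.trans (hsI _ (hts (i + 1) (by omega))).2⟩
    obtain ⟨k, hk⟩ := he r (by
      simp only [hs, Finset.mem_union, Finset.mem_filter,
        Finite.mem_toFinset]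
      exact Or.inl ⟨hrS, hrI⟩)
    rw [hti i (by omega), hti (i + 1) (by omega), ← hk] at hr
    have h1 := e.lt_iff_lt.1 hr.1
    have h2 := e.lt_iff_lt.1 hr.2
    rw [Fin.lt_def] at h1 h2
    simp only at h1 h2
    omega

/-- `f ⁻¹' V` may contain intervals, so only its frontier can be finite. On each side of a parameter
`f` is constant or avoids its value there, hence frontier points are isolated. -/
theorem HasAnalyticGerms.frontier_preimage_finite [T1Space M] {f : ℝ → M}
    (hf : HasAnalyticGerms I f) (hfc : Continuous f) {V : Set M} (hV : V.Finite) :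
    (Icc 0 1 ∩ frontier (f ⁻¹' V)).Finite := by
  refine isCompact_Icc.induction_on (p := fun s : Set ℝ => (s ∩ frontier (f ⁻¹' V)).Finite)
    (by simp) (fun s s' hss h => h.subset (inter_subset_inter_left _ hss))
    (fun s s' h h' => by rw [union_inter_distrib_right]; exact h.union h') fun t₀ _ => ?_
  have hav : ∀ᶠ t in 𝓝 t₀, f t ∈ V → f t = f t₀ := by
    have := (hV.subset (sdiff_subset (t := {f t₀}))).isClosed.isOpen_compl.preimage hfc
    filter_upwards [this.mem_nhds (by simp)] with t ht htV
    by_contra hne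
    exact ht ⟨htV, hne⟩
  have key : ∀ l : Filter ℝ, l ≤ 𝓝 t₀ → ((∀ᶠ t in l, f t = f t₀) ∨ ∀ᶠ t in l, f t ≠ f t₀) →
      (∀ᶠ t in l, t ∈ f ⁻¹' V) ∨ ∀ᶠ t in l, t ∈ (f ⁻¹' V)ᶜ := by
    rintro l hl (h | h)
    · by_cases h0 : f t₀ ∈ V
      · exact Or.inl (h.mono fun t ht => by rw [mem_preimage, ht]; exact h0)
      · exact Or.inr (h.mono fun t ht => by rw [mem_compl_iff, mem_preimage, ht]; exact h0)
    · exact Or.inr ((h.and (hl hav)).mono fun t ht h' => ht.1 (ht.2 h'))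
  have hfr : ∀ (s : Set ℝ), IsOpen s → ((∀ᶠ t in 𝓝[s] t₀, t ∈ f ⁻¹' V) ∨
      ∀ᶠ t in 𝓝[s] t₀, t ∈ (f ⁻¹' V)ᶜ) → ∀ᶠ t in 𝓝[s] t₀, t ∉ frontier (f ⁻¹' V) := by
    rintro s hs (h | h)
    · filter_upwards [eventually_eventually_nhdsWithin.2 h, self_mem_nhdsWithin] with t ht hts
      rw [hs.nhdsWithin_eq hts] at ht
      exact fun h' => h'.2 (mem_interior_iff_mem_nhds.2 ht)
    · filter_upwards [eventually_eventually_nhdsWithin.2 h, self_mem_nhdsWithin] with t ht hts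
      rw [hs.nhdsWithin_eq hts] at ht
      rw [← frontier_compl]
      exact fun h' => h'.2 (mem_interior_iff_mem_nhds.2 ht)
  have hr := hfr _ isOpen_Ioi (key (𝓝[>] t₀) nhdsWithin_le_nhds
    ((hf.right t₀).imp_right fun ⟨σ, _, h⟩ => h.mono fun _ h => h.ne))
  have hl := hfr _ isOpen_Iio (key (𝓝[<] t₀) nhdsWithin_le_nhds
    ((hf.left t₀).imp_right fun ⟨σ, _, h⟩ => h.mono fun _ h => h.ne))
  have hall : ∀ᶠ t in 𝓝 t₀, t ∈ frontier (f ⁻¹' V) → t = t₀ := by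
    rw [← nhdsNE_sup_pure, ← nhdsLT_sup_nhdsGT, eventually_sup, eventually_sup]
    exact ⟨⟨hl.mono fun t h h' => (h h').elim, hr.mono fun t h h' => (h h').elim⟩, by simp⟩
  exact ⟨_, mem_nhdsWithin_of_mem_nhds hall, (finite_singleton t₀).subset fun t ht => ht.1 ht.2⟩

/-- Cut at the frontier of `f ⁻¹' V`: between consecutive cuts `f` is always or never in `V`. In the
first case it is a continuous map from an interval to a finite set, hence constant. -/
theorem HasAnalyticGerms.exists_partition [T1Space M] {f : ℝ → M}
    (hf : HasAnalyticGerms I f) (hfc : Continuous f) {V : Set M} (hV : V.Finite) (h0 : f 0 ∈ V)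
    (h1 : f 1 ∈ V) : ∃ (n : ℕ) (t : ℕ → ℝ), t 0 = 0 ∧ t n = 1 ∧ (∀ i < n, t i < t (i + 1)) ∧
      (∀ i ≤ n, t i ∈ Icc (0 : ℝ) 1 ∧ f (t i) ∈ V) ∧
      ∀ i < n, (∀ τ ∈ Icc (t i) (t (i + 1)), f τ = f (t i)) ∨
        ∀ τ ∈ Ioo (t i) (t (i + 1)), f τ ∉ V := by
  have hcl : IsClosed (f ⁻¹' V) := hV.isClosed.preimage hfc
  obtain ⟨n, t, ht0, htn, hlt, hmem, hdis⟩ :=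
    exists_sorted_partition (hf.frontier_preimage_finite hfc hV)
  have htI : ∀ i ≤ n, t i ∈ Icc (0 : ℝ) 1 ∧ f (t i) ∈ V := fun i hi => by
    rcases hmem i hi with h | h | h
    · exact ⟨h.1, hcl.frontier_subset h.2⟩
    · rw [h]; exact ⟨by simp, h0⟩
    · rw [h]; exact ⟨by simp, h1⟩
  refine ⟨n, t, ht0, htn, hlt, htI, fun i hi => ?_⟩
  by_cases hex : ∃ τ ∈ Ioo (t i) (t (i + 1)), f τ ∈ V
  · left
    obtain ⟨τ, hτ, hτV⟩ := hex
    have hnf : ∀ τ ∈ Ioo (t i) (t (i + 1)), τ ∈ f ⁻¹' V → τ ∈ interior (f ⁻¹' V) := by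
      intro τ hτ hτV
      by_contra hni
      refine Set.disjoint_left.1 (hdis i hi) hτ ⟨⟨?_, ?_⟩, subset_closure hτV, hni⟩
      · exact (htI i hi.le).1.1.trans hτ.1.le
      · exact hτ.2.le.trans (htI (i + 1) hi).1.2
    have hsub : Ioo (t i) (t (i + 1)) ⊆ interior (f ⁻¹' V) := by
      refine isPreconnected_Ioo.subset_of_closure_inter_subset isOpen_interior
        ⟨τ, hτ, hnf τ hτ hτV⟩ fun τ' hτ' => hnf τ' hτ'.2 ?_
      exact closure_minimal interior_subset hcl hτ'.1
    have hIcc : MapsTo f (Icc (t i) (t (i + 1))) V := by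
      rw [← closure_Ioo (hlt i hi).ne]
      exact fun τ hτ => closure_minimal (hsub.trans interior_subset) hcl hτ
    exact fun τ hτ => isPreconnected_Icc.constant_of_mapsTo hV.isDiscrete hfc.continuousOn hIcc hτ
      (left_mem_Icc.2 (hlt i hi).le)
  · right
    exact fun τ hτ h => hex ⟨τ, hτ, h⟩

/-- Finitely many stars of half radius cover the image, and the vertices are their centres, the
points on their spheres and the end points. A piece that avoids the vertices is an arc of every star
whose half ball it meets, so two pieces with a common interior point are arcs of one star on one
branch. Halving leaves room for pieces that end on the sphere. -/
theorem exists_isEdgePartition [T2Space M] {f : ℝ → M} (hf : HasAnalyticGerms I f)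
    (hfc : Continuous f) : ∃ n t, IsEdgePartition I f n t := by
  choose ε B hS using exists_isStar hf hfc
  have hhalf : ∀ p, ε p / 2 < ε p := fun p => half_lt_self (hS p).pos
  obtain ⟨T, -, hT⟩ := (isCompact_Icc.image (s := Icc (0 : ℝ) 1) hfc).elim_nhds_subcover
    (fun p => coordBall I p (ε p / 2))
    (fun p _ => (isOpen_coordBall I p _).mem_nhds (self_mem_coordBall I p (half_pos (hS p).pos)))
  set V : Set M := {f 0, f 1} ∪ ⋃ p ∈ T, ({p} ∪ {q | q ∈ f '' Icc 0 1 ∧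
    q ∈ (chartAt H p).source ∧ ‖radialChart I p q‖ = ε p / 2}) with hVdef
  have hV : V.Finite := by
    refine (toFinite _).union (T.finite_toSet.biUnion fun p _ => (finite_singleton p).union ?_)
    exact (hS p).finite_sphere (half_pos (hS p).pos) (hhalf p)
  have hpV : ∀ p ∈ T, p ∈ V := fun p hp => Or.inr (mem_iUnion₂.2 ⟨p, hp, Or.inl rfl⟩)
  have hqV : ∀ p ∈ T, ∀ τ ∈ Icc (0 : ℝ) 1, f τ ∈ (chartAt H p).source →
      ‖radialChart I p (f τ)‖ = ε p / 2 → f τ ∈ V := fun p hp τ hτ h1 h2 =>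
    Or.inr (mem_iUnion₂.2 ⟨p, hp, Or.inr ⟨mem_image_of_mem f hτ, h1, h2⟩⟩)
  obtain ⟨n, t, ht0, htn, hlt, htI, hpiece⟩ :=
    hf.exists_partition hfc hV (Or.inl (by simp)) (Or.inl (by simp))
  have hsubI : ∀ i < n, Icc (t i) (t (i + 1)) ⊆ Icc 0 1 := fun i hi =>
    Icc_subset_Icc (htI i hi.le).1.1 (htI (i + 1) hi).1.2
  have hcover : ∀ τ ∈ Icc (0 : ℝ) 1, ∃ p ∈ T, f τ ∈ coordBall I p (ε p / 2) := fun τ hτ => by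
    simpa using hT (mem_image_of_mem f hτ)
  have harc : ∀ i < n, (∀ τ ∈ Ioo (t i) (t (i + 1)), f τ ∉ V) →
      ∀ m ∈ Ioo (t i) (t (i + 1)), ∀ p ∈ T, f m ∈ coordBall I p (ε p / 2) →
      ∀ σ ∈ B p, RadialAt I f p σ m → IsArc I f p σ (t i) (t (i + 1)) := by
    intro i hi hav m hm p hp hmp σ hσ hr
    refine (hS p).isArc hfc (hhalf p) (htI i hi.le).1.1 (htI (i + 1) hi).1.2
      (fun τ hτ => ⟨fun h => hav τ hτ (h ▸ hpV p hp), fun h => hav τ hτ ?_⟩) hm hmp hσ hr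
    exact hqV p hp τ (hsubI i hi (Ioo_subset_Icc_self hτ)) h.1 h.2
  have hex : ∀ i < n, (∀ τ ∈ Ioo (t i) (t (i + 1)), f τ ∉ V) →
      ∀ m ∈ Ioo (t i) (t (i + 1)), ∃ p ∈ T, f m ∈ coordBall I p (ε p / 2) ∧
        ∃ σ ∈ B p, RadialAt I f p σ m := by
    intro i hi hav m hm
    have hmI := hsubI i hi (Ioo_subset_Icc_self hm)
    obtain ⟨p, hp, hmp⟩ := hcover m hmI
    exact ⟨p, hp, hmp, ((hS p).radial m hmI (coordBall_mono (hhalf p).le hmp)).resolve_left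
      fun h => hav m hm (h ▸ hpV p hp)⟩
  have hmid : ∀ i < n, (t i + t (i + 1)) / 2 ∈ Ioo (t i) (t (i + 1)) := fun i hi => by
    have := hlt i hi
    constructor <;> linarith
  refine ⟨n, t, ht0, htn, hlt, fun i hi => ?_, fun i hi he j hj => ?_⟩
  · refine (hpiece i hi).imp_right fun hav => ?_
    obtain ⟨p, hp, hmp, σ, hσ, hr⟩ := hex i hi hav _ (hmid i hi)
    exact (harc i hi hav _ (hmid i hi) p hp hmp σ hσ hr).isEdge
  · have hav : ∀ τ ∈ Ioo (t i) (t (i + 1)), f τ ∉ V := by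
      refine (hpiece i hi).resolve_left fun h => ?_
      exact (hlt i hi).ne (he.inj (left_mem_Icc.2 (hlt i hi).le) (right_mem_Icc.2 (hlt i hi).le)
        (h _ (right_mem_Icc.2 (hlt i hi).le)).symm)
    rw [or_iff_not_imp_left, Set.not_disjoint_iff]
    rintro ⟨_, ⟨τ, hτ, rfl⟩, τ', hτ', hττ⟩
    have hav' : ∀ τ ∈ Ioo (t j) (t (j + 1)), f τ ∉ V := by
      refine (hpiece j hj).resolve_left fun h => hav τ hτ ?_
      rw [← hττ, h τ' hτ']
      exact (htI j hj.le).2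
    have hτ'' : τ' ∈ Ioo (t j) (t (j + 1)) := by
      refine ⟨lt_of_le_of_ne hτ'.1 fun h => ?_, lt_of_le_of_ne hτ'.2 fun h => ?_⟩
      · exact hav τ hτ (by rw [← hττ, ← h]; exact (htI j hj.le).2)
      · exact hav τ hτ (by rw [← hττ, h]; exact (htI (j + 1) hj).2)
    obtain ⟨p, hp, hmp, σ, hσ, hr⟩ := hex i hi hav τ hτ
    -- Being on the branch `σ` depends only on the point `f τ = f τ'`, while the derivative
    -- condition comes from the star at `τ'`.
    have hr' : RadialAt I f p σ τ' := by
      obtain h | ⟨σ', -, h⟩ := (hS p).radial τ' (hsubI j hj hτ')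
        (by rw [hττ]; exact coordBall_mono (hhalf p).le hmp)
      · exact (hr.ne (hττ ▸ h)).elim
      · exact ⟨h.mem, h.ne, by rw [hττ]; exact hr.branch, h.deriv_ne, h.analytic⟩
    have a1 := harc i hi hav τ hτ p hp hmp σ hσ hr
    have a2 := harc j hj hav' τ' hτ'' p hp (by rwa [hττ]) σ hσ hr'
    exact ⟨a2.isEdge, a1.exists_isReparam hfc (hlt i hi) (hlt j hj) a2 (htI i hi.le).2
      (htI (i + 1) hi).2 (htI j hj.le).2 (htI (j + 1) hj).2 hav hav' hτ hτ'' hττ.symm⟩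

end Decomposition

/-! ### Signed passage counts and cancellation -/

section Counting

variable {X : Type*}

open Classical in
/-- `1` or `-1` if the restriction of `f` to `[c, d]` is an orientation preserving, respectively
reversing, reparametrization of the restriction to `[a, b]`, and `0` if it is no
reparametrization. -/
def edgeSign (f : ℝ → X) (a b c d : ℝ) : ℤ :=
  if ∃ φ, IsReparam f a b c d φ ∧ φ c = a ∧ φ d = b then 1
  else if ∃ φ, IsReparam f a b c d φ then -1 else 0

/-- The number of times that `f` runs through the edge `[t i, t (i + 1)]`, counted with sign. -/
def edgeCount (f : ℝ → X) (n : ℕ) (t : ℕ → ℝ) (i : ℕ) : ℤ :=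
  ∑ j ∈ Finset.range n, edgeSign f (t i) (t (i + 1)) (t j) (t (j + 1))

theorem edgeSign_eq_zero {f : ℝ → X} {a b c d : ℝ} (h : ¬∃ φ, IsReparam f a b c d φ) :
    edgeSign f a b c d = 0 := by
  rw [edgeSign, if_neg, if_neg h]
  exact fun ⟨φ, hφ, _⟩ => h ⟨φ, hφ⟩

theorem zpow_finset_sum {ι G : Type*} [CommGroup G] (a : G) (s : Finset ι) (k : ι → ℤ) :
    a ^ ∑ j ∈ s, k j = ∏ j ∈ s, a ^ k j := by
  classical
  induction s using Finset.induction_on with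
  | empty => simp
  | insert j s hj ih => rw [Finset.sum_insert hj, Finset.prod_insert hj, zpow_add, ih]

theorem div_eq_zpow_edgeSign {f : ℝ → X} {a b c d : ℝ} {G : Type*} [CommGroup G] (g : ℝ → G)
    (hg : ∀ φ, IsReparam f a b c d φ → g (φ d) / g (φ c) = g d / g c)
    (h : ∃ φ, IsReparam f a b c d φ) : g d / g c = (g b / g a) ^ edgeSign f a b c d := by
  by_cases hpos : ∃ φ, IsReparam f a b c d φ ∧ φ c = a ∧ φ d = b
  · obtain ⟨φ, hφ, h1, h2⟩ := hpos
    rw [edgeSign, if_pos ⟨φ, hφ, h1, h2⟩, zpow_one, ← hg φ hφ, h1, h2]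
  · rw [edgeSign, if_neg hpos, if_pos h]
    obtain ⟨φ, hφ⟩ := h
    rcases hφ.ends with ⟨h1, h2⟩ | ⟨h1, h2⟩
    · exact (hpos ⟨φ, hφ, h1, h2⟩).elim
    · rw [← hg φ hφ, h1, h2, zpow_neg_one, inv_div]

variable {E : Type*} [NormedAddCommGroup E] [NormedSpace ℝ E]
  {H : Type*} [TopologicalSpace H] {I : ModelWithCorners ℝ E H}
  {M : Type*} [TopologicalSpace M] [ChartedSpace H M]
  {f : ℝ → M} {n : ℕ} {t : ℕ → ℝ} (hP : IsEdgePartition I f n t)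

include hP

theorem IsEdgePartition.mid_mem {i : ℕ} (hi : i < n) :
    (t i + t (i + 1)) / 2 ∈ Ioo (t i) (t (i + 1)) := by
  have := hP.lt i hi
  constructor <;> linarith

theorem IsEdgePartition.mem_Icc {i : ℕ} (hi : i ≤ n) : t i ∈ Icc (0 : ℝ) 1 := by
  constructor
  · induction i with
    | zero => exact hP.zero.ge
    | succ k ih => exact (ih (by omega)).trans (hP.lt k (by omega)).le
  · induction hi using Nat.decreasingInduction with
    | self => exact hP.one.le
    | of_succ k hk ih => exact (hP.lt k hk).le.trans ih

theorem IsEdgePartition.Icc_subset {i : ℕ} (hi : i < n) : Icc (t i) (t (i + 1)) ⊆ Icc 0 1 :=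
  Icc_subset_Icc (hP.mem_Icc hi.le).1 (hP.mem_Icc (i := i + 1) hi).2

theorem IsEdgePartition.not_disjoint_of_isReparam {i j : ℕ} (hj : j < n) {φ : ℝ → ℝ}
    (hφ : IsReparam f (t i) (t (i + 1)) (t j) (t (j + 1)) φ) :
    ¬Disjoint (f '' Ioo (t i) (t (i + 1))) (f '' Icc (t j) (t (j + 1))) := by
  rw [Set.not_disjoint_iff]
  have hm := hP.mid_mem hj
  exact ⟨_, ⟨_, hφ.mapsTo_Ioo hm, rfl⟩, _, Ioo_subset_Icc_self hm,
    (hφ.comp _ (Ioo_subset_Icc_self hm)).symm⟩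

/-- The second inclusion comes from the edge alternative with `i` and `j` exchanged, so `φ` need not
be inverted. -/
theorem IsEdgePartition.image_eq_of_isReparam {i j : ℕ} (hi : i < n) (hj : j < n)
    (he : IsEdge I f (t i) (t (i + 1))) {φ : ℝ → ℝ}
    (hφ : IsReparam f (t i) (t (i + 1)) (t j) (t (j + 1)) φ) :
    f '' Ioo (t j) (t (j + 1)) = f '' Ioo (t i) (t (i + 1)) := by
  have hsub : ∀ {a b c d : ℝ} {φ : ℝ → ℝ}, IsReparam f a b c d φ →
      f '' Ioo c d ⊆ f '' Ioo a b := by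
    rintro a b c d φ hφ _ ⟨τ, hτ, rfl⟩
    exact ⟨φ τ, hφ.mapsTo_Ioo hτ, hφ.comp τ (Ioo_subset_Icc_self hτ)⟩
  refine (hsub hφ).antisymm ?_
  have hej := ((hP.disjoint_or i hi he j hj).resolve_left
    (hP.not_disjoint_of_isReparam hj hφ)).1
  rcases hP.disjoint_or j hj hej i hi with h | ⟨-, ψ, hψ⟩
  · have hm := hP.mid_mem hj
    exact (Set.disjoint_left.1 h ⟨_, hm, rfl⟩ (image_mono Ioo_subset_Icc_self
      (hsub hφ ⟨_, hm, rfl⟩))).elim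
  · exact hsub hψ

theorem IsEdgePartition.div_eq_prod {G : Type*} [CommGroup G] (g : ℝ → G) :
    g 1 / g 0 = ∏ j ∈ Finset.range n, g (t (j + 1)) / g (t j) := by
  rw [Finset.prod_range_div (fun j => g (t j)), hP.one, hP.zero]

/-- If `g` is constant off the edge `[t i, t (i + 1)]`, its total increment is a multiple of the
increment along this edge. -/
theorem IsEdgePartition.div_eq_zpow_edgeCount {G : Type*} [CommGroup G] (g : ℝ → G) {i : ℕ}
    (hi : i < n) (he : IsEdge I f (t i) (t (i + 1)))
    (hg : ∀ j < n, ∀ φ, IsReparam f (t i) (t (i + 1)) (t j) (t (j + 1)) φ →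
      g (φ (t (j + 1))) / g (φ (t j)) = g (t (j + 1)) / g (t j))
    (hd : ∀ j < n, Disjoint (f '' Ioo (t i) (t (i + 1))) (f '' Icc (t j) (t (j + 1))) →
      g (t (j + 1)) = g (t j)) :
    g 1 / g 0 = (g (t (i + 1)) / g (t i)) ^ edgeCount f n t i := by
  rw [hP.div_eq_prod, edgeCount, zpow_finset_sum]
  refine Finset.prod_congr rfl fun j hj => ?_
  rw [Finset.mem_range] at hj
  rcases hP.disjoint_or i hi he j hj with h | ⟨-, h⟩
  · rw [edgeSign_eq_zero fun ⟨φ, hφ⟩ => hP.not_disjoint_of_isReparam hj hφ h, zpow_zero, hd j hj h,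
      div_self']
  · exact div_eq_zpow_edgeSign g (hg j hj) h

/-- If all edges are passed with total multiplicity zero, a function with values in an abelian group
whose increments are invariant under reparametrization has total increment zero. -/
theorem IsEdgePartition.eq_of_edgeCount_eq_zero {G : Type*} [CommGroup G] (g : ℝ → G)
    (hcount : ∀ i < n, IsEdge I f (t i) (t (i + 1)) → edgeCount f n t i = 0)
    (hconst : ∀ i < n, (∀ τ ∈ Icc (t i) (t (i + 1)), f τ = f (t i)) → g (t (i + 1)) = g (t i))
    (hg : ∀ i < n, ∀ j < n, IsEdge I f (t i) (t (i + 1)) → IsEdge I f (t j) (t (j + 1)) →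
      ∀ φ, IsReparam f (t i) (t (i + 1)) (t j) (t (j + 1)) φ →
      g (φ (t (j + 1))) / g (φ (t j)) = g (t (j + 1)) / g (t j)) : g 1 = g 0 := by
  classical
  rw [← div_eq_one, hP.div_eq_prod]
  -- Pieces are grouped by the image of their interior: one group collects all passages of an edge
  -- in either direction, the other groups consist of constant pieces.
  set κ : ℕ → Set M := fun j => f '' Ioo (t j) (t (j + 1)) with hκ
  rw [← Finset.prod_fiberwise_of_maps_to (g := κ) (t := (Finset.range n).image κ)
    fun j hj => Finset.mem_image_of_mem κ hj]
  refine Finset.prod_eq_one fun K hK => ?_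
  obtain ⟨i, hi, rfl⟩ := Finset.mem_image.1 hK
  rw [Finset.mem_range] at hi
  by_cases he : IsEdge I f (t i) (t (i + 1))
  · have hrel : ∀ j < n, κ j = κ i → IsEdge I f (t j) (t (j + 1)) ∧
        ∃ φ, IsReparam f (t i) (t (i + 1)) (t j) (t (j + 1)) φ := fun j hj hji => by
      refine (hP.disjoint_or i hi he j hj).resolve_left fun h => ?_
      have hm : f ((t i + t (i + 1)) / 2) ∈ κ i := ⟨_, hP.mid_mem hi, rfl⟩
      refine Set.disjoint_left.1 h hm (image_mono Ioo_subset_Icc_self ?_)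
      rw [← hji] at hm
      exact hm
    have hsum : ∑ j ∈ (Finset.range n).filter (fun j => κ j = κ i),
        edgeSign f (t i) (t (i + 1)) (t j) (t (j + 1)) = edgeCount f n t i := by
      rw [edgeCount]
      refine Finset.sum_filter_of_ne fun j hj hne => ?_
      by_contra hκ'
      refine hne (edgeSign_eq_zero fun ⟨φ, hφ⟩ => hκ' ?_)
      exact hP.image_eq_of_isReparam hi (Finset.mem_range.1 hj) he hφ
    calc ∏ j ∈ (Finset.range n).filter (fun j => κ j = κ i), g (t (j + 1)) / g (t j)
        = ∏ j ∈ (Finset.range n).filter (fun j => κ j = κ i),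
          (g (t (i + 1)) / g (t i)) ^ edgeSign f (t i) (t (i + 1)) (t j) (t (j + 1)) := by
          refine Finset.prod_congr rfl fun j hj => ?_
          rw [Finset.mem_filter, Finset.mem_range] at hj
          obtain ⟨hej, h⟩ := hrel j hj.1 hj.2
          exact div_eq_zpow_edgeSign g (hg i hi j hj.1 he hej) h
      _ = 1 := by rw [← zpow_finset_sum, hsum, hcount i hi he, zpow_zero]
  · refine Finset.prod_eq_one fun j hj => ?_
    rw [Finset.mem_filter, Finset.mem_range] at hj
    rw [div_eq_one]
    refine hconst j hj.1 ((hP.const_or_edge j hj.1).resolve_right fun hej => he ?_)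
    have hm : f ((t i + t (i + 1)) / 2) ∈ κ i := ⟨_, hP.mid_mem hi, rfl⟩
    refine ((hP.disjoint_or j hj.1 hej i hi).resolve_left fun h => ?_).1
    have h2 := hm
    rw [← hj.2] at h2
    exact Set.disjoint_left.1 h h2 (image_mono Ioo_subset_Icc_self hm)

theorem IsEdgePartition.continuousOn {Y : Type*} [TopologicalSpace Y] {g : ℝ → Y}
    (hg : ∀ i < n, ContinuousOn g (Icc (t i) (t (i + 1)))) : ContinuousOn g (Icc 0 1) := by
  have : ∀ k ≤ n, ContinuousOn g (Icc 0 (t k)) := by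
    intro k
    induction k with
    | zero => intro _; simp [hP.zero]
    | succ k ih =>
      intro hk
      rw [← Icc_union_Icc_eq_Icc (hP.mem_Icc (i := k) (by omega)).1 (hP.lt k (by omega)).le]
      exact (ih (by omega)).union_of_isClosed (hg k (by omega)) isClosed_Icc isClosed_Icc
  simpa [hP.one] using this n le_rfl

end Counting

/-! ### Thin loops have zero counts -/

section Winding

variable {X : Type*}

open Classical in
/-- The map to the circle that winds once along `f` restricted to `[a, b]` and collapses the
rest. -/
def windingMap (f : ℝ → X) (a b : ℝ) (y : X) : Circle :=
  if h : ∃ s ∈ Icc a b, f s = y then Circle.exp (2 * Real.pi * ((h.choose - a) / (b - a))) else 1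

theorem windingMap_apply {f : ℝ → X} {a b s : ℝ} (hf : InjOn f (Icc a b)) (hs : s ∈ Icc a b) :
    windingMap f a b (f s) = Circle.exp (2 * Real.pi * ((s - a) / (b - a))) := by
  have h : ∃ s' ∈ Icc a b, f s' = f s := ⟨s, hs, rfl⟩
  rw [windingMap, dif_pos h, hf h.choose_spec.1 hs h.choose_spec.2]

theorem windingMap_eq_one {f : ℝ → X} {a b : ℝ} (hab : a < b) (hf : InjOn f (Icc a b)) {y : X}
    (hy : y ∉ f '' Ioo a b) : windingMap f a b y = 1 := by
  by_cases h : ∃ s ∈ Icc a b, f s = y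
  · obtain ⟨s, hs, rfl⟩ := h
    rw [windingMap_apply hf hs]
    rcases hs.1.eq_or_lt with rfl | h1
    · simp
    rcases hs.2.eq_or_lt with rfl | h2
    · rw [div_self (sub_pos.2 hab).ne', mul_one, Circle.exp_two_pi]
    · exact (hy ⟨s, ⟨h1, h2⟩, rfl⟩).elim
  · rw [windingMap, dif_neg h]

variable {E : Type*} [NormedAddCommGroup E] [NormedSpace ℝ E]
  {H : Type*} [TopologicalSpace H] {I : ModelWithCorners ℝ E H}
  {M : Type*} [TopologicalSpace M] [ChartedSpace H M]

/-- A thin loop passes each edge with total multiplicity zero. -/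
theorem IsThin.edgeCount_eq_zero [T2Space M] {x : M} {α : Path x x} (hα : IsThin α) {n : ℕ}
    {t : ℕ → ℝ} (hP : IsEdgePartition I α.extend n t) {i : ℕ} (hi : i < n)
    (he : IsEdge I α.extend (t i) (t (i + 1))) : edgeCount α.extend n t i = 0 := by
  have hab := hP.lt i hi
  set f := α.extend with hf
  set a := t i with ha
  set b := t (i + 1) with hb
  set lin : ℝ → ℝ := fun s => 2 * Real.pi * ((s - a) / (b - a)) with hlin
  have hlinc : Continuous lin := by fun_prop
  set w : M → Circle := windingMap f a b
  have hrel : ∀ j < n, ∀ φ, IsReparam f a b (t j) (t (j + 1)) φ →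
      ∀ τ ∈ Icc (t j) (t (j + 1)), w (f τ) = Circle.exp (lin (φ τ)) := fun j hj φ hφ τ hτ => by
    rw [← hφ.comp τ hτ]
    exact windingMap_apply he.inj (hφ.mapsTo hτ)
  have hdis : ∀ j < n, Disjoint (f '' Ioo a b) (f '' Icc (t j) (t (j + 1))) →
      ∀ τ ∈ Icc (t j) (t (j + 1)), w (f τ) = 1 := fun j hj hd τ hτ =>
    windingMap_eq_one hab he.inj fun h => Set.disjoint_left.1 hd h ⟨τ, hτ, rfl⟩
  have hwf : ContinuousOn (fun τ => w (f τ)) (Icc 0 1) := by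
    refine hP.continuousOn fun j hj => ?_
    rcases hP.disjoint_or i hi he j hj with h | ⟨-, φ, hφ⟩
    · exact continuousOn_const.congr (hdis j hj h)
    · exact ((Circle.exp.continuous.comp hlinc).comp_continuousOn hφ.cont).congr (hrel j hj φ hφ)
  -- the winding map is continuous on the image of the loop
  have hwα : Continuous fun s : unitInterval => w (α s) := by
    have := hwf.comp_continuous continuous_subtype_val fun s : unitInterval => s.2
    refine this.congr fun s => ?_
    simp [hf]
  -- A continuous map from a compact to a Hausdorff space is closed, so the image carries the
  -- quotient topology of the interval and continuity can be tested along `α`.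
  have hq : IsQuotientMap (rangeFactorization α) :=
    (Continuous.isClosedMap (by fun_prop)).isQuotientMap (by fun_prop)
      rangeFactorization_surjective
  have hwc : Continuous fun y : range α => w y := by
    rw [hq.continuous_iff]
    exact hwα
  obtain ⟨F, hF⟩ := hα
  obtain ⟨e, hex⟩ := Circle.exp_surjective (w x)
  set γ : C(unitInterval, Circle) := ⟨fun s => w (α s), hwα⟩ with hγ
  have hγ0 : γ 0 = Circle.exp e := by simp [hγ, hex]
  -- Thinness enters here: the homotopy stays in the image, the only place where `w` is known to be
  -- continuous.
  have hhom : γ.HomotopicRel (ContinuousMap.const unitInterval (w x)) {0, 1} := by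
    refine ⟨{
      toFun := fun z => w (F z)
      continuous_toFun := ?_
      map_zero_left := fun s => ?_
      map_one_left := fun s => ?_
      prop' := fun s z hz => ?_ }⟩
    · exact hwc.comp (F.continuous.subtype_mk hF)
    · simp [hγ]
    · simp
    · rcases hz with rfl | rfl <;> simp [hγ]
  have hend := Circle.isCoveringMap_exp.liftPath_apply_one_eq_of_homotopicRel hhom e hγ0
    (by simp [hex])
  rw [Circle.isCoveringMap_exp.liftPath_const (by simp [hex])] at hend
  have hlift := Circle.isCoveringMap_exp.liftPath_lifts γ e hγ0
  have hzero := Circle.isCoveringMap_exp.liftPath_zero γ e hγ0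
  set Θ := Circle.isCoveringMap_exp.liftPath γ e hγ0
  set θ : ℝ → ℝ := fun τ => Θ (projIcc 0 1 zero_le_one τ) with hθ
  have hθc : Continuous θ := Θ.continuous.comp continuous_projIcc
  have hθw : ∀ τ ∈ Icc (0 : ℝ) 1, Circle.exp (θ τ) = w (f τ) := fun τ hτ => by
    have := congrFun hlift (projIcc 0 1 zero_le_one τ)
    simp only [Function.comp_apply] at this
    rw [hθ, this, hγ]
    rfl
  have hθ01 : θ 1 = θ 0 := by
    simp only [hθ, projIcc_right, projIcc_left]
    exact hend.trans hzero.symm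
  -- Two continuous angle functions of the same circle-valued path differ by a constant on each
  -- piece.
  have hincr : ∀ j < n, ∀ ψ : ℝ → ℝ, ContinuousOn ψ (Icc (t j) (t (j + 1))) →
      (∀ τ ∈ Icc (t j) (t (j + 1)), w (f τ) = Circle.exp (ψ τ)) →
      θ (t (j + 1)) - ψ (t (j + 1)) = θ (t j) - ψ (t j) := by
    intro j hj ψ hψ hw
    have hc : ∀ τ ∈ Icc (t j) (t (j + 1)), Circle.exp (θ τ - ψ τ) = 1 := fun τ hτ => by
      rw [Circle.exp_sub, hθw τ (hP.Icc_subset hj hτ), hw τ hτ, div_self']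
    exact Circle.isCoveringMap_exp.constOn_of_comp (g := fun τ => θ τ - ψ τ) isPreconnected_Icc
      (hθc.continuousOn.sub hψ) (fun τ hτ τ' hτ' => by rw [hc τ hτ, hc τ' hτ'])
      (right_mem_Icc.2 (hP.lt j hj).le) (left_mem_Icc.2 (hP.lt j hj).le)
  have hself := hincr i hi lin hlinc.continuousOn fun τ hτ => windingMap_apply he.inj hτ
  rw [← ha, ← hb] at hself
  have hlinab : lin b - lin a = 2 * Real.pi := by
    simp [hlin, div_self (sub_pos.2 hab).ne']
  have hconst : ∀ u ∈ ({a, b} : Set ℝ), θ u - lin u = θ a - lin a := by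
    rintro u (rfl | rfl)
    · rfl
    · exact hself
  -- Written additively, the total increment `0` of `θ` is the count times `2π`, the increment over
  -- the chosen edge.
  have hmain := hP.div_eq_zpow_edgeCount (fun τ => Multiplicative.ofAdd (θ τ)) hi he
    (fun j hj φ hφ => ?_) (fun j hj hd => ?_)
  · simp only [hθ01, div_self', ← ha, ← hb] at hmain
    rw [← ofAdd_sub, ← ofAdd_zsmul, ← ofAdd_zero, Multiplicative.ofAdd.injective.eq_iff] at hmain
    have h2 : θ b - θ a = 2 * Real.pi := by linarith
    rw [h2, eq_comm, smul_eq_zero] at hmain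
    exact hmain.resolve_right (by positivity)
  · have h1 := hincr j hj (fun τ => lin (φ τ)) (hlinc.comp_continuousOn hφ.cont) (hrel j hj φ hφ)
    -- `φ` sends the ends of the piece to the ends of the edge, where `θ - lin` takes one and the
    -- same value.
    have h2 : θ (φ (t j)) - lin (φ (t j)) = θ a - lin a :=
      hconst _ (by rcases hφ.ends with ⟨h, -⟩ | ⟨h, -⟩ <;> simp [h, ha, hb])
    have h3 : θ (φ (t (j + 1))) - lin (φ (t (j + 1))) = θ a - lin a :=
      hconst _ (by rcases hφ.ends with ⟨-, h⟩ | ⟨-, h⟩ <;> simp [h, ha, hb])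
    simp only [← ofAdd_sub, Multiplicative.ofAdd.injective.eq_iff]
    linarith
  · have h1 := hincr j hj (fun _ => 0) continuousOn_const (by simpa using hdis j hj hd)
    simp only [sub_zero] at h1
    simp only [h1]

end Winding

/-! ### Lassos in the image of a loop -/

section Lasso

variable {X : Type*} [TopologicalSpace X]

theorem homotopic_trans_symm_cast {a y y' y'' : X} (p : Path a y) (q : Path a y') (r : Path a y'')
    (h : y = y') (h' : y' = y'') :
    ((p.trans (q.symm.cast h rfl)).trans (q.trans (r.symm.cast h' rfl))).Homotopic
      (p.trans (r.symm.cast (h.trans h') rfl)) := by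
  subst h h'
  simp only [Path.cast_rfl_rfl]
  rw [← Path.Homotopic.Quotient.eq]
  simp only [Path.Homotopic.Quotient.mk_trans, Path.Homotopic.Quotient.mk_symm]
  rw [Path.Homotopic.Quotient.trans_assoc,
    ← Path.Homotopic.Quotient.trans_assoc (Path.Homotopic.Quotient.mk q).symm,
    Path.Homotopic.Quotient.symm_trans, Path.Homotopic.Quotient.refl_trans]

variable {x : X} (α : Path x x)

/-- The base point of the image of a loop. -/
def rangeBase : range α := ⟨x, 0, α.source⟩

/-- The points of a loop as points of its image. -/
def rangePoint (t : ℝ) : range α := ⟨α.extend t, projIcc 0 1 zero_le_one t, rfl⟩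

theorem continuous_rangePoint : Continuous (rangePoint α) :=
  α.extend.continuous.subtype_mk _

/-- The initial part of a loop up to the parameter `s`, as a path in the image of the loop. -/
def initialPath (s : ℝ) : Path (rangeBase α) (rangePoint α s) where
  toFun z := rangePoint α (s * z)
  continuous_toFun := (continuous_rangePoint α).comp (by fun_prop)
  source' := Subtype.ext (by simp [rangePoint, rangeBase])
  target' := by simp

/-- Run along the loop up to the parameter `s`, and back from another parameter
of the same point. -/
def lasso (s s' : ℝ) (h : α.extend s = α.extend s') : Path (rangeBase α) (rangeBase α) :=
  (initialPath α s).trans ((initialPath α s').symm.cast (Subtype.ext h) rfl)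

/-- The way back from `s'` cancels the way out to `s'`. -/
theorem lasso_trans {s s' s'' : ℝ} (h : α.extend s = α.extend s')
    (h' : α.extend s' = α.extend s'') :
    ((lasso α s s' h).trans (lasso α s' s'' h')).Homotopic (lasso α s s'' (h.trans h')) :=
  homotopic_trans_symm_cast _ _ _ _ _

/-- The lassos at the parameters `φ τ` and `ψ τ` share the base point and depend continuously on
`τ`, so as `τ` runs from `c` to `d` they form the homotopy. -/
theorem lasso_homotopic {c d : ℝ} (hcd : c ≤ d) {φ ψ : ℝ → ℝ} (hφ : ContinuousOn φ (Icc c d))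
    (hψ : ContinuousOn ψ (Icc c d)) (h : ∀ τ ∈ Icc c d, α.extend (φ τ) = α.extend (ψ τ)) :
    (lasso α (φ c) (ψ c) (h c (left_mem_Icc.2 hcd))).Homotopic
      (lasso α (φ d) (ψ d) (h d (right_mem_Icc.2 hcd))) := by
  set l : unitInterval → ℝ := fun r => c + r * (d - c) with hl
  have hlm : ∀ r, l r ∈ Icc c d := fun r => by
    have h1 := mul_nonneg r.2.1 (sub_nonneg.2 hcd)
    have h2 := mul_le_of_le_one_left (sub_nonneg.2 hcd) r.2.2
    exact ⟨by simp only [hl]; linarith, by simp only [hl]; linarith⟩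
  have hlc : Continuous l := by fun_prop
  have hφl : Continuous fun r => φ (l r) := hφ.comp_continuous hlc hlm
  have hψl : Continuous fun r => ψ (l r) := hψ.comp_continuous hlc hlm
  have hcont : Continuous ↿fun r : unitInterval => lasso α (φ (l r)) (ψ (l r)) (h _ (hlm r)) := by
    refine Path.trans_continuous_family (fun r => initialPath α (φ (l r))) ?_
      (fun r => (initialPath α (ψ (l r))).symm.cast (Subtype.ext (h _ (hlm r))) rfl) ?_
    · exact (continuous_rangePoint α).comp
        ((hφl.comp continuous_fst).mul (continuous_subtype_val.comp continuous_snd))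
    · have := Path.symm_continuous_family (fun r => initialPath α (ψ (l r)))
        ((continuous_rangePoint α).comp
          ((hψl.comp continuous_fst).mul (continuous_subtype_val.comp continuous_snd)))
      exact this
  have hl0 : l 0 = c := by simp [hl]
  have hl1 : l 1 = d := by simp [hl]
  refine ⟨{
    toFun := fun z => lasso α (φ (l z.1)) (ψ (l z.1)) (h _ (hlm z.1)) z.2
    continuous_toFun := hcont
    map_zero_left := fun z => ?_
    map_one_left := fun z => ?_
    prop' := fun r z hz => ?_ }⟩
  · simp only [hl0]; rfl
  · simp only [hl1]; rfl
  · rcases hz with rfl | rfl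
    · simp
    · simp

end Lasso

/-! ### Zero counts give products of commutators -/

section Commutator

variable {E : Type*} [NormedAddCommGroup E] [NormedSpace ℝ E]
  {H : Type*} [TopologicalSpace H] {I : ModelWithCorners ℝ E H}
  {M : Type*} [TopologicalSpace M] [ChartedSpace H M] {x : M}

theorem IsPiecewiseAnalytic.cast {x y x' y' : M} {γ : Path x y} (h : IsPiecewiseAnalytic I γ)
    (hx : x' = x) (hy : y' = y) : IsPiecewiseAnalytic I (γ.cast hx hy) := by
  subst hx hy
  exact h

theorem IsPiecewiseAnalytic.map_initialPath {α : Path x x} (h : IsPiecewiseAnalytic I α) {s : ℝ}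
    (hs : s ∈ Icc (0 : ℝ) 1) :
    IsPiecewiseAnalytic I ((initialPath α s).map continuous_subtype_val) := by
  have hval : ∀ z : unitInterval,
      (initialPath α s).map continuous_subtype_val z = α.extend (s * z) := fun z => rfl
  rcases hs.1.eq_or_lt with rfl | hs0
  · refine ⟨1, fun i => i, by simp, by simp, fun i _ => by simp,
      fun i _ => ⟨fun _ => x, fun _ _ => contMDiffAt_const, fun z _ => ?_⟩⟩
    rw [hval, zero_mul, Path.extend_zero]
  obtain ⟨n, t, h0, h1, hm, ha⟩ := h
  -- The partition is rescaled by `s` and cut off at `1`; intervals beyond `s` collapse to the point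
  -- `1`, where a constant curve serves.
  refine ⟨n, fun i => min (t i / s) 1, by simp [h0], ?_, fun i hi => ?_, fun i hi => ?_⟩
  · change min (t n / s) 1 = 1
    rw [h1, min_eq_right]
    exact (one_le_div hs0).2 hs.2
  · exact min_le_min_right _ (div_le_div_of_nonneg_right (hm i hi) hs0.le)
  rcases le_or_gt s (t i) with hle | hlt
  · refine ⟨fun _ => α.extend s, fun _ _ => contMDiffAt_const, fun z hz => ?_⟩
    have : (z : ℝ) = 1 := le_antisymm z.2.2 (by
      rw [← min_eq_right ((one_le_div hs0).2 hle)]; exact hz.1)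
    rw [hval, this, mul_one]
  · obtain ⟨c, hc, hγ⟩ := ha i hi
    have key : ∀ r ∈ Icc (min (t i / s) 1) (min (t (i + 1) / s) 1),
        s * r ∈ Icc (t i) (t (i + 1)) := fun r hr => by
      rw [min_eq_left ((div_le_one hs0).2 hlt.le)] at hr
      refine ⟨(div_le_iff₀' hs0).1 hr.1, (le_div_iff₀' hs0).1 (hr.2.trans (min_le_left _ _))⟩
    refine ⟨fun r => c (s * r + 0), fun r hr => contMDiffAt_comp_affine (hc _ ?_), fun z hz => ?_⟩
    · rw [add_zero]
      exact key r hr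
    · have hmem : s * (z : ℝ) ∈ unitInterval :=
        ⟨mul_nonneg hs0.le z.2.1, mul_le_one₀ hs.2 z.2.1 z.2.2⟩
      rw [hval, Path.extend_apply _ hmem, hγ ⟨_, hmem⟩ (key z hz)]
      simp only [add_zero]

theorem IsPiecewiseAnalytic.map_lasso {α : Path x x} (h : IsPiecewiseAnalytic I α) {s s' : ℝ}
    (hs : s ∈ Icc (0 : ℝ) 1) (hs' : s' ∈ Icc (0 : ℝ) 1) (he : α.extend s = α.extend s') :
    IsPiecewiseAnalytic I ((lasso α s s' he).map continuous_subtype_val) := by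
  rw [lasso, Path.map_trans]
  exact (h.map_initialPath hs).trans ((h.map_initialPath hs').symm.cast he rfl)

/-- The homotopy may use all of the image of `α`, while thin equivalence of the two loops only
allows their own images. Multiplying both by `α` enlarges these to contain the image of `α`, and `α`
cancels in the group. -/
theorem LoopGroup.mk_eq_of_homotopic (α : PALoop I x) {p q : Path (rangeBase α.1) (rangeBase α.1)}
    (hp : IsPiecewiseAnalytic I (p.map continuous_subtype_val))
    (hq : IsPiecewiseAnalytic I (q.map continuous_subtype_val)) (h : p.Homotopic q) :
    LoopGroup.mk (I := I) (x := x) ⟨p.map continuous_subtype_val, hp⟩ =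
      LoopGroup.mk (x := x) ⟨q.map continuous_subtype_val, hq⟩ := by
  refine mul_right_cancel (b := LoopGroup.mk α) ?_
  refine Quot.sound (thinEquiv_of_cls fun S h1 h2 _ => ?_)
  have h1' := h1
  have h2' := h2
  rw [Path.trans_range, union_subset_iff] at h1' h2'
  dsimp only
  rw [cls_trans (x := x) h1'.1 h1'.2, cls_trans (x := x) h2'.1 h2'.2]
  congr 1
  obtain ⟨F⟩ := h
  exact Path.Homotopic.Quotient.eq.2 ⟨F.map ⟨Set.inclusion h1'.2, continuous_inclusion h1'.2⟩⟩

/-- The class of a lasso. -/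
def lassoClass (α : PALoop I x) {s s' : ℝ} (hs : s ∈ Icc (0 : ℝ) 1) (hs' : s' ∈ Icc (0 : ℝ) 1)
    (h : α.1.extend s = α.1.extend s') : LoopGroup I x :=
  LoopGroup.mk ⟨(lasso α.1 s s' h).map continuous_subtype_val, α.2.map_lasso hs hs' h⟩

theorem lassoClass_mul (α : PALoop I x) {s s' s'' : ℝ} (hs : s ∈ Icc (0 : ℝ) 1)
    (hs' : s' ∈ Icc (0 : ℝ) 1) (hs'' : s'' ∈ Icc (0 : ℝ) 1)
    (h : α.1.extend s = α.1.extend s') (h' : α.1.extend s' = α.1.extend s'') :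
    lassoClass α hs hs' h * lassoClass α hs' hs'' h' = lassoClass α hs hs'' (h.trans h') := by
  have hpa : IsPiecewiseAnalytic I (((lasso α.1 s s' h).trans (lasso α.1 s' s'' h')).map
      continuous_subtype_val) := by
    rw [Path.map_trans]
    exact (α.2.map_lasso hs hs' h).trans (α.2.map_lasso hs' hs'' h')
  rw [lassoClass, lassoClass, lassoClass, ← LoopGroup.mk_eq_of_homotopic α hpa
    (α.2.map_lasso hs hs'' (h.trans h')) (lasso_trans α.1 h h')]
  exact congrArg (LoopGroup.mk (I := I) (x := x))
    (Subtype.ext (Path.map_trans _ _ continuous_subtype_val).symm)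

theorem lassoClass_self (α : PALoop I x) {s : ℝ} (hs : s ∈ Icc (0 : ℝ) 1) :
    lassoClass α hs hs rfl = 1 := by
  have := lassoClass_mul α hs hs hs rfl rfl
  exact mul_eq_left.1 this

theorem lassoClass_one_zero (α : PALoop I x) (h : α.1.extend 1 = α.1.extend 0) :
    lassoClass α (right_mem_Icc.2 zero_le_one) (left_mem_Icc.2 zero_le_one) h =
      LoopGroup.mk α := by
  -- The lasso at `1` and `0` is literally `α` followed by a constant path.
  rw [← mul_one (LoopGroup.mk α), lassoClass]
  refine congrArg (LoopGroup.mk (I := I)) (Subtype.ext ?_)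
  refine Path.ext (funext fun z => ?_)
  change ((lasso α.1 1 0 h) z : M) = (α.1.trans (Path.refl x)) z
  rw [lasso, Path.trans_apply, Path.trans_apply]
  split_ifs with hz
  · change α.1.extend (1 * _) = _
    rw [one_mul, Path.extend_apply]
  · change α.1.extend (0 * _) = x
    rw [zero_mul, Path.extend_zero]

/-- A loop that passes each edge with total multiplicity zero is a product of commutators. -/
theorem mem_commutator_of_edgeCount_eq_zero (α : PALoop I x) {n : ℕ} {t : ℕ → ℝ}
    (hP : IsEdgePartition I α.1.extend n t)
    (hcount : ∀ i < n, IsEdge I α.1.extend (t i) (t (i + 1)) → edgeCount α.1.extend n t i = 0) :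
    LoopGroup.mk α ∈ commutator (LoopGroup I x) := by
  classical
  set f := α.1.extend with hf
  have hex : ∀ y : M, ∃ s ∈ Icc (0 : ℝ) 1, y ∈ f '' Icc 0 1 → f s = y := fun y => by
    by_cases h : y ∈ f '' Icc 0 1
    · obtain ⟨s, hs, rfl⟩ := h
      exact ⟨s, hs, fun _ => rfl⟩
    · exact ⟨0, by simp, fun h' => (h h').elim⟩
  choose ρ hρ hfρ using hex
  have hfρ' : ∀ s ∈ Icc (0 : ℝ) 1, f s = f (ρ (f s)) := fun s hs =>
    (hfρ _ (mem_image_of_mem f hs)).symm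
  -- `ρ y` is a fixed parameter of the point `y`, and `g s` is the class of the lasso that runs out
  -- to `s` and back from `ρ (f s)`. Its total increment from `0` to `1` will be the class of `α`.
  set g : ℝ → Abelianization (LoopGroup I x) := fun s =>
    if h : s ∈ Icc (0 : ℝ) 1 then
      Abelianization.of (lassoClass α h (hρ (f s)) (hfρ' s h)) else 1 with hg
  have hgs : ∀ s (hs : s ∈ Icc (0 : ℝ) 1),
      g s = Abelianization.of (lassoClass α hs (hρ (f s)) (hfρ' s hs)) := fun s hs => dif_pos hs
  -- Parameters of the same point return along the same path, so `g s` and `g s'` differ by the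
  -- lasso at `s` and `s'`.
  have hdiv : ∀ s s' (hs : s ∈ Icc (0 : ℝ) 1) (hs' : s' ∈ Icc (0 : ℝ) 1) (h : f s = f s'),
      g s = Abelianization.of (lassoClass α hs hs' h) * g s' := fun s s' hs hs' h => by
    rw [hgs s hs, hgs s' hs', ← map_mul, lassoClass_mul]
    simp only [h]
  have h0 : (0 : ℝ) ∈ Icc (0 : ℝ) 1 := by simp
  have h1 : (1 : ℝ) ∈ Icc (0 : ℝ) 1 := by simp
  have hf10 : f 1 = f 0 := by simp [hf]
  have hmain : g 1 = g 0 := by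
    refine hP.eq_of_edgeCount_eq_zero g hcount (fun i hi hc => ?_)
      (fun i hi j hj hei hej φ hφ => ?_)
    · have hi' := hP.mem_Icc (i := i + 1) hi
      have hle := (hP.lt i hi).le
      rw [hdiv _ _ hi' (hP.mem_Icc hi.le) (hc _ (right_mem_Icc.2 hle))]
      have := LoopGroup.mk_eq_of_homotopic α
        (α.2.map_lasso (hP.mem_Icc hi.le) (hP.mem_Icc hi.le) rfl)
        (α.2.map_lasso hi' (hP.mem_Icc hi.le) (hc _ (right_mem_Icc.2 hle)))
        (lasso_homotopic α.1 hle (φ := fun τ => τ) (ψ := fun _ => t i) continuousOn_id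
          continuousOn_const hc)
      rw [show lassoClass α hi' (hP.mem_Icc hi.le) (hc _ (right_mem_Icc.2 hle)) = 1 from
        this.symm.trans (lassoClass_self α (hP.mem_Icc hi.le)), map_one, one_mul]
    · have hle := (hP.lt j hj).le
      have hcm := left_mem_Icc.2 hle
      have hdm := right_mem_Icc.2 hle
      have hc' := hP.Icc_subset hi (hφ.mapsTo hcm)
      have hd' := hP.Icc_subset hi (hφ.mapsTo hdm)
      have hc := hP.Icc_subset hj hcm
      have hd := hP.Icc_subset hj hdm
      -- The lasso at `φ τ` and `τ` does not change its class as `τ` moves along the piece; this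
      -- makes increments of `g` invariant under reparametrization.
      have key : lassoClass α hc' hc (hφ.comp _ hcm) = lassoClass α hd' hd (hφ.comp _ hdm) :=
        LoopGroup.mk_eq_of_homotopic α (α.2.map_lasso hc' hc _) (α.2.map_lasso hd' hd _)
          (lasso_homotopic α.1 hle (φ := φ) (ψ := fun τ => τ) hφ.cont continuousOn_id hφ.comp)
      rw [hdiv _ _ hc' hc (hφ.comp _ hcm), hdiv _ _ hd' hd (hφ.comp _ hdm), key,
        mul_div_mul_left_eq_div]
  rw [hdiv 1 0 h1 h0 hf10, mul_eq_right, lassoClass_one_zero] at hmain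
  rwa [← Abelianization.ker_of, MonoidHom.mem_ker]

end Commutator

/-! ### Connections evaluated on velocities -/

section Velocity

variable {F : Type*} [NormedAddCommGroup F] [NormedSpace ℝ F]
  {K : Type*} [TopologicalSpace K] {J : ModelWithCorners ℝ F K}
  {P : Type*} [TopologicalSpace P] [ChartedSpace K P]

theorem mfderiv_comp_real {u : ℝ → P} {φ : ℝ → ℝ} {t s : ℝ} (hs : φ t = s)
    (hu : MDifferentiableAt 𝓘(ℝ, ℝ) J u s) (hφ : DifferentiableAt ℝ φ t) (r : ℝ) :
    (mfderiv 𝓘(ℝ, ℝ) J (fun s => u (φ s)) t r : F) =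
      (r * deriv φ t) • (mfderiv 𝓘(ℝ, ℝ) J u s (1 : ℝ) : F) := by
  subst hs
  have h1 : mfderiv 𝓘(ℝ, ℝ) J (fun s => u (φ s)) t = _ :=
    mfderiv_comp (g := u) (f := φ) t hu hφ.mdifferentiableAt
  rw [h1]
  have h2 : mfderiv 𝓘(ℝ, ℝ) 𝓘(ℝ, ℝ) φ t r = (r * deriv φ t) • (1 : ℝ) := by
    rw [mfderiv_eq_fderiv]
    refine (fderiv_eq_deriv_mul (f := φ) (x := t) (y := r)).trans ?_
    simp [mul_comm]
  exact (congrArg (mfderiv 𝓘(ℝ, ℝ) J u (φ t)) h2).trans (map_smul _ _ (1 : ℝ))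

variable [MulAction Circle P]

theorem contMDiff_exp_smul
    (hs : ContMDiff ((𝓡 1).prod J) J ∞ (fun z : Circle × P => z.1 • z.2)) :
    ContMDiff (𝓘(ℝ, ℝ).prod J) J ∞ (fun z : ℝ × P => Circle.exp z.1 • z.2) :=
  hs.comp ((contMDiff_circleExp.comp contMDiff_fst).prodMk contMDiff_snd)

variable [IsManifold J ∞ P]

/-- The value of a connection on the velocity of a curve. -/
def Connection.along (A : Connection J P) (u : ℝ → P) (t : ℝ) : ℝ :=
  A.form (u t) (mfderiv 𝓘(ℝ, ℝ) J u t (1 : ℝ))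

/-- All tangent spaces are definitionally the model space `F`, so a vector moves to an equal base
point without a cast. -/
theorem Connection.form_congr (A : Connection J P) {p q : P} (h : p = q) (v : F) :
    A.form p v = A.form q v := by rw [h]

theorem Connection.along_congr (A : Connection J P) {u v : ℝ → P} {t : ℝ} (h : u =ᶠ[𝓝 t] v) :
    A.along u t = A.along v t := by
  rw [Connection.along, Connection.along, h.mfderiv_eq]
  exact A.form_congr h.self_of_nhds _

/-- `form_vertical` is an identity at the angle `0`; shifting the angle by `a` applies it at the
point `Circle.exp a • q`. -/
theorem Connection.form_mfderiv_exp_smul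
    (hs : ContMDiff ((𝓡 1).prod J) J ∞ (fun z : Circle × P => z.1 • z.2))
    (A : Connection J P) (q : P) (a r : ℝ) :
    A.form (Circle.exp a • q) (mfderiv 𝓘(ℝ, ℝ) J (fun θ : ℝ => Circle.exp θ • q) a r) = r := by
  have hd : MDifferentiableAt 𝓘(ℝ, ℝ) J (fun θ : ℝ => Circle.exp θ • (Circle.exp a • q)) 0 :=
    ((contMDiff_exp_smul hs).comp (contMDiff_id.prodMk contMDiff_const)).mdifferentiableAt (by simp)
  have heq : (fun θ : ℝ => Circle.exp θ • q) =
      fun θ : ℝ => Circle.exp (θ - a) • (Circle.exp a • q) := by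
    funext θ
    simp [smul_smul]
  have h1 : (mfderiv 𝓘(ℝ, ℝ) J (fun θ : ℝ => Circle.exp θ • q) a r : F) =
      r • (mfderiv 𝓘(ℝ, ℝ) J (fun θ : ℝ => Circle.exp θ • (Circle.exp a • q)) 0 (1 : ℝ) : F) := by
    rw [heq]
    have := mfderiv_comp_real (J := J) (φ := fun θ : ℝ => θ - a) (sub_self a) hd
      (by fun_prop) r
    rw [deriv_sub_const, deriv_id'', mul_one] at this
    exact this
  have h3 := A.form_vertical (Circle.exp a • q)
  have h4 : A.form (Circle.exp a • q)
      (mfderiv 𝓘(ℝ, ℝ) J (fun θ : ℝ => Circle.exp θ • (Circle.exp a • q)) 0 (1 : ℝ)) = 1 :=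
    (A.form_congr (show Circle.exp a • q = Circle.exp 0 • Circle.exp a • q by
      rw [Circle.exp_zero, one_smul]) _).trans h3
  refine (congrArg (A.form (Circle.exp a • q)) h1).trans ?_
  refine (map_smul (A.form (Circle.exp a • q)) r _).trans ?_
  rw [smul_eq_mul]
  exact (congrArg (r * ·) h4).trans (mul_one r)

/-- Rotating a curve by the angle `θ` adds the derivative of `θ` to the value of the connection. -/
theorem Connection.along_exp_smul
    (hs : ContMDiff ((𝓡 1).prod J) J ∞ (fun z : Circle × P => z.1 • z.2))
    (A : Connection J P) {u : ℝ → P} {t : ℝ} (hu : MDifferentiableAt 𝓘(ℝ, ℝ) J u t) {θ : ℝ → ℝ}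
    {θ' : ℝ} (hθ : HasDerivAt θ θ' t) :
    MDifferentiableAt 𝓘(ℝ, ℝ) J (fun s => Circle.exp (θ s) • u s) t ∧
      A.along (fun s => Circle.exp (θ s) • u s) t = A.along u t + θ' := by
  have hΦ : MDifferentiableAt (𝓘(ℝ, ℝ).prod J) J (fun z : ℝ × P => Circle.exp z.1 • z.2)
      (θ t, u t) := (contMDiff_exp_smul hs).mdifferentiableAt (by simp)
  have hθm : MDifferentiableAt 𝓘(ℝ, ℝ) 𝓘(ℝ, ℝ) θ t :=
    hθ.differentiableAt.mdifferentiableAt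
  have hpair : MDifferentiableAt 𝓘(ℝ, ℝ) (𝓘(ℝ, ℝ).prod J) (fun s => (θ s, u s)) t :=
    hθm.prodMk hu
  have hcomp : (fun s => Circle.exp (θ s) • u s) =
    (fun z : ℝ × P => Circle.exp z.1 • z.2) ∘ fun s => (θ s, u s) := rfl
  refine ⟨by rw [hcomp]; exact MDifferentiableAt.comp t hΦ hpair, ?_⟩
  have hd : mfderiv 𝓘(ℝ, ℝ) J (fun s => Circle.exp (θ s) • u s) t (1 : ℝ) =
      mfderiv 𝓘(ℝ, ℝ) J (fun a : ℝ => Circle.exp a • u t) (θ t) θ' +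
      mfderiv J J (fun q : P => Circle.exp (θ t) • q) (u t) (mfderiv 𝓘(ℝ, ℝ) J u t (1 : ℝ)) := by
    rw [hcomp, mfderiv_comp t hΦ hpair, mfderiv_prodMk hθm hu]
    have hθ1 : mfderiv 𝓘(ℝ, ℝ) 𝓘(ℝ, ℝ) θ t (1 : ℝ) = θ' := by
      rw [mfderiv_eq_fderiv]
      exact (fderiv_apply_one_eq_deriv (f := θ)).trans hθ.deriv
    refine (mfderiv_prod_eq_add_apply hΦ).trans ?_
    congr 1
    exact congrArg _ hθ1
  have h1 := A.form_mfderiv_exp_smul hs (u t) (θ t) θ'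
  have h2 := A.invariant (Circle.exp (θ t)) (u t) (mfderiv 𝓘(ℝ, ℝ) J u t (1 : ℝ))
  rw [Connection.along, hd]
  refine (map_add (A.form (Circle.exp (θ t) • u t)) _ _).trans ?_
  rw [h1, h2, add_comm]
  rfl

theorem Connection.along_smul
    (hs : ContMDiff ((𝓡 1).prod J) J ∞ (fun z : Circle × P => z.1 • z.2))
    (A : Connection J P) {u : ℝ → P} {t : ℝ} (hu : MDifferentiableAt 𝓘(ℝ, ℝ) J u t) (g : Circle) :
    MDifferentiableAt 𝓘(ℝ, ℝ) J (fun s => g • u s) t ∧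
      A.along (fun s => g • u s) t = A.along u t := by
  obtain ⟨a, rfl⟩ := Circle.exp_surjective g
  simpa using A.along_exp_smul hs hu (hasDerivAt_const t a)

theorem Connection.along_comp (A : Connection J P) {u : ℝ → P} {φ : ℝ → ℝ} {t : ℝ}
    (hu : MDifferentiableAt 𝓘(ℝ, ℝ) J u (φ t)) (hφ : DifferentiableAt ℝ φ t) :
    MDifferentiableAt 𝓘(ℝ, ℝ) J (fun s => u (φ s)) t ∧
      A.along (fun s => u (φ s)) t = deriv φ t * A.along u (φ t) := by
  have hφm := hφ.mdifferentiableAt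
  refine ⟨MDifferentiableAt.comp t hu hφm, ?_⟩
  have hd := mfderiv_comp_real rfl hu hφ 1
  rw [one_mul] at hd
  refine (congrArg (A.form (u (φ t))) hd).trans ?_
  exact map_smul (A.form (u (φ t))) _ _

theorem Connection.continuousOn_along (A : Connection J P) {u : ℝ → P} {s : Set ℝ} (hs : IsOpen s)
    (hu : ContMDiffOn 𝓘(ℝ, ℝ) J ∞ u s) : ContinuousOn (A.along u) s := by
  have h1 := hu.continuousOn_tangentMapWithin (by simp) hs.uniqueMDiffOn
  have h2 : Continuous fun t : ℝ => (⟨t, (1 : ℝ)⟩ : TangentBundle 𝓘(ℝ, ℝ) ℝ) := by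
    have := (tangentBundleModelSpaceHomeomorph 𝓘(ℝ, ℝ)).symm.continuous.comp
      (f := fun t : ℝ => ((t, (1 : ℝ)) : ModelProd ℝ ℝ))
      (by exact continuous_id.prodMk continuous_const)
    exact this
  have h3 := A.smooth_form.continuous.comp_continuousOn
    (h1.comp (s := s) h2.continuousOn fun t ht => ht)
  refine h3.congr fun t ht => ?_
  simp only [Function.comp_apply, tangentMapWithin, Connection.along]
  rw [mfderivWithin_of_isOpen hs ht]
  rfl

end Velocity

/-! ### Fibres of a principal circle bundle -/

section Fibres

variable {E : Type*} [NormedAddCommGroup E] [NormedSpace ℝ E]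
  {H : Type*} [TopologicalSpace H] {I : ModelWithCorners ℝ E H}
  {M : Type*} [TopologicalSpace M] [ChartedSpace H M]
  {F : Type*} [NormedAddCommGroup F] [NormedSpace ℝ F]
  {K : Type*} [TopologicalSpace K] {J : ModelWithCorners ℝ F K}
  {P : Type*} [TopologicalSpace P] [ChartedSpace K P] [MulAction Circle P]
  {π : P → M} (hπ : IsPrincipalCircleBundle I J π)

include hπ

theorem IsPrincipalCircleBundle.continuous_const_smul (g : Circle) :
    Continuous fun p : P => g • p :=
  hπ.smooth_smul.continuous.comp (continuous_const.prodMk continuous_id)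

/-- A trivialization computes `e (g • p)` without saying that `g • p` lies in its domain. For small
angles it does, by continuity, so the set of angles preserving the fibre is open; it is closed, and
`ℝ` is connected. -/
theorem IsPrincipalCircleBundle.proj_smul [T2Space M] (g : Circle) (p : P) : π (g • p) = π p := by
  obtain ⟨a, rfl⟩ := Circle.exp_surjective g
  have hcont : Continuous fun a : ℝ => Circle.exp a • p :=
    (contMDiff_exp_smul hπ.smooth_smul).continuous.comp (continuous_id.prodMk continuous_const)
  have hπc := hπ.smooth_proj.continuous
  suffices h : {a : ℝ | π (Circle.exp a • p) = π p} = univ from h.ge (mem_univ a)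
  refine IsClopen.eq_univ ⟨isClosed_eq (hπc.comp hcont) continuous_const, ?_⟩ ⟨0, by simp⟩
  rw [isOpen_iff_mem_nhds]
  intro a ha
  obtain ⟨U, e, -, hx, hsrc, -, -, -, hfst, hsm⟩ := hπ.locally_trivial (π p)
  have hq : Circle.exp a • p ∈ e.source := by
    rw [hsrc, mem_preimage, show π (Circle.exp a • p) = π p from ha]
    exact hx
  filter_upwards [hcont.continuousAt.preimage_mem_nhds (e.open_source.mem_nhds hq)] with b hb
  have h1 := hsm (Circle.exp (b - a)) _ hq
  rw [smul_smul, ← Circle.exp_add, sub_add_cancel] at h1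
  change π (Circle.exp b • p) = π p
  rw [← hfst _ hb, h1, hfst _ hq]
  exact ha

theorem IsPrincipalCircleBundle.exists_smul_eq [T2Space M] {p q : P} (h : π p = π q) :
    ∃ g : Circle, q = g • p := by
  obtain ⟨U, e, -, hx, hsrc, -, -, -, hfst, hsm⟩ := hπ.locally_trivial (π p)
  have hp : p ∈ e.source := by rw [hsrc]; exact hx
  have hq : q ∈ e.source := by rw [hsrc, mem_preimage, ← h]; exact hx
  have hg : ((e q).2 / (e p).2) • p ∈ e.source := by
    rw [hsrc, mem_preimage, hπ.proj_smul]; exact hx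
  refine ⟨(e q).2 / (e p).2, e.injOn hq hg ?_⟩
  rw [hsm _ p hp, div_mul_cancel, hfst p hp, h, ← hfst q hq]

theorem IsPrincipalCircleBundle.smul_left_injective (p : P) :
    Function.Injective fun g : Circle => g • p := by
  intro g g' h
  obtain ⟨U, e, -, hx, hsrc, -, -, -, hfst, hsm⟩ := hπ.locally_trivial (π p)
  have hp : p ∈ e.source := by rw [hsrc]; exact hx
  have h2 := congrArg (fun q => (e q).2) h
  simp only [hsm _ p hp] at h2
  exact mul_right_cancel h2

theorem IsPrincipalCircleBundle.surjective : Function.Surjective π := by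
  intro y
  obtain ⟨U, e, -, hx, hsrc, htgt, -, -, hfst, hsm⟩ := hπ.locally_trivial y
  have ht : ((y, 1) : M × Circle) ∈ e.target := by rw [htgt]; exact ⟨hx, mem_univ _⟩
  refine ⟨e.symm (y, 1), ?_⟩
  rw [← hfst _ (e.map_target ht), e.right_inv ht]

/-- Local trivializations as equivariant local functions to `ℂ`. -/
theorem IsPrincipalCircleBundle.exists_local_phase [T2Space M] (y : M) :
    ∃ (U : Set M) (z : P → ℂ), IsOpen U ∧ y ∈ U ∧ ContMDiffOn J 𝓘(ℝ, ℂ) ∞ z (π ⁻¹' U) ∧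
      (∀ p, ‖z p‖ = 1) ∧ ∀ (g : Circle), ∀ p ∈ π ⁻¹' U, z (g • p) = g * z p := by
  obtain ⟨U, e, hU, hx, hsrc, htgt, he, -, hfst, hsm⟩ := hπ.locally_trivial y
  refine ⟨U, fun p => ((e p).2 : ℂ), hU, hx, ?_, fun p => Circle.norm_coe _, fun g p hp => ?_⟩
  · rw [← hsrc]
    have : Fact (Module.finrank ℝ ℂ = 1 + 1) := finrank_real_complex_fact'
    have hc : ContMDiff (𝓡 1) 𝓘(ℝ, ℂ) ∞ (fun z : Circle => (z : ℂ)) :=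
      contMDiff_coe_sphere (E := ℂ) (n := 1)
    exact hc.comp_contMDiffOn (contMDiff_snd.comp_contMDiffOn he)
  · rw [← hsrc] at hp
    simp only [hsm g p hp, Circle.coe_mul]

end Fibres

/-! ### Interval induction and vanishing derivatives -/

section Intervals

/-- A local and additive property of intervals holds for the unit interval. -/
theorem interval_induction {Q : ℝ → ℝ → Prop}
    (htrans : ∀ a b c, a ≤ b → b ≤ c → Q a b → Q b c → Q a c)
    (hloc : ∀ t ∈ Icc (0 : ℝ) 1, ∃ δ > 0, ∀ a b, a ≤ b → a ∈ Ioo (t - δ) (t + δ) →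
      b ∈ Ioo (t - δ) (t + δ) → Q a b) : Q 0 1 := by
  choose! δ hδ hQ using hloc
  obtain ⟨t, ht0, hmono, ⟨n, hn⟩, hsub⟩ := exists_monotone_Icc_subset_open_cover_unitInterval
    (c := fun s : unitInterval => {r : unitInterval | (r : ℝ) ∈ Ioo (s - δ s) (s + δ s)})
    (fun s => isOpen_Ioo.preimage continuous_subtype_val)
    (fun s _ => mem_iUnion.2 ⟨s, by
      have := hδ s s.2
      constructor <;> linarith⟩)
  have hstep : ∀ k, Q (t k) (t (k + 1)) := fun k => by
    obtain ⟨s, hs⟩ := hsub k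
    have hle := hmono (Nat.le_succ k)
    exact hQ s s.2 _ _ hle (hs (left_mem_Icc.2 hle)) (hs (right_mem_Icc.2 hle))
  have : ∀ k, Q 0 (t (k + 1)) := fun k => by
    induction k with
    | zero => simpa [ht0] using hstep 0
    | succ k ih => exact htrans _ _ _ (t (k + 1)).2.1 (hmono (Nat.le_succ _)) ih (hstep _)
  simpa [hn (n + 1) (by omega)] using this n

theorem eq_of_hasDerivAt_zero_off_finite {V : Type*} [NormedAddCommGroup V] [NormedSpace ℝ V]
    [CompleteSpace V] {g : ℝ → V} {a b : ℝ} (hg : ContinuousOn g (Icc a b)) {S : Set ℝ}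
    (hS : S.Finite) (hd : ∀ t ∈ Ioo a b, t ∉ S → HasDerivAt g 0 t) {t : ℝ} (ht : t ∈ Icc a b) :
    g t = g a := by
  have := integral_eq_of_hasDerivAt_off_countable_of_le g (fun _ => 0) ht.1 hS.countable
    (hg.mono (Icc_subset_Icc_right ht.2))
    (fun s hs => hd s ⟨hs.1.1, hs.1.2.trans_le ht.2⟩ hs.2) (by simp)
  rw [intervalIntegral.integral_zero] at this
  exact (sub_eq_zero.1 this.symm)

end Intervals

/-! ### Existence and uniqueness of horizontal lifts -/

section Lifts

variable {M : Type*} {F : Type*} [NormedAddCommGroup F] [NormedSpace ℝ F]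
  {K : Type*} [TopologicalSpace K] {J : ModelWithCorners ℝ F K}
  {P : Type*} [TopologicalSpace P] [ChartedSpace K P] [MulAction Circle P] [IsManifold J ∞ P]
  {π : P → M} {A : Connection J P} {f : ℝ → M} {u v : ℝ → P} {a b c d : ℝ}

/-- Horizontal lifts of the restriction of a curve `f` to `[a, b]`. -/
structure IsLiftOn (π : P → M) (A : Connection J P) (f : ℝ → M) (a b : ℝ) (u : ℝ → P) : Prop where
  cont : ContinuousOn u (Icc a b)
  proj : ∀ t ∈ Icc a b, π (u t) = f t
  horizontal : ∃ S : Set ℝ, S.Finite ∧ ∀ t ∈ Ioo a b, t ∉ S →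
    MDifferentiableAt 𝓘(ℝ, ℝ) J u t ∧ A.along u t = 0

theorem IsLiftOn.congr (h : IsLiftOn π A f a b u) {f' : ℝ → M} (hf : ∀ t ∈ Icc a b, f' t = f t) :
    IsLiftOn π A f' a b u :=
  ⟨h.cont, fun t ht => (h.proj t ht).trans (hf t ht).symm, h.horizontal⟩

theorem IsLiftOn.mono (h : IsLiftOn π A f a b u) (hac : a ≤ c) (hdb : d ≤ b) :
    IsLiftOn π A f c d u := by
  obtain ⟨S, hS, hh⟩ := h.horizontal
  exact ⟨h.cont.mono (Icc_subset_Icc hac hdb), fun t ht => h.proj t (Icc_subset_Icc hac hdb ht),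
    S, hS, fun t ht => hh t (Ioo_subset_Ioo hac hdb ht)⟩

theorem IsLiftOn.glue (hab : a ≤ b) (hbc : b ≤ c) (hu : IsLiftOn π A f a b u)
    (hv : IsLiftOn π A f b c v) (huv : u b = v b) :
    IsLiftOn π A f a c (fun t => if t ≤ b then u t else v t) := by
  obtain ⟨S, hS, hh⟩ := hu.horizontal
  obtain ⟨T, hT, hh'⟩ := hv.horizontal
  have e1 : EqOn (fun t => if t ≤ b then u t else v t) u (Iic b) := fun t ht => if_pos ht
  have e2 : EqOn (fun t => if t ≤ b then u t else v t) v (Ici b) := fun t ht => by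
    rcases (mem_Ici.1 ht).eq_or_lt with rfl | h
    · simp [huv]
    · exact if_neg (not_le.2 h)
  refine ⟨?_, fun t ht => ?_, S ∪ T ∪ {b}, (hS.union hT).union (finite_singleton b),
    fun t ht htS => ?_⟩
  · rw [← Icc_union_Icc_eq_Icc hab hbc]
    exact (hu.cont.congr (e1.mono fun t ht => ht.2)).union_of_isClosed
      (hv.cont.congr (e2.mono fun t ht => ht.1)) isClosed_Icc isClosed_Icc
  · rcases le_total t b with h | h
    · exact (congrArg π (e1 h)).trans (hu.proj t ⟨ht.1, h⟩)
    · exact (congrArg π (e2 h)).trans (hv.proj t ⟨h, ht.2⟩)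
  · simp only [mem_union, mem_singleton_iff, not_or] at htS
    rcases lt_or_gt_of_ne htS.2 with h | h
    · have he : (fun t => if t ≤ b then u t else v t) =ᶠ[𝓝 t] u :=
        eventuallyEq_of_mem (Iio_mem_nhds h) (e1.mono Iio_subset_Iic_self)
      obtain ⟨h1, h2⟩ := hh t ⟨ht.1, h⟩ htS.1.1
      exact ⟨h1.congr_of_eventuallyEq he, (A.along_congr he).trans h2⟩
    · have he : (fun t => if t ≤ b then u t else v t) =ᶠ[𝓝 t] v :=
        eventuallyEq_of_mem (Ioi_mem_nhds h) (e2.mono Ioi_subset_Ici_self)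
      obtain ⟨h1, h2⟩ := hh' t ⟨h, ht.2⟩ htS.1.2
      exact ⟨h1.congr_of_eventuallyEq he, (A.along_congr he).trans h2⟩

theorem IsLiftOn.comp (h : IsLiftOn π A f a b u) {φ : ℝ → ℝ} (hc : ContinuousOn φ (Icc c d))
    (hm : MapsTo φ (Icc c d) (Icc a b)) (hm' : MapsTo φ (Ioo c d) (Ioo a b))
    (hi : InjOn φ (Ioo c d)) (hd : ∀ t ∈ Ioo c d, DifferentiableAt ℝ φ t) :
    IsLiftOn π A (fun t => f (φ t)) c d (fun t => u (φ t)) := by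
  obtain ⟨S, hS, hh⟩ := h.horizontal
  refine ⟨h.cont.comp hc hm, fun t ht => h.proj _ (hm ht), Ioo c d ∩ φ ⁻¹' S, ?_,
    fun t ht htS => ?_⟩
  -- Injectivity of `φ` keeps the set of exceptional parameters finite.
  · refine Finite.of_finite_image (f := φ) (hS.subset ?_) (hi.mono inter_subset_left)
    rintro _ ⟨t, ht, rfl⟩
    exact ht.2
  · obtain ⟨h1, h2⟩ := hh (φ t) (hm' ht) fun h => htS ⟨ht, h⟩
    obtain ⟨h3, h4⟩ := A.along_comp h1 (hd t ht)
    exact ⟨h3, by rw [h4, h2, mul_zero]⟩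

variable {E : Type*} [NormedAddCommGroup E] [NormedSpace ℝ E]
  {H : Type*} [TopologicalSpace H] {I : ModelWithCorners ℝ E H}
  [TopologicalSpace M]

theorem isHorizontalLift_iff {x : M} {α : Path x x} {u₀ : P} :
    IsHorizontalLift π A α u₀ u ↔ IsLiftOn π A α.extend 0 1 u ∧ u 0 = u₀ := by
  constructor
  · rintro ⟨h1, h2, h3, S, hS⟩
    refine ⟨⟨h1, fun t ht => ?_, S, S.finite_toSet, fun t ht htS => hS t ht (by simpa using htS)⟩,
      h2⟩
    rw [α.extend_apply ht]
    exact h3 ⟨t, ht⟩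
  · rintro ⟨⟨h1, h2, S, hf, hS⟩, h3⟩
    refine ⟨h1, h3, fun s => ?_, hf.toFinset, fun t ht htS => hS t ht (by simpa using htS)⟩
    rw [h2 s s.2, Path.extend_apply]

variable [ChartedSpace H M] [T2Space M] (hπ : IsPrincipalCircleBundle I J π)

include hπ

theorem IsLiftOn.smul (h : IsLiftOn π A f a b u) (g : Circle) :
    IsLiftOn π A f a b (fun t => g • u t) := by
  obtain ⟨S, hS, hh⟩ := h.horizontal
  refine ⟨(hπ.continuous_const_smul g).comp_continuousOn h.cont, fun t ht => ?_, S, hS,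
    fun t ht htS => ?_⟩
  · rw [hπ.proj_smul, h.proj t ht]
  · obtain ⟨h1, h2⟩ := hh t ht htS
    obtain ⟨h3, h4⟩ := A.along_smul hπ.smooth_smul h1 g
    exact ⟨h3, h4.trans h2⟩

/-- Horizontal lifts are unique up to the action of the structure group. -/
theorem IsLiftOn.exists_eq_smul (hu : IsLiftOn π A f a b u) (hv : IsLiftOn π A f a b v) :
    ∃ g : Circle, ∀ t ∈ Icc a b, v t = g • u t := by
  have hex : ∀ t ∈ Icc a b, ∃ g : Circle, v t = g • u t := fun t ht =>
    hπ.exists_smul_eq ((hu.proj t ht).trans (hv.proj t ht).symm)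
  choose! G hG using hex
  obtain ⟨S, hS, hh⟩ := hu.horizontal
  obtain ⟨T, hT, hh'⟩ := hv.horizontal
  -- Locally the rotation from `u` to `v` is a quotient of phases, which gives its continuity and,
  -- off the exceptional sets, its differentiability.
  have hphase : ∀ t₀ ∈ Icc a b, ∃ (U : Set M) (z : P → ℂ), IsOpen (π ⁻¹' U) ∧
      ContMDiffOn J 𝓘(ℝ, ℂ) ∞ z (π ⁻¹' U) ∧ (∀ p, ‖z p‖ = 1) ∧ u t₀ ∈ π ⁻¹' U ∧
      v t₀ ∈ π ⁻¹' U ∧ ∀ t ∈ Icc a b, u t ∈ π ⁻¹' U → (G t : ℂ) = z (v t) / z (u t) := by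
    intro t₀ ht₀
    obtain ⟨U, z, hU, hy, hz, hz1, hzg⟩ := hπ.exists_local_phase (f t₀)
    refine ⟨U, z, hU.preimage hπ.smooth_proj.continuous, hz, hz1, ?_, ?_, fun t ht htU => ?_⟩
    · rwa [mem_preimage, hu.proj t₀ ht₀]
    · rwa [mem_preimage, hv.proj t₀ ht₀]
    · rw [hG t ht, hzg _ _ htU, mul_div_cancel_right₀]
      exact norm_ne_zero_iff.1 (by rw [hz1]; exact one_ne_zero)
  have hcont : ContinuousOn (fun t => (G t : ℂ)) (Icc a b) := by
    intro t₀ ht₀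
    obtain ⟨U, z, hU, hz, hz1, hu0, hv0, hGz⟩ := hphase t₀ ht₀
    have hcz : ∀ p ∈ π ⁻¹' U, ContinuousAt z p := fun p hp =>
      (hz.contMDiffAt (hU.mem_nhds hp)).continuousAt
    have h1 : ContinuousWithinAt (fun t => z (v t) / z (u t)) (Icc a b) t₀ :=
      ((hcz _ hv0).comp_continuousWithinAt (hv.cont t₀ ht₀)).div
        ((hcz _ hu0).comp_continuousWithinAt (hu.cont t₀ ht₀))
        (norm_ne_zero_iff.1 (by rw [hz1]; exact one_ne_zero))
    refine h1.congr_of_eventuallyEq ?_ (hGz t₀ ht₀ hu0)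
    filter_upwards [self_mem_nhdsWithin, (hu.cont t₀ ht₀).preimage_mem_nhdsWithin
      (hU.mem_nhds hu0)] with t ht htU
    exact hGz t ht htU
  have hderiv : ∀ t ∈ Ioo a b, t ∉ S ∪ T → HasDerivAt (fun t => (G t : ℂ)) 0 t := by
    intro t₀ ht₀ htS
    rw [mem_union, not_or] at htS
    have ht₀' := Ioo_subset_Icc_self ht₀
    have hnhds := Icc_mem_nhds ht₀.1 ht₀.2
    obtain ⟨hu1, hu2⟩ := hh t₀ ht₀ htS.1
    obtain ⟨hv1, hv2⟩ := hh' t₀ ht₀ htS.2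
    obtain ⟨U, z, hU, hz, hz1, hu0, hv0, hGz⟩ := hphase t₀ ht₀'
    have hdz : ∀ p ∈ π ⁻¹' U, MDifferentiableAt J 𝓘(ℝ, ℂ) z p := fun p hp =>
      (hz.contMDiffAt (hU.mem_nhds hp)).mdifferentiableAt (by simp)
    have hzu : DifferentiableAt ℝ (fun t => z (u t)) t₀ :=
      mdifferentiableAt_iff_differentiableAt.1 (MDifferentiableAt.comp t₀ (hdz _ hu0) hu1)
    have hzv : DifferentiableAt ℝ (fun t => z (v t)) t₀ :=
      mdifferentiableAt_iff_differentiableAt.1 (MDifferentiableAt.comp t₀ (hdz _ hv0) hv1)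
    -- Division by `G t₀` moves the value at `t₀` to `1`, away from the branch cut, so the argument
    -- is a differentiable angle there.
    have hGd : DifferentiableAt ℝ (fun t => ((G t / G t₀ : Circle) : ℂ)) t₀ := by
      have h1 : DifferentiableAt ℝ (fun t => z (v t) / z (u t) / (G t₀ : ℂ)) t₀ :=
        (hzv.fun_div hzu (norm_ne_zero_iff.1 (by rw [hz1]; exact one_ne_zero))).div_const _
      refine h1.congr_of_eventuallyEq ?_
      filter_upwards [hnhds, (hu.cont.continuousAt hnhds).preimage_mem_nhds (hU.mem_nhds hu0)]
        with t ht htU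
      rw [Circle.coe_div, hGz t ht htU]
    have hlog := hGd.hasDerivAt.clog_real (by simp)
    set θ : ℝ → ℝ := fun t => Complex.arg ((G t / G t₀ : Circle) : ℂ) with hθ
    obtain ⟨θ', hθ'⟩ : ∃ θ', HasDerivAt θ θ' t₀ := by
      refine ⟨_, (Complex.imCLM.hasFDerivAt.comp_hasDerivAt t₀ hlog).congr_of_eventuallyEq ?_⟩
      exact Eventually.of_forall fun t => by simp [hθ, Complex.log_im]
    have hGθ : ∀ t, G t = G t₀ * Circle.exp (θ t) := fun t => by
      rw [hθ, Circle.exp_arg, mul_div_cancel]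
    have hvθ : v =ᶠ[𝓝 t₀] fun t => Circle.exp (θ t) • (G t₀ • u t) := by
      filter_upwards [hnhds] with t ht
      rw [hG t ht, hGθ t, smul_smul, mul_comm]
    obtain ⟨h3, h4⟩ := A.along_smul hπ.smooth_smul hu1 (G t₀)
    obtain ⟨-, h6⟩ := A.along_exp_smul hπ.smooth_smul h3 hθ'
    -- Rotating the horizontal curve `u` adds `θ'` to the connection value, and the result `v` is
    -- again horizontal.
    have h7 : θ' = 0 := by
      rw [A.along_congr hvθ, h6, h4, hu2, zero_add] at hv2
      exact hv2
    rw [h7] at hθ'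
    have h8 : HasDerivAt (fun t => (G t₀ : ℂ) * Complex.exp (θ t * Complex.I)) 0 t₀ := by
      have := ((hθ'.ofReal_comp.mul_const Complex.I).cexp).const_mul (G t₀ : ℂ)
      simpa using this
    refine h8.congr_of_eventuallyEq (Eventually.of_forall fun t => ?_)
    dsimp only
    rw [hGθ t, Circle.coe_mul, Circle.coe_exp]
  refine ⟨G a, fun t ht => ?_⟩
  have := eq_of_hasDerivAt_zero_off_finite hcont (hS.union hT) hderiv ht
  rw [hG t ht, Circle.ext this]

/-- A local section `w` over the curve is rotated by an angle with derivative `-A.along w`. As the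
group is abelian, the equation of parallel transport is a plain integral. -/
theorem IsPrincipalCircleBundle.exists_local_lift (A : Connection J P) {k : ℝ → M} {t₀ : ℝ}
    {s : Set ℝ} (hs : s ∈ 𝓝 t₀) (hk : ContMDiffOn 𝓘(ℝ, ℝ) I ∞ k s) :
    ∃ δ > 0, ∃ u : ℝ → P, ∀ a b, a ∈ Ioo (t₀ - δ) (t₀ + δ) → b ∈ Ioo (t₀ - δ) (t₀ + δ) →
      IsLiftOn π A k a b u := by
  obtain ⟨U, e, hU, hx, hsrc, htgt, -, he, hfst, hsm⟩ := hπ.locally_trivial (k t₀)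
  have hkc : ContinuousAt k t₀ := (hk.contMDiffAt hs).continuousAt
  obtain ⟨δ, hδ, hball⟩ := Metric.mem_nhds_iff.1
    (inter_mem hs (hkc.preimage_mem_nhds (hU.mem_nhds hx)))
  rw [Real.ball_eq_Ioo] at hball
  set N := Ioo (t₀ - δ) (t₀ + δ) with hN
  have ht₀ : t₀ ∈ N := ⟨by linarith, by linarith⟩
  have hmaps : MapsTo (fun t => (k t, (1 : Circle))) N e.target := fun t ht => by
    rw [htgt]
    exact ⟨(hball ht).2, mem_univ _⟩
  set w : ℝ → P := fun t => e.symm (k t, 1) with hw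
  have hwN : ContMDiffOn 𝓘(ℝ, ℝ) J ∞ w N :=
    he.comp ((hk.mono fun t ht => (hball ht).1).prodMk contMDiffOn_const) hmaps
  have hb := A.continuousOn_along isOpen_Ioo hwN
  have hintg : ∀ t ∈ N, IntervalIntegrable (A.along w) volume t₀ t := fun t ht =>
    (hb.mono (ordConnected_Ioo.uIcc_subset ht₀ ht)).intervalIntegrable
  set θ : ℝ → ℝ := fun t => -∫ r in t₀..t, A.along w r with hθ
  have hθd : ∀ t ∈ N, HasDerivAt θ (-A.along w t) t := fun t ht =>
    (intervalIntegral.integral_hasDerivAt_right (hintg t ht)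
      (hb.stronglyMeasurableAtFilter isOpen_Ioo t ht)
      (hb.continuousAt (isOpen_Ioo.mem_nhds ht))).neg
  have hmain : ∀ t ∈ N, MDifferentiableAt 𝓘(ℝ, ℝ) J (fun r => Circle.exp (θ r) • w r) t ∧
      A.along (fun r => Circle.exp (θ r) • w r) t = 0 := fun t ht => by
    have h1 := (hwN.contMDiffAt (isOpen_Ioo.mem_nhds ht)).mdifferentiableAt (by simp)
    obtain ⟨h2, h3⟩ := A.along_exp_smul hπ.smooth_smul h1 (hθd t ht)
    exact ⟨h2, by rw [h3, add_neg_cancel]⟩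
  refine ⟨δ, hδ, fun r => Circle.exp (θ r) • w r, fun a b ha hb' => ⟨fun t ht => ?_,
    fun t ht => ?_, ∅, finite_empty, fun t ht _ => hmain t ?_⟩⟩
  · exact (hmain t (ordConnected_Ioo.out ha hb' ht)).1.continuousAt.continuousWithinAt
  · have htN := ordConnected_Ioo.out ha hb' ht
    rw [hπ.proj_smul, hw, ← hfst _ (e.map_target (hmaps htN)), e.right_inv (hmaps htN)]
  · exact ordConnected_Ioo.out ha hb' (Ioo_subset_Icc_self ht)

/-- Lifts exist through every point over the initial point. -/
theorem IsPrincipalCircleBundle.exists_isLiftOn [IsManifold I ω M] (A : Connection J P) {f : ℝ → M}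
    (hf : HasAnalyticGerms I f) {p : P} (hp : π p = f 0) :
    ∃ u, IsLiftOn π A f 0 1 u ∧ u 0 = p := by
  have hstart : ∀ {a b : ℝ} {u : ℝ → P}, a ≤ b → IsLiftOn π A f a b u →
      ∀ p, π p = f a → ∃ u, IsLiftOn π A f a b u ∧ u a = p := fun {a b u} hab hu p hp => by
    obtain ⟨g, hg⟩ := hπ.exists_smul_eq (p := u a) (q := p)
      ((hu.proj a (left_mem_Icc.2 hab)).trans hp.symm)
    exact ⟨_, hu.smul hπ g, hg.symm⟩
  have htrans : ∀ a b c, a ≤ b → b ≤ c →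
      (∀ p, π p = f a → ∃ u, IsLiftOn π A f a b u ∧ u a = p) →
      (∀ p, π p = f b → ∃ u, IsLiftOn π A f b c u ∧ u b = p) →
      ∀ p, π p = f a → ∃ u, IsLiftOn π A f a c u ∧ u a = p := by
    intro a b c hab hbc h1 h2 p hp
    obtain ⟨u, hu, rfl⟩ := h1 p hp
    obtain ⟨v, hv, hvb⟩ := h2 (u b) (hu.proj b (right_mem_Icc.2 hab))
    exact ⟨_, hu.glue hab hbc hv hvb.symm, if_pos hab⟩
  refine interval_induction (Q := fun a b => ∀ p, π p = f a → ∃ u, IsLiftOn π A f a b u ∧ u a = p)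
    htrans (fun t₀ _ => ?_) p hp
  have hloc : ∀ k : ℝ → M, ContMDiffAt 𝓘(ℝ, ℝ) I ω k t₀ → ∃ δ > 0, ∃ u : ℝ → P, ∀ a b,
      a ∈ Ioo (t₀ - δ) (t₀ + δ) → b ∈ Ioo (t₀ - δ) (t₀ + δ) → IsLiftOn π A k a b u := by
    intro k hk
    obtain ⟨s, hs, hks⟩ := (contMDiffAt_iff_contMDiffOn_nhds (by simp)).1 hk
    exact hπ.exists_local_lift A hs (hks.of_le le_top)
  obtain ⟨⟨k, hk, hfk⟩, k', hk', hfk'⟩ := hf t₀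
  obtain ⟨δ, hδ, u, hu⟩ := hloc k hk
  obtain ⟨δ', hδ', u', hu'⟩ := hloc k' hk'
  obtain ⟨r, hr, hfr⟩ := mem_nhdsGE_iff_exists_Ico_subset.1 hfk
  obtain ⟨r', hr', hfr'⟩ := mem_nhdsLE_iff_exists_Ioc_subset.1 hfk'
  rw [mem_Ioi] at hr
  rw [mem_Iio] at hr'
  -- Within `ε` of `t₀` both one-sided analytic curves have lifts and agree with `f` on their sides.
  set ε := min (min δ δ') (min (r - t₀) (t₀ - r'))
  have hε1 : ε ≤ δ := (min_le_left _ _).trans (min_le_left _ _)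
  have hε2 : ε ≤ δ' := (min_le_left _ _).trans (min_le_right _ _)
  have hε3 : ε ≤ r - t₀ := (min_le_right _ _).trans (min_le_left _ _)
  have hε4 : ε ≤ t₀ - r' := (min_le_right _ _).trans (min_le_right _ _)
  have hε : 0 < ε := lt_min (lt_min hδ hδ') (lt_min (sub_pos.2 hr) (sub_pos.2 hr'))
  have hright : ∀ a b, a ≤ b → t₀ ≤ a → b < t₀ + ε → IsLiftOn π A f a b u := by
    intro a b hab ha hb
    refine (hu a b ⟨by linarith, by linarith⟩ ⟨by linarith, by linarith⟩).congr fun t ht => ?_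
    exact hfr ⟨ha.trans ht.1, by linarith [ht.2]⟩
  have hleft : ∀ a b, a ≤ b → b ≤ t₀ → t₀ - ε < a → IsLiftOn π A f a b u' := by
    intro a b hab hb ha
    refine (hu' a b ⟨by linarith, by linarith⟩ ⟨by linarith, by linarith⟩).congr fun t ht => ?_
    exact hfr' ⟨by linarith [ht.1], ht.2.trans hb⟩
  refine ⟨ε, hε, fun a b hab ha hb => ?_⟩
  rcases le_total t₀ a with h | h
  · exact hstart hab (hright a b hab h hb.2)
  rcases le_total b t₀ with h' | h'
  · exact hstart hab (hleft a b hab h' ha.1)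
  · exact htrans a t₀ b h h' (hstart h (hleft a t₀ h le_rfl ha.1))
      (hstart h' (hright t₀ b h' le_rfl hb.2))

end Lifts

/-! ### Holonomy: multiplicativity and thin invariance -/

section Holonomy

variable {E : Type*} [NormedAddCommGroup E] [NormedSpace ℝ E]
  {H : Type*} [TopologicalSpace H] {I : ModelWithCorners ℝ E H}
  {M : Type*} [TopologicalSpace M] [ChartedSpace H M]
  {F : Type*} [NormedAddCommGroup F] [NormedSpace ℝ F]
  {K : Type*} [TopologicalSpace K] {J : ModelWithCorners ℝ F K}
  {P : Type*} [TopologicalSpace P] [ChartedSpace K P] [MulAction Circle P] [IsManifold J ∞ P]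
  {π : P → M} {x : M} {u₀ : P}
  [T2Space M] (hπ : IsPrincipalCircleBundle I J π)

include hπ

theorem IsLiftOn.eq_smul {A : Connection J P} {f : ℝ → M} {u v : ℝ → P} {a b : ℝ}
    (hu : IsLiftOn π A f a b u) (hv : IsLiftOn π A f a b v) {g : Circle} (hab : a ≤ b)
    (h : v a = g • u a) : ∀ t ∈ Icc a b, v t = g • u t := by
  obtain ⟨c, hc⟩ := hu.exists_eq_smul hπ hv
  have : c = g := hπ.smul_left_injective (u a) ((hc a (left_mem_Icc.2 hab)).symm.trans h)
  rwa [this] at hc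

theorem IsPrincipalCircleBundle.existsUnique_isHolonomy [IsManifold I ω M] (hu₀ : π u₀ = x)
    (A : Connection J P) (α : PALoop I x) : ∃! g : Circle, IsHolonomy π A u₀ α.1 g := by
  obtain ⟨u, hu, hu0⟩ := hπ.exists_isLiftOn A α.2.hasAnalyticGerms (p := u₀) (by simp [hu₀])
  obtain ⟨g, hg⟩ := hπ.exists_smul_eq (p := u 1) (q := u₀)
    (by rw [hu.proj 1 (by simp), hu₀]; simp)
  refine ⟨g, ⟨u, isHorizontalLift_iff.2 ⟨hu, hu0⟩, hg⟩, ?_⟩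
  rintro g' ⟨v, hv, hg'⟩
  obtain ⟨hv, hv0⟩ := isHorizontalLift_iff.1 hv
  have h1 := hu.eq_smul hπ hv (g := 1) zero_le_one (by rw [hu0, hv0, one_smul]) 1 (by simp)
  rw [one_smul] at h1
  rw [h1] at hg'
  exact hπ.smul_left_injective (u 1) (hg'.symm.trans hg)

theorem IsPrincipalCircleBundle.isHolonomy_holonomy [IsManifold I ω M] (hu₀ : π u₀ = x)
    (A : Connection J P) (α : PALoop I x) : IsHolonomy π A u₀ α.1 (holonomy π A u₀ α.1) :=
  Classical.epsilon_spec (hπ.existsUnique_isHolonomy hu₀ A α).exists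

theorem IsPrincipalCircleBundle.holonomy_eq [IsManifold I ω M] (hu₀ : π u₀ = x)
    (A : Connection J P) (α : PALoop I x) {u : ℝ → P} (hu : IsLiftOn π A α.1.extend 0 1 u)
    (h0 : u 0 = u₀) {g : Circle} (hg : u₀ = g • u 1) : holonomy π A u₀ α.1 = g :=
  (hπ.existsUnique_isHolonomy hu₀ A α).unique (hπ.isHolonomy_holonomy hu₀ A α)
    ⟨u, isHorizontalLift_iff.2 ⟨hu, h0⟩, hg⟩

theorem IsPrincipalCircleBundle.exists_lift_holonomy [IsManifold I ω M] (hu₀ : π u₀ = x)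
    (A : Connection J P) (α : PALoop I x) : ∃ u : ℝ → P, IsLiftOn π A α.1.extend 0 1 u ∧
      u 0 = u₀ ∧ u₀ = holonomy π A u₀ α.1 • u 1 := by
  obtain ⟨u, hu, hg⟩ := hπ.isHolonomy_holonomy hu₀ A α
  exact ⟨u, (isHorizontalLift_iff.1 hu).1, (isHorizontalLift_iff.1 hu).2, hg⟩

theorem IsPrincipalCircleBundle.holonomy_trans [IsManifold I ω M] (hu₀ : π u₀ = x)
    (A : Connection J P) (α β : PALoop I x) :
    holonomy π A u₀ (α.1.trans β.1) = holonomy π A u₀ α.1 * holonomy π A u₀ β.1 := by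
  obtain ⟨u, hu, hu0, hu1⟩ := hπ.exists_lift_holonomy hu₀ A α
  obtain ⟨v, hv, hv0, hv1⟩ := hπ.exists_lift_holonomy hu₀ A β
  set g := holonomy π A u₀ α.1
  set g' := holonomy π A u₀ β.1
  have h1 : IsLiftOn π A (α.1.trans β.1).extend 0 (1 / 2) (fun t => u (2 * t)) := by
    refine (hu.comp (φ := fun t => 2 * t) (c := 0) (d := 1 / 2) (by fun_prop)
      (fun t ht => ⟨by linarith [ht.1], by linarith [ht.2]⟩)
      (fun t ht => ⟨by linarith [ht.1], by linarith [ht.2]⟩)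
      (fun a _ b _ hab => by simpa using hab) fun t _ => by fun_prop).congr fun t ht => ?_
    have h01 : t ∈ Icc (0 : ℝ) 1 := ⟨ht.1, by linarith [ht.2]⟩
    rw [Path.extend_apply _ h01, Path.trans_apply, dif_pos ht.2, Path.extend_apply]
  -- The lift over the first loop ends at `g⁻¹ • u₀`, so the lift over the second is rotated by
  -- `g⁻¹` to start there.
  have h2 : IsLiftOn π A (α.1.trans β.1).extend (1 / 2) 1 (fun t => g⁻¹ • v (2 * t - 1)) := by
    refine ((hv.smul hπ g⁻¹).comp (φ := fun t => 2 * t - 1) (c := 1 / 2) (d := 1) (by fun_prop)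
      (fun t ht => ⟨by linarith [ht.1], by linarith [ht.2]⟩)
      (fun t ht => ⟨by linarith [ht.1], by linarith [ht.2]⟩)
      (fun a _ b _ hab => by simpa using hab) fun t _ => by fun_prop).congr fun t ht => ?_
    have h01 : t ∈ Icc (0 : ℝ) 1 := ⟨by linarith [ht.1], ht.2⟩
    rw [Path.extend_apply _ h01, Path.trans_apply]
    split_ifs with h
    · have : t = 1 / 2 := le_antisymm h ht.1
      subst this
      simp
    · rw [Path.extend_apply]
  have h3 := h1.glue (by norm_num) (by norm_num) h2 (by
    norm_num
    rw [hv0, eq_inv_smul_iff, ← hu1])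
  refine hπ.holonomy_eq hu₀ A ⟨α.1.trans β.1, α.2.trans β.2⟩ h3 (by simpa using hu0) ?_
  norm_num
  rw [smul_smul, mul_right_comm, mul_inv_cancel, one_mul, ← hv1]

/-- The holonomy around a loop that passes all its edges with total multiplicity zero is trivial. -/
theorem IsPrincipalCircleBundle.holonomy_eq_one [IsManifold I ω M] (hu₀ : π u₀ = x)
    (A : Connection J P) (α : PALoop I x) {n : ℕ} {t : ℕ → ℝ}
    (hP : IsEdgePartition I α.1.extend n t)
    (hcount : ∀ i < n, IsEdge I α.1.extend (t i) (t (i + 1)) → edgeCount α.1.extend n t i = 0) :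
    holonomy π A u₀ α.1 = 1 := by
  obtain ⟨u, hu, hu0, hu1⟩ := hπ.exists_lift_holonomy hu₀ A α
  refine hπ.holonomy_eq hu₀ A α hu hu0 ?_
  set f := α.1.extend with hf
  have hs := Function.rightInverse_surjInv hπ.surjective
  set s := Function.surjInv hπ.surjective
  -- `s` is a section with no continuity, used only to compare lifted points over the same point of
  -- `M`; increments of `g` depend just on the lifts.
  have hex : ∀ τ ∈ Icc (0 : ℝ) 1, ∃ g : Circle, u τ = g • s (f τ) := fun τ hτ =>
    hπ.exists_smul_eq ((hs (f τ)).trans (hu.proj τ hτ).symm)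
  choose! g hg using hex
  have hl : ∀ {i}, i < n → t i ∈ Icc (t i) (t (i + 1)) := fun hi => left_mem_Icc.2 (hP.lt _ hi).le
  have hr : ∀ {i}, i < n → t (i + 1) ∈ Icc (t i) (t (i + 1)) :=
    fun hi => right_mem_Icc.2 (hP.lt _ hi).le
  have hmono : ∀ {i}, i < n → IsLiftOn π A f (t i) (t (i + 1)) u := fun hi =>
    hu.mono (hP.mem_Icc hi.le).1 (hP.mem_Icc (Nat.succ_le_of_lt hi)).2
  have hmain : g 1 = g 0 := by
    refine hP.eq_of_edgeCount_eq_zero g hcount (fun i hi hc => ?_) fun i hi j hj hei hej φ hφ => ?_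
    · have hconst : IsLiftOn π A f (t i) (t (i + 1)) fun _ => u (t i) := by
        refine ⟨continuousOn_const, fun τ hτ => ?_, ∅, finite_empty, fun τ _ _ =>
          ⟨mdifferentiableAt_const, ?_⟩⟩
        · rw [hu.proj _ (hP.mem_Icc hi.le), hc τ hτ]
        · rw [Connection.along, mfderiv_const]
          exact map_zero (A.form (u (t i)))
      have h1 := hconst.eq_smul hπ (hmono hi) (g := 1) (hP.lt i hi).le (one_smul _ _).symm _ (hr hi)
      rw [one_smul, hg _ (hP.mem_Icc hi.le), hg _ (hP.mem_Icc (Nat.succ_le_of_lt hi)),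
        hc _ (hr hi)] at h1
      exact hπ.smul_left_injective _ h1
    -- `u ∘ φ` and `u` lift the same piece, so they differ by a constant rotation.
    · have hlift : IsLiftOn π A f (t j) (t (j + 1)) fun τ => u (φ τ) :=
        ((hmono hi).comp hφ.cont hφ.mapsTo hφ.mapsTo_Ioo (fun a ha b hb hab => by
          have ha := Ioo_subset_Icc_self ha
          have hb := Ioo_subset_Icc_self hb
          refine hej.inj ha hb ?_
          rw [← hφ.comp a ha, ← hφ.comp b hb, hab]) hφ.diff).congr
          fun τ hτ => (hφ.comp τ hτ).symm
      obtain ⟨c, hc⟩ := (hmono hj).exists_eq_smul hπ hlift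
      have key : ∀ τ ∈ Icc (t j) (t (j + 1)), g (φ τ) = c * g τ := fun τ hτ => by
        have h1 := hc τ hτ
        rw [hg _ (hP.Icc_subset hi (hφ.mapsTo hτ)), hg τ (hP.Icc_subset hj hτ), hφ.comp τ hτ,
          smul_smul] at h1
        exact hπ.smul_left_injective _ h1
      rw [key _ (hl hj), key _ (hr hj), mul_div_mul_left_eq_div]
  rw [one_smul, ← hu0, hg 0 (by simp), hg 1 (by simp), hmain]
  simp [hf]

variable [FiniteDimensional ℝ E]

/-- Both `α β⁻¹` and `β β⁻¹` are thin, so the holonomies of `α` and `β` are inverse to the same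
element; no formula for reversed loops is needed. -/
theorem IsPrincipalCircleBundle.holonomy_eq_of_thinEquiv [IsManifold I ω M] (hu₀ : π u₀ = x)
    (A : Connection J P) {α β : PALoop I x} (h : ThinEquiv α.1 β.1) :
    holonomy π A u₀ α.1 = holonomy π A u₀ β.1 := by
  have hthin : ∀ γ : PALoop I x, IsThin γ.1 → holonomy π A u₀ γ.1 = 1 := fun γ hγ => by
    obtain ⟨n, t, hP⟩ := exists_isEdgePartition γ.2.hasAnalyticGerms γ.1.extend.continuous
    exact hπ.holonomy_eq_one hu₀ A γ hP fun i hi he => hγ.edgeCount_eq_zero hP hi he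
  have key : ∀ γ : PALoop I x, ThinEquiv γ.1 β.1 →
      holonomy π A u₀ γ.1 * holonomy π A u₀ β.1.symm = 1 := fun γ hγ =>
    (hπ.holonomy_trans hu₀ A γ ⟨β.1.symm, β.2.symm⟩).symm.trans
      (hthin ⟨γ.1.trans β.1.symm, γ.2.trans β.2.symm⟩ hγ)
  exact mul_right_cancel ((key α h).trans (key β (ThinEquiv.refl _)).symm)

end Holonomy

/-! ### Differentials and phase forms -/

section Differential

variable {F : Type*} [NormedAddCommGroup F] [NormedSpace ℝ F]
  {K : Type*} [TopologicalSpace K] {J : ModelWithCorners ℝ F K}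
  {P : Type*} [TopologicalSpace P] [ChartedSpace K P]
  {V : Type*} [NormedAddCommGroup V] [NormedSpace ℝ V]

variable (J) in
/-- The differential of a vector valued function as a vector valued 1-form. -/
def differential (z : P → V) (p : P) : TangentSpace J p →L[ℝ] V := mfderiv J 𝓘(ℝ, V) z p

theorem differential_congr {z z' : P → V} {p : P} (h : z =ᶠ[𝓝 p] z') :
    differential J z p = differential J z' p := h.mfderiv_eq

theorem differential_mfderiv {F' : Type*} [NormedAddCommGroup F'] [NormedSpace ℝ F']
    {K' : Type*} [TopologicalSpace K'] {J' : ModelWithCorners ℝ F' K'}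
    {Q : Type*} [TopologicalSpace Q] [ChartedSpace K' Q] {z : P → V} {u : Q → P} {q : Q}
    (hz : MDifferentiableAt J 𝓘(ℝ, V) z (u q)) (hu : MDifferentiableAt J' J u q)
    (v : TangentSpace J' q) :
    differential J z (u q) (mfderiv J' J u q v) = differential J' (fun r => z (u r)) q v := by
  have : mfderiv J' 𝓘(ℝ, V) (fun r => z (u r)) q = _ := mfderiv_comp q hz hu
  rw [differential, differential, this]
  rfl

theorem differential_real (z : ℝ → V) (t : ℝ) : differential 𝓘(ℝ, ℝ) z t (1 : ℝ) = deriv z t := by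
  have : differential 𝓘(ℝ, ℝ) z t = fderiv ℝ z t := mfderiv_eq_fderiv
  rw [this]
  exact fderiv_apply_one_eq_deriv (f := z)

theorem differential_velocity {z : P → V} {u : ℝ → P} {t : ℝ}
    (hz : MDifferentiableAt J 𝓘(ℝ, V) z (u t)) (hu : MDifferentiableAt 𝓘(ℝ, ℝ) J u t) :
    differential J z (u t) (mfderiv 𝓘(ℝ, ℝ) J u t (1 : ℝ)) = deriv (fun s => z (u s)) t :=
  (differential_mfderiv hz hu (1 : ℝ)).trans (differential_real _ t)

theorem differential_clm_comp {W : Type*} [NormedAddCommGroup W] [NormedSpace ℝ W] (L : V →L[ℝ] W)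
    {z : P → V} {p : P} (hz : MDifferentiableAt J 𝓘(ℝ, V) z p) (v : TangentSpace J p) :
    L (differential J z p v) = differential J (fun q => L (z q)) p v := by
  rw [← differential_mfderiv L.differentiableAt.mdifferentiableAt hz]
  have : differential 𝓘(ℝ, V) L (z p) = L := mfderiv_eq_fderiv.trans L.fderiv
  exact (congrArg (fun T : V →L[ℝ] W => T (mfderiv J 𝓘(ℝ, V) z p v)) this).symm

theorem contMDiffOn_differential [IsManifold J ∞ P] {z : P → V} {s : Set P} (hs : IsOpen s)
    (hz : ContMDiffOn J 𝓘(ℝ, V) ∞ z s) :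
    ContMDiffOn J.tangent 𝓘(ℝ, V) ∞ (fun v : TangentBundle J P => differential J z v.proj v.snd)
      (Bundle.TotalSpace.proj ⁻¹' s) := by
  have h1 := hz.contMDiffOn_tangentMapWithin (m := ∞) (by simp) hs.uniqueMDiffOn
  refine ((contMDiff_snd_tangentBundle_modelSpace V 𝓘(ℝ, V)).comp_contMDiffOn h1).congr
    fun v hv => ?_
  exact congrArg (fun L : TangentSpace J v.proj →L[ℝ] V => L v.snd)
    (mfderivWithin_of_isOpen hs hv).symm

theorem contMDiff_differential [IsManifold J ∞ P] {z : P → V} (hz : ContMDiff J 𝓘(ℝ, V) ∞ z) :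
    ContMDiff J.tangent 𝓘(ℝ, V) ∞
      (fun v : TangentBundle J P => differential J z v.proj v.snd) := by
  have := contMDiffOn_differential isOpen_univ hz.contMDiffOn
  rwa [preimage_univ, contMDiffOn_univ] at this

variable (J) in
/-- The 1-form `z⁻¹ dz / i` for a function `z` of absolute value one. -/
def phaseForm (z : P → ℂ) (p : P) : TangentSpace J p →L[ℝ] ℝ :=
  Complex.imCLM ∘L (starRingEnd ℂ (z p) • differential J z p)

theorem phaseForm_apply (z : P → ℂ) (p : P) (v : TangentSpace J p) :
    phaseForm J z p v = (starRingEnd ℂ (z p) * differential J z p v).im := rfl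

theorem contMDiffOn_phaseForm [IsManifold J ∞ P] {z : P → ℂ} {s : Set P} (hs : IsOpen s)
    (hz : ContMDiffOn J 𝓘(ℝ, ℂ) ∞ z s) :
    ContMDiffOn J.tangent 𝓘(ℝ, ℝ) ∞ (fun v : TangentBundle J P => phaseForm J z v.proj v.snd)
      (Bundle.TotalSpace.proj ⁻¹' s) := by
  have h1 := contMDiffOn_differential hs hz
  have h2 : ContMDiffOn J.tangent 𝓘(ℝ, ℂ) ∞ (fun v : TangentBundle J P => z v.proj)
      (Bundle.TotalSpace.proj ⁻¹' s) :=
    hz.comp (Bundle.contMDiff_proj _).contMDiffOn fun v hv => hv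
  have h3 : ContDiff ℝ ∞ fun w : ℂ × ℂ => (starRingEnd ℂ w.1 * w.2).im :=
    Complex.imCLM.contDiff.comp ((Complex.conjCLE.contDiff.comp contDiff_fst).mul contDiff_snd)
  exact h3.contMDiff.comp_contMDiffOn (h2.prodMk_space h1)

end Differential

/-! ### The phase form satisfies the axioms of a connection locally -/

section Connections

variable {E : Type*} [NormedAddCommGroup E] [NormedSpace ℝ E]
  {H : Type*} [TopologicalSpace H] {I : ModelWithCorners ℝ E H}
  {M : Type*} [TopologicalSpace M] [ChartedSpace H M]
  {F : Type*} [NormedAddCommGroup F] [NormedSpace ℝ F]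
  {K : Type*} [TopologicalSpace K] {J : ModelWithCorners ℝ F K}
  {P : Type*} [TopologicalSpace P] [ChartedSpace K P] [MulAction Circle P]
  {π : P → M} (hπ : IsPrincipalCircleBundle I J π)

include hπ

theorem IsPrincipalCircleBundle.mdifferentiableAt_smul (g : Circle) (p : P) :
    MDifferentiableAt J J (fun q : P => g • q) p :=
  (hπ.smooth_smul.comp (contMDiff_const.prodMk contMDiff_id)).mdifferentiableAt (by simp)

theorem IsPrincipalCircleBundle.mdifferentiableAt_exp_smul (p : P) (a : ℝ) :
    MDifferentiableAt 𝓘(ℝ, ℝ) J (fun θ : ℝ => Circle.exp θ • p) a :=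
  ((contMDiff_exp_smul hπ.smooth_smul).comp
    (contMDiff_id.prodMk contMDiff_const)).mdifferentiableAt (by simp)

variable [T2Space M]

/-- Under `g` both `z` and `dz` are multiplied by `g`, which cancels against its conjugate. -/
theorem IsPrincipalCircleBundle.phaseForm_smul {U : Set M} (hU : IsOpen U) {z : P → ℂ}
    (hz : ContMDiffOn J 𝓘(ℝ, ℂ) ∞ z (π ⁻¹' U))
    (hzg : ∀ (g : Circle), ∀ p ∈ π ⁻¹' U, z (g • p) = g * z p) (g : Circle) {p : P}
    (hp : p ∈ π ⁻¹' U) (v : TangentSpace J p) :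
    phaseForm J z (g • p) (mfderiv J J (fun q : P => g • q) p v) = phaseForm J z p v := by
  have hO : IsOpen (π ⁻¹' U) := hU.preimage hπ.smooth_proj.continuous
  have hd : ∀ q ∈ π ⁻¹' U, MDifferentiableAt J 𝓘(ℝ, ℂ) z q := fun q hq =>
    (hz.contMDiffAt (hO.mem_nhds hq)).mdifferentiableAt (by simp)
  have hgp : g • p ∈ π ⁻¹' U := by rwa [mem_preimage, hπ.proj_smul]
  have h1 := differential_mfderiv (u := fun q : P => g • q) (hd _ hgp)
    (hπ.mdifferentiableAt_smul g p) v
  have h2 : differential J (fun q => z (g • q)) p v = g * differential J z p v := by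
    rw [differential_congr (z' := fun q => ((g : ℂ) • ContinuousLinearMap.id ℝ ℂ) (z q))
      (eventuallyEq_of_mem (hO.mem_nhds hp) fun q hq => hzg g q hq)]
    rw [← differential_clm_comp ((g : ℂ) • ContinuousLinearMap.id ℝ ℂ) (hd p hp)]
    rfl
  rw [phaseForm_apply, h1, h2, hzg g p hp, phaseForm_apply, map_mul, mul_mul_mul_comm,
    ← Circle.coe_inv_eq_conj, ← Circle.coe_mul, inv_mul_cancel, Circle.coe_one, one_mul]

theorem IsPrincipalCircleBundle.phaseForm_vertical {U : Set M} (hU : IsOpen U) {z : P → ℂ}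
    (hz : ContMDiffOn J 𝓘(ℝ, ℂ) ∞ z (π ⁻¹' U)) (hz1 : ∀ p, ‖z p‖ = 1)
    (hzg : ∀ (g : Circle), ∀ p ∈ π ⁻¹' U, z (g • p) = g * z p) {p : P} (hp : p ∈ π ⁻¹' U) :
    phaseForm J z (Circle.exp 0 • p)
      (mfderiv 𝓘(ℝ, ℝ) J (fun θ : ℝ => Circle.exp θ • p) 0 (1 : ℝ)) = 1 := by
  have hO : IsOpen (π ⁻¹' U) := hU.preimage hπ.smooth_proj.continuous
  have hgp : Circle.exp 0 • p ∈ π ⁻¹' U := by rwa [mem_preimage, hπ.proj_smul]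
  have h1 := differential_velocity (u := fun θ : ℝ => Circle.exp θ • p)
    ((hz.contMDiffAt (hO.mem_nhds hgp)).mdifferentiableAt (by simp))
    (hπ.mdifferentiableAt_exp_smul p 0)
  have h2 : HasDerivAt (fun θ : ℝ => z (Circle.exp θ • p)) (Complex.I * z p) 0 := by
    have h3 : HasDerivAt (fun θ : ℝ => Complex.exp (θ * Complex.I) * z p) (Complex.I * z p) 0 := by
      have := (((hasDerivAt_id (0 : ℝ)).ofReal_comp.mul_const Complex.I).cexp).mul_const (z p)
      simpa using this
    refine h3.congr_of_eventuallyEq (Eventually.of_forall fun θ => ?_)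
    dsimp only
    rw [hzg _ p hp, Circle.coe_exp]
  rw [phaseForm_apply, h1, h2.deriv, Circle.exp_zero, one_smul, mul_left_comm,
    ← Complex.normSq_eq_conj_mul_self, Complex.normSq_eq_norm_sq, hz1]
  simp

end Connections

/-! ### Existence of connections and perturbation by 1-forms -/

section ConnectionSpace

variable {E : Type*} [NormedAddCommGroup E] [NormedSpace ℝ E]
  {H : Type*} [TopologicalSpace H] {I : ModelWithCorners ℝ E H}
  {M : Type*} [TopologicalSpace M] [ChartedSpace H M]
  {F : Type*} [NormedAddCommGroup F] [NormedSpace ℝ F]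
  {K : Type*} [TopologicalSpace K] {J : ModelWithCorners ℝ F K}
  {P : Type*} [TopologicalSpace P] [ChartedSpace K P] [MulAction Circle P] [IsManifold J ∞ P]
  {π : P → M} [T2Space M] (hπ : IsPrincipalCircleBundle I J π)

include hπ

/-- The axioms are affine in the form, so a partition of unity on `M` glues the local phase forms.
Without some connection, triviality of all holonomies would say nothing about a loop. -/
theorem IsPrincipalCircleBundle.nonempty_connection [FiniteDimensional ℝ E] [IsManifold I ∞ M]
    [SigmaCompactSpace M] : Nonempty (Connection J P) := by
  choose U z hU hmem hz hz1 hzg using hπ.exists_local_phase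
  obtain ⟨ρ, hρ⟩ := SmoothPartitionOfUnity.exists_isSubordinate I isClosed_univ U hU
    fun y _ => mem_iUnion.2 ⟨y, hmem y⟩
  have hπU : ∀ {i : M} {p : P}, ρ i (π p) ≠ 0 → p ∈ π ⁻¹' U i := fun {i p} h =>
    hρ i (subset_tsupport _ h)
  have hsupp : ∀ {i : M} {y : M}, i ∈ ρ.finsupport y → ρ i y ≠ 0 := fun {i y} h => by
    simpa [SmoothPartitionOfUnity.mem_finsupport] using h
  have hval : ∀ (p : P) (v : TangentSpace J p),
      (∑ i ∈ ρ.finsupport (π p), ρ i (π p) • phaseForm J (z i) p) v =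
        ∑ i ∈ ρ.finsupport (π p), ρ i (π p) * phaseForm J (z i) p v := fun p v => by
    rw [sum_apply]
    rfl
  refine ⟨⟨fun p => ∑ i ∈ ρ.finsupport (π p), ρ i (π p) • phaseForm J (z i) p, ?_, ?_, ?_⟩⟩
  -- The index set of the finite sum varies with the point; as a locally finite `finsum` over a
  -- fixed index set it can be differentiated.
  · have hfin : (fun v : TangentBundle J P => (∑ i ∈ ρ.finsupport (π v.proj),
        ρ i (π v.proj) • phaseForm J (z i) v.proj) v.snd) =
        fun v => ∑ᶠ i, ρ i (π v.proj) * phaseForm J (z i) v.proj v.snd := by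
      funext v
      rw [hval, finsum_eq_sum_of_support_subset]
      intro i hi
      rw [SmoothPartitionOfUnity.coe_finsupport]
      exact left_ne_zero_of_mul hi
    rw [hfin]
    have hproj : ContMDiff J.tangent I ∞ fun v : TangentBundle J P => π v.proj :=
      hπ.smooth_proj.comp (Bundle.contMDiff_proj _)
    refine contMDiff_finsum (fun i => ?_) ?_
    · intro v
      by_cases hv : π v.proj ∈ tsupport (ρ i)
      · have hO : IsOpen (π ⁻¹' U i) := (hU i).preimage hπ.smooth_proj.continuous
        have h1 := (contMDiffOn_phaseForm hO (hz i)).contMDiffAt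
          ((hO.preimage (FiberBundle.continuous_proj F (TangentSpace J))).mem_nhds (hρ i hv))
        exact (((ρ i).contMDiff.comp hproj).contMDiffAt).mul h1
      · have h0 : (fun v : TangentBundle J P => ρ i (π v.proj) * phaseForm J (z i) v.proj v.snd)
            =ᶠ[𝓝 v] fun _ => 0 := by
          filter_upwards [hproj.continuous.continuousAt.preimage_mem_nhds
            ((isClosed_tsupport _).isOpen_compl.mem_nhds hv)] with w hw
          rw [image_eq_zero_of_notMem_tsupport hw, zero_mul]
        exact contMDiffAt_const.congr_of_eventuallyEq h0
    · refine (ρ.locallyFinite.preimage_continuous hproj.continuous).subset fun i v hv => ?_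
      exact left_ne_zero_of_mul hv
  · intro g p v
    rw [hval, hval, hπ.proj_smul]
    refine Finset.sum_congr rfl fun i hi => ?_
    rw [hπ.phaseForm_smul (hU i) (hz i) (hzg i) g (hπU (hsupp hi))]
  · intro p
    rw [hval, hπ.proj_smul]
    refine (Finset.sum_congr rfl fun i hi => ?_).trans (ρ.sum_finsupport (π p) (mem_univ _))
    rw [hπ.phaseForm_vertical (hU i) (hz i) (hz1 i) (hzg i) (hπU (hsupp hi)), mul_one]

/-- Adding a basic 1-form `ψ dh` to a connection. -/
theorem IsPrincipalCircleBundle.exists_connection_add (A : Connection J P) {ψ h : M → ℝ}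
    (hψ : ContMDiff I 𝓘(ℝ, ℝ) ∞ ψ) (hh : ContMDiff I 𝓘(ℝ, ℝ) ∞ h) :
    ∃ A' : Connection J P, ∀ (u : ℝ → P) (t : ℝ), MDifferentiableAt 𝓘(ℝ, ℝ) J u t →
      A'.along u t = A.along u t + ψ (π (u t)) * deriv (fun s => h (π (u s))) t := by
  have hhπ : ContMDiff J 𝓘(ℝ, ℝ) ∞ fun p => h (π p) := hh.comp hπ.smooth_proj
  have hhd : ∀ p, MDifferentiableAt J 𝓘(ℝ, ℝ) (fun p => h (π p)) p := fun p =>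
    hhπ.mdifferentiableAt (by simp)
  have hval : ∀ (p : P) (v : TangentSpace J p),
      (A.form p + ψ (π p) • differential J (fun p => h (π p)) p) v =
        A.form p v + ψ (π p) * differential J (fun p => h (π p)) p v := fun p v => rfl
  refine ⟨⟨fun p => A.form p + ψ (π p) • differential J (fun p => h (π p)) p, ?_, ?_, ?_⟩,
    fun u t hu => ?_⟩
  · have h1 : ContMDiff J.tangent 𝓘(ℝ, ℝ) ∞ fun v : TangentBundle J P => ψ (π v.proj) :=
      (hψ.comp hπ.smooth_proj).comp (Bundle.contMDiff_proj _)
    exact A.smooth_form.add (h1.mul (contMDiff_differential hhπ))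
  · intro g p v
    rw [hval, hval, A.invariant, hπ.proj_smul,
      differential_mfderiv (u := fun q : P => g • q) (hhd _) (hπ.mdifferentiableAt_smul g p)]
    simp only [hπ.proj_smul]
  · intro p
    rw [hval, A.form_vertical, differential_velocity (u := fun θ : ℝ => Circle.exp θ • p) (hhd _)
      (hπ.mdifferentiableAt_exp_smul p 0)]
    simp only [hπ.proj_smul, deriv_const, mul_zero, add_zero]
  · rw [Connection.along, hval, differential_velocity (hhd _) hu]
    rfl

end ConnectionSpace

/-! ### Holonomies detect the counts -/

section Detection

variable {E : Type*} [NormedAddCommGroup E] [NormedSpace ℝ E]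
  {H : Type*} [TopologicalSpace H] {I : ModelWithCorners ℝ E H}
  {M : Type*} [TopologicalSpace M] [ChartedSpace H M]

theorem IsEdgePartition.exists_mem_Icc {f : ℝ → M} {n : ℕ} {t : ℕ → ℝ}
    (hP : IsEdgePartition I f n t) {τ : ℝ} (hτ : τ ∈ Icc (0 : ℝ) 1) :
    ∃ j < n, τ ∈ Icc (t j) (t (j + 1)) := by
  have key : ∀ k, 0 < k → τ ≤ t k → ∃ j < k, τ ∈ Icc (t j) (t (j + 1)) := by
    intro k hk
    induction k, hk using Nat.le_induction with
    | base => exact fun h => ⟨0, zero_lt_one, hP.zero.le.trans hτ.1, h⟩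
    | succ k hk ih =>
      intro h
      rcases le_total τ (t k) with h' | h'
      · obtain ⟨j, hj, hm⟩ := ih h'
        exact ⟨j, hj.trans (Nat.lt_succ_self k), hm⟩
      · exact ⟨k, Nat.lt_succ_self k, h', h⟩
  refine key n (Nat.pos_of_ne_zero ?_) (hτ.2.trans hP.one.ge)
  rintro rfl
  exact zero_ne_one (hP.zero.symm.trans hP.one)

/-- A germ of an analytic function is the germ of a global smooth function. -/
theorem exists_contMDiff_eventuallyEq [FiniteDimensional ℝ E] [T2Space M] [IsManifold I ω M]
    {h : M → ℝ} {y : M} (hh : ContMDiffAt I 𝓘(ℝ, ℝ) ω h y) :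
    ∃ h' : M → ℝ, ContMDiff I 𝓘(ℝ, ℝ) ∞ h' ∧ h' =ᶠ[𝓝 y] h := by
  have : IsManifold I ∞ M := .of_le (n := ω) le_top
  obtain ⟨N, hN, hhN⟩ := (contMDiffAt_iff_contMDiffOn_nhds (by simp)).1 hh
  obtain ⟨χ, -, hχ⟩ := (SmoothBumpFunction.nhds_basis_tsupport (I := I) y).mem_iff.1
    (interior_mem_nhds.2 hN)
  refine ⟨fun q => χ q * h q, contMDiff_of_tsupport fun q hq => ?_, ?_⟩
  · have hqN := hχ (tsupport_mul_subset_left hq)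
    exact χ.contMDiffAt.mul
      ((hhN.contMDiffAt (mem_interior_iff_mem_nhds.1 hqN)).of_le le_top)
  · filter_upwards [χ.eventuallyEq_one] with q hq
    rw [hq, Pi.one_apply, one_mul]

theorem contDiffAt_comp_curve {f : ℝ → M} {h : M → ℝ} (hh : ContMDiff I 𝓘(ℝ, ℝ) ∞ h) {τ : ℝ}
    (hf : ContMDiffAt 𝓘(ℝ, ℝ) I ω f τ) : ContDiffAt ℝ ∞ (fun s => h (f s)) τ :=
  contMDiffAt_iff_contDiffAt.1 (ContMDiffAt.comp τ hh.contMDiffAt (hf.of_le le_top))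

/-- The derivative of `h ∘ f` may jump at corners of `f`; these lie off the support of `ψ`, where
the product vanishes. -/
theorem continuous_mul_deriv_comp {f : ℝ → M} (hfc : Continuous f) {ψ h : M → ℝ}
    (hψ : Continuous ψ) (hh : ContMDiff I 𝓘(ℝ, ℝ) ∞ h)
    (hf : ∀ τ, f τ ∈ tsupport ψ → ContMDiffAt 𝓘(ℝ, ℝ) I ω f τ) :
    Continuous fun τ => ψ (f τ) * deriv (fun s => h (f s)) τ := by
  rw [continuous_iff_continuousAt]
  intro τ
  by_cases hτ : f τ ∈ tsupport ψ
  · exact (hψ.comp hfc).continuousAt.mul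
      ((contDiffAt_comp_curve hh (hf τ hτ)).derivWithin (m := 0) (by simp)).continuousAt
  · refine (continuousAt_const (y := (0 : ℝ))).congr ?_
    filter_upwards [hfc.continuousAt.preimage_mem_nhds
      ((isClosed_tsupport ψ).isOpen_compl.mem_nhds hτ)] with s hs
    rw [image_eq_zero_of_notMem_tsupport hs, zero_mul]

/-- Total multiplicities of edges are detected by the integrals of smooth 1-forms `ψ dh`. -/
theorem IsEdgePartition.edgeCount_eq_zero [FiniteDimensional ℝ E] [T2Space M] [IsManifold I ω M]
    {x : M} {α : Path x x} {n : ℕ} {t : ℕ → ℝ} (hP : IsEdgePartition I α.extend n t)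
    (hintg : ∀ ψ h : M → ℝ, ContMDiff I 𝓘(ℝ, ℝ) ∞ ψ → ContMDiff I 𝓘(ℝ, ℝ) ∞ h → ∀ B : ℝ → ℝ,
      (∀ τ, HasDerivAt B (ψ (α.extend τ) * deriv (fun s => h (α.extend s)) τ) τ) → B 1 = B 0)
    {i : ℕ} (hi : i < n) (he : IsEdge I α.extend (t i) (t (i + 1))) :
    edgeCount α.extend n t i = 0 := by
  have : IsManifold I ∞ M := .of_le (n := ω) le_top
  set f := α.extend with hf
  have hfc : Continuous f := f.continuous
  have hm := hP.mid_mem hi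
  set m := (t i + t (i + 1)) / 2
  obtain ⟨h₀, hh₀, hpos₀⟩ := he.immersive m hm
  obtain ⟨h, hh, hheq⟩ := exists_contMDiff_eventuallyEq hh₀
  have hpos : 0 < deriv (fun s => h (f s)) m := by
    have heq : (fun s => h (f s)) =ᶠ[𝓝 m] fun s => h₀ (f s) :=
      hfc.continuousAt.eventually hheq
    rwa [heq.deriv_eq]
  have hdiff : ∀ τ ∈ Ioo (t i) (t (i + 1)), ContDiffAt ℝ ∞ (fun s => h (f s)) τ := fun τ hτ =>
    contDiffAt_comp_curve hh (he.analytic τ hτ)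
  have hdc : ContinuousAt (deriv fun s => h (f s)) m :=
    ((hdiff m hm).derivWithin (m := 0) (by simp)).continuousAt
  -- `O` is an interval around the midpoint, inside the open edge, on which `h` increases along the
  -- curve.
  obtain ⟨δ, hδ, hball⟩ := Metric.mem_nhds_iff.1
    (inter_mem (isOpen_Ioo.mem_nhds hm) (hdc.preimage_mem_nhds (Ioi_mem_nhds hpos)))
  set O := Metric.ball m δ
  have hmO : m ∈ O := Metric.mem_ball_self hδ
  -- the part of the image that the support of the form has to avoid
  set C : Set M := (⋃ j ∈ {j | j < n ∧ Disjoint (f '' Ioo (t i) (t (i + 1)))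
    (f '' Icc (t j) (t (j + 1)))}, f '' Icc (t j) (t (j + 1))) ∪ f '' (Icc (t i) (t (i + 1)) \ O)
    with hC
  have hCc : IsClosed C := by
    refine IsClosed.union (Finite.isClosed_biUnion ((finite_lt_nat n).subset fun j hj => hj.1)
      fun j _ => (isCompact_Icc.image hfc).isClosed) ?_
    exact ((isCompact_Icc.diff Metric.isOpen_ball).image hfc).isClosed
  have hmC : f m ∉ C := by
    rintro (h1 | ⟨τ, hτ, hτm⟩)
    · obtain ⟨j, hj, h2⟩ := mem_iUnion₂.1 h1
      exact Set.disjoint_left.1 hj.2 ⟨m, hm, rfl⟩ h2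
    · exact hτ.2 (he.inj hτ.1 (Ioo_subset_Icc_self hm) hτm ▸ hmO)
  -- The support of `ψ` avoids `C`, so `ψ dh` vanishes on all pieces disjoint from the open edge and
  -- is nonnegative along the edge, with positive integral.
  obtain ⟨ψ, -, hψC⟩ := (SmoothBumpFunction.nhds_basis_tsupport (I := I) (f m)).mem_iff.1
    (hCc.isOpen_compl.mem_nhds hmC)
  have hψ0 : ∀ τ, f τ ∈ C → ψ (f τ) = 0 := fun τ hτ =>
    image_eq_zero_of_notMem_tsupport fun h => hψC h hτ
  have hdis : ∀ j < n, Disjoint (f '' Ioo (t i) (t (i + 1))) (f '' Icc (t j) (t (j + 1))) →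
      ∀ τ ∈ Icc (t j) (t (j + 1)), f τ ∈ C := fun j hj hd τ hτ =>
    Or.inl (mem_iUnion₂.2 ⟨j, ⟨hj, hd⟩, τ, hτ, rfl⟩)
  have hends : f (t i) ∈ C ∧ f (t (i + 1)) ∈ C := by
    have hle := (hP.lt i hi).le
    exact ⟨Or.inr ⟨_, ⟨left_mem_Icc.2 hle, fun h => (hball h).1.1.false⟩, rfl⟩,
      Or.inr ⟨_, ⟨right_mem_Icc.2 hle, fun h => (hball h).1.2.false⟩, rfl⟩⟩
  have hsupp : ∀ τ ∈ Icc (0 : ℝ) 1, f τ ∈ tsupport ψ →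
      ∃ j < n, τ ∈ Ioo (t j) (t (j + 1)) ∧ IsEdge I f (t j) (t (j + 1)) := by
    intro τ hτ hψτ
    obtain ⟨j, hj, hτj⟩ := hP.exists_mem_Icc hτ
    rcases hP.disjoint_or i hi he j hj with hd | ⟨hej, φ, hφ⟩
    · exact (hψC hψτ (hdis j hj hd τ hτj)).elim
    · have hφe : φ τ ≠ t i ∧ φ τ ≠ t (i + 1) := by
        constructor <;> intro h <;> refine hψC hψτ ?_ <;> rw [← hφ.comp τ hτj, h]
        exacts [hends.1, hends.2]
      refine ⟨j, hj, ⟨lt_of_le_of_ne hτj.1 ?_, lt_of_le_of_ne hτj.2 ?_⟩, hej⟩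
      · rintro rfl
        rcases hφ.ends with h | h
        exacts [hφe.1 h.1, hφe.2 h.1]
      · rintro rfl
        rcases hφ.ends with h | h
        exacts [hφe.2 h.2, hφe.1 h.2]
  -- Outside `[0, 1]` the extended loop rests at an end point, whose image is off the support.
  have han : ∀ τ, f τ ∈ tsupport ψ → ContMDiffAt 𝓘(ℝ, ℝ) I ω f τ := by
    intro τ hψτ
    rcases lt_or_ge τ 0 with h | h
    · have : f τ = f 0 := by rw [hf, α.extend_of_le_zero h.le, α.extend_zero]
      obtain ⟨j, hj, hj0, -⟩ := hsupp 0 (by simp) (this ▸ hψτ)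
      exact (hj0.1.not_ge (hP.mem_Icc hj.le).1).elim
    rcases lt_or_ge 1 τ with h' | h'
    · have : f τ = f 1 := by rw [hf, α.extend_of_one_le h'.le, α.extend_one]
      obtain ⟨j, hj, hj0, -⟩ := hsupp 1 (by simp) (this ▸ hψτ)
      exact (hj0.2.not_ge (hP.mem_Icc (Nat.succ_le_of_lt hj)).2).elim
    obtain ⟨j, -, hτj, hej⟩ := hsupp τ ⟨h, h'⟩ hψτ
    exact hej.analytic τ hτj
  set b : ℝ → ℝ := fun τ => ψ (f τ) * deriv (fun s => h (f s)) τ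
  have hb : ∀ τ, b τ = ψ (f τ) * deriv (fun s => h (f s)) τ := fun _ => rfl
  have hbc : Continuous b := continuous_mul_deriv_comp hfc ψ.continuous hh han
  set B : ℝ → ℝ := fun τ => ∫ s in (0 : ℝ)..τ, b s with hB
  have hBd : ∀ τ, HasDerivAt B (b τ) τ := fun τ => (hbc.integral_hasStrictDerivAt 0 τ).hasDerivAt
  have hBc : Continuous B := continuous_iff_continuousAt.2 fun τ => (hBd τ).continuousAt
  have hincr : 0 < B (t (i + 1)) - B (t i) := by
    rw [hB, intervalIntegral.integral_interval_sub_left (hbc.intervalIntegrable _ _)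
      (hbc.intervalIntegrable _ _)]
    refine intervalIntegral.integral_pos (hP.lt i hi) hbc.continuousOn (fun τ hτ => ?_)
      ⟨m, Ioo_subset_Icc_self hm, ?_⟩
    · by_cases hτO : τ ∈ O
      · exact mul_nonneg ψ.nonneg (hball hτO).2.le
      · rw [hb, hψ0 τ (Or.inr ⟨τ, ⟨Ioc_subset_Icc_self hτ, hτO⟩, rfl⟩), zero_mul]
    · rw [hb, ψ.eq_one, one_mul]
      exact hpos
  -- Additively, the total integral of the form is the count times its positive integral over the
  -- chosen edge; the invariance needed for this is the chain rule.
  have hmain := hP.div_eq_zpow_edgeCount (fun τ => Multiplicative.ofAdd (B τ)) hi he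
    (fun j hj φ hφ => ?_) (fun j hj hd => ?_)
  · simp only [hintg ψ h ψ.contMDiff hh B hBd, div_self'] at hmain
    rw [← ofAdd_sub, ← ofAdd_zsmul, ← ofAdd_zero, Multiplicative.ofAdd.injective.eq_iff, eq_comm,
      smul_eq_zero] at hmain
    exact hmain.resolve_right hincr.ne'
  · have key := eq_of_hasDerivAt_zero_off_finite (g := fun τ => B (φ τ) - B τ)
      ((hBc.comp_continuousOn hφ.cont).sub hBc.continuousOn) finite_empty (fun τ hτ _ => ?_)
      (right_mem_Icc.2 (hP.lt j hj).le)
    · simp only [← ofAdd_sub, Multiplicative.ofAdd.injective.eq_iff]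
      linarith
    · have hφd := (hφ.diff τ hτ).hasDerivAt
      have h1 := ((hBd (φ τ)).comp τ hφd).sub (hBd τ)
      have h2 : deriv (fun s => h (f s)) τ = deriv (fun s => h (f s)) (φ τ) * deriv φ τ := by
        have h3 := ((hdiff _ (hφ.mapsTo_Ioo hτ)).differentiableAt (by simp)).hasDerivAt.comp τ hφd
        rw [← h3.deriv]
        refine EventuallyEq.deriv_eq ?_
        filter_upwards [isOpen_Ioo.mem_nhds hτ] with s hs
        rw [Function.comp_apply, hφ.comp s (Ioo_subset_Icc_self hs)]
      have h4 : b (φ τ) * deriv φ τ - b τ = 0 := by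
        rw [hb, hb, hφ.comp τ (Ioo_subset_Icc_self hτ), h2]
        ring
      rw [h4] at h1
      exact h1
  · have key := eq_of_hasDerivAt_zero_off_finite (g := B) hBc.continuousOn finite_empty
      (fun τ hτ _ => ?_) (right_mem_Icc.2 (hP.lt j hj).le)
    · simp only [key]
    · have h1 := hBd τ
      rwa [hb, hψ0 τ (hdis j hj hd τ (Ioo_subset_Icc_self hτ)), zero_mul] at h1

variable {F : Type*} [NormedAddCommGroup F] [NormedSpace ℝ F]
  {K : Type*} [TopologicalSpace K] {J : ModelWithCorners ℝ F K}
  {P : Type*} [TopologicalSpace P] [ChartedSpace K P] [MulAction Circle P] [IsManifold J ∞ P]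
  {π : P → M} {x : M} {u₀ : P} [T2Space M] (hπ : IsPrincipalCircleBundle I J π)

include hπ

/-- Adding the 1-form `ψ dh` to a connection changes the holonomy by the exponential of its
integral. -/
theorem IsPrincipalCircleBundle.exists_holonomy_eq_exp_mul [IsManifold I ω M] (hu₀ : π u₀ = x)
    (A : Connection J P) (α : PALoop I x) {ψ h : M → ℝ} (hψ : ContMDiff I 𝓘(ℝ, ℝ) ∞ ψ)
    (hh : ContMDiff I 𝓘(ℝ, ℝ) ∞ h) {B : ℝ → ℝ} (hB : ∀ τ, HasDerivAt B
      (ψ (α.1.extend τ) * deriv (fun s => h (α.1.extend s)) τ) τ) :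
    ∃ A' : Connection J P,
      holonomy π A' u₀ α.1 = Circle.exp (B 1 - B 0) * holonomy π A u₀ α.1 := by
  obtain ⟨A', hA'⟩ := hπ.exists_connection_add A hψ hh
  obtain ⟨u, hu, hu0, hu1⟩ := hπ.exists_lift_holonomy hu₀ A α
  have hBc : Continuous B := continuous_iff_continuousAt.2 fun τ => (hB τ).continuousAt
  have hlift : IsLiftOn π A' α.1.extend 0 1 fun τ => Circle.exp (B 0 - B τ) • u τ := by
    obtain ⟨S, hS, hh'⟩ := hu.horizontal
    refine ⟨?_, fun τ hτ => by rw [hπ.proj_smul, hu.proj τ hτ], S, hS, fun τ hτ hτS => ?_⟩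
    · exact (contMDiff_exp_smul hπ.smooth_smul).continuous.comp_continuousOn
        ((continuous_const.sub hBc).continuousOn.prodMk hu.cont)
    · obtain ⟨h1, h2⟩ := hh' τ hτ hτS
      obtain ⟨h3, h4⟩ := A'.along_exp_smul hπ.smooth_smul h1 ((hB τ).const_sub (B 0))
      refine ⟨h3, ?_⟩
      have h5 : (fun s => h (π (u s))) =ᶠ[𝓝 τ] fun s => h (α.1.extend s) := by
        filter_upwards [Icc_mem_nhds hτ.1 hτ.2] with s hs
        rw [hu.proj s hs]
      rw [h4, hA' u τ h1, h2, hu.proj τ (Ioo_subset_Icc_self hτ), h5.deriv_eq, zero_add,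
        add_neg_cancel]
  refine ⟨A', hπ.holonomy_eq hu₀ A' α hlift (by simpa using hu0) ?_⟩
  rw [smul_smul, mul_right_comm, ← Circle.exp_add, sub_add_sub_cancel, sub_self, Circle.exp_zero,
    one_mul, ← hu1]

/-- If all connections have trivial holonomy around a loop, the loop passes each edge with total
multiplicity zero. -/
theorem IsPrincipalCircleBundle.edgeCount_eq_zero [FiniteDimensional ℝ E] [IsManifold I ω M]
    [SigmaCompactSpace M] (hu₀ : π u₀ = x) (α : PALoop I x)
    (hα : ∀ A : Connection J P, holonomy π A u₀ α.1 = 1) {n : ℕ} {t : ℕ → ℝ}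
    (hP : IsEdgePartition I α.1.extend n t) {i : ℕ} (hi : i < n)
    (he : IsEdge I α.1.extend (t i) (t (i + 1))) : edgeCount α.1.extend n t i = 0 := by
  have : IsManifold I ∞ M := .of_le (n := ω) le_top
  obtain ⟨A⟩ := hπ.nonempty_connection
  refine hP.edgeCount_eq_zero (fun ψ h hψ hh B hB => ?_) hi he
  by_contra hne
  have hne' : B 1 - B 0 ≠ 0 := sub_ne_zero.2 hne
  -- The form is scaled to have integral `π`, so the holonomy would change by the factor `-1`.
  set c := Real.pi / (B 1 - B 0) with hc
  obtain ⟨A', hA'⟩ := hπ.exists_holonomy_eq_exp_mul hu₀ A α (contMDiff_const.mul hψ) hh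
    (ψ := fun q => c * ψ q) (B := fun τ => c * B τ) fun τ => by
      simpa only [mul_assoc] using (hB τ).const_mul c
  rw [hα, hα, mul_one, ← mul_sub, hc, div_mul_cancel₀ _ hne'] at hA'
  have := congrArg (fun z : Circle => (z : ℂ)) hA'
  simp only [Circle.coe_one, Circle.coe_exp, Complex.exp_pi_mul_I] at this
  norm_num at this

end Detection

end LoopHoop

end

/-! ### Assembly of the theorem -/

open LoopHoop in
/-- `M` is a real analytic manifold, `π : P → M` a smooth principal `U(1)`-bundle, `u₀` a point of
the fibre over the base point `x`. Holonomies exist and are unique, the Wilson functions form a group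
under pointwise multiplication, and `α ↦ T_α` descends to a homomorphism on the group of loops whose
kernel is the commutator subgroup. -/
theorem mainTheorem3
    {E : Type*} [NormedAddCommGroup E] [NormedSpace ℝ E] [FiniteDimensional ℝ E]
    {H : Type*} [TopologicalSpace H] (I : ModelWithCorners ℝ E H) [I.Boundaryless]
    {M : Type*} [TopologicalSpace M] [ChartedSpace H M] [IsManifold I ω M]
    [T2Space M] [SecondCountableTopology M]
    {F : Type*} [NormedAddCommGroup F] [NormedSpace ℝ F] [FiniteDimensional ℝ F]
    {K : Type*} [TopologicalSpace K] (J : ModelWithCorners ℝ F K) [J.Boundaryless]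
    {P : Type*} [TopologicalSpace P] [ChartedSpace K P] [IsManifold J ∞ P]
    [MulAction Circle P] (π : P → M) (hπ : IsPrincipalCircleBundle I J π)
    (x : M) (u₀ : P) (hu₀ : π u₀ = x) :
    (∀ (A : Connection J P) (α : PALoop I x), ∃! g : Circle, IsHolonomy π A u₀ α.1 g) ∧
    ∃ _ : Group (Hoop I J π u₀ x),
      (∀ f g : Hoop I J π u₀ x,
        ((f * g : Hoop I J π u₀ x) : Connection J P → ℂ) = fun A => f.1 A * g.1 A) ∧
      ∃ τ : LoopGroup I x →* Hoop I J π u₀ x,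
        (∀ α : PALoop I x, (τ (LoopGroup.mk α) : Connection J P → ℂ) = wilson J π u₀ α) ∧
        τ.ker = commutator (LoopGroup I x) := by
  refine ⟨hπ.existsUnique_isHolonomy hu₀, ?_⟩
  -- Together with second countability this yields the σ-compactness needed for partitions of unity.
  have : LocallyCompactSpace M := Manifold.locallyCompact_of_finiteDimensional I
  let σ : LoopGroup I x →* (Connection J P → Circle) := MonoidHom.mk'
    (Quot.lift (fun α A => holonomy π A u₀ α.1)
      fun _ _ h => funext fun A => hπ.holonomy_eq_of_thinEquiv hu₀ A h)
    (by
      rintro ⟨α⟩ ⟨β⟩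
      exact funext fun A => hπ.holonomy_trans hu₀ A α β)
  have hσ : ∀ α : PALoop I x, σ (LoopGroup.mk α) = fun A => holonomy π A u₀ α.1 := fun _ => rfl
  -- Wilson functions are the elements of the range of the circle-valued homomorphism `σ`, read in
  -- `ℂ`. The group structure of the range is carried over, and the kernel of `τ` is that of `σ`.
  let e : σ.range ≃ Hoop I J π u₀ x := Equiv.ofBijective
    (fun k => ⟨fun A => (k.1 A : ℂ), by
      obtain ⟨_, ⟨α⟩, rfl⟩ := k
      exact ⟨α, rfl⟩⟩)
    ⟨fun k k' h => Subtype.ext <| funext fun A =>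
        Circle.ext (congrFun (congrArg Subtype.val h) A), by
      rintro ⟨_, α, rfl⟩
      exact ⟨⟨_, LoopGroup.mk α, rfl⟩, rfl⟩⟩
  have he : ∀ (k : σ.range) (A : Connection J P), (e k).1 A = (k.1 A : ℂ) := fun _ _ => rfl
  let : Group (Hoop I J π u₀ x) := e.symm.group
  have hmul : ∀ f g : Hoop I J π u₀ x, f * g = e (e.symm f * e.symm g) := fun _ _ => rfl
  let e' : σ.range ≃* Hoop I J π u₀ x := MulEquiv.mk' e fun k l => by
    rw [hmul, e.symm_apply_apply, e.symm_apply_apply]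
  refine ⟨inferInstance, fun f g => funext fun A => ?_,
    (e' : σ.range →* Hoop I J π u₀ x).comp σ.rangeRestrict, fun α => rfl, ?_⟩
  · obtain ⟨k, rfl⟩ := e.surjective f
    obtain ⟨l, rfl⟩ := e.surjective g
    rw [hmul, e.symm_apply_apply, e.symm_apply_apply, he, he, he]
    simp
  · rw [MonoidHom.ker_mulEquiv_comp, MonoidHom.ker_rangeRestrict]
    refine le_antisymm ?_ (Abelianization.commutator_subset_ker σ)
    rintro ⟨α⟩ hα
    obtain ⟨n, t, hP⟩ := exists_isEdgePartition α.2.hasAnalyticGerms α.1.extend.continuous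
    exact mem_commutator_of_edgeCount_eq_zero α hP fun i hi hei =>
      hπ.edgeCount_eq_zero hu₀ α (fun A => congrFun ((hσ α).symm.trans hα) A) hP hi hei
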